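/- Let $L(p)=p+\operatorname{sgn}p$ be the maximal monotone multivalued map with $L(0)=[-1,1]$, let $I=(0,1)$, and for $\beta\ge 0$ put $$f_\beta(x)=4+\beta\,[-2\chi_{[3/8,5/8]}(x)+\chi_{[1/4,3/4]}(x)].$$ A steady solution of $L(v_x)_x=f$ in $I$, $v(0)=v(1)=0$, is an absolutely continuous $v$ on $[0,1]$ vanishing at $0$ and $1$ for which there is $\sigma\in L_1(I)$ with $\sigma(x)\in L(v_x(x))$ a.e. and $\sigma_x=f$ in $\mathcal D'(I)$. A weak solution on $I\times(0,T)$ of $u_t-L(u_x)_x=F$, $u(0,t)=u(1,t)=0$, $u|_{t=0}=u_0$, is a function $u\in L_\infty(0,T;L_2(I))$ with $u(\cdot,t)\in W^{1,1}_0(I)$ for a.e. $t$ for which there is $\sigma\in L_1(0,T;L_1(I))$ with $\sigma\in L(u_x)$ a.e. and $$\int_0^T\!\!\int_I(-u\,\phi_t+\sigma\,\phi_x)\,dx\,dt=\int_0^T\!\!\int_I F\phi\,dx\,dt+\int_I u_0\,\phi(\cdot,0)\,dx$$ for all smooth $\phi$ with compact support in $I\times[0,T)$; it is a weak solution on $I\times(0,\infty)$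 if this holds for every $T>0$. A facet of a function on $[0,1]$ is a maximal nondegenerate interval on which it is constant. Let $\alpha>12$. The steady problems with forces $4$ and $f_\alpha$ have unique steady solutions $u_0$ and $u_\alpha$, respectively. The only facet of $u_0$ is $[1/4,3/4]$. The function $u_\alpha$ is symmetric about $x=1/2$, and there are $1/4<c<3/8<e<1/2<f<5/8<d<3/4$ such that its facets are exactly $[1/4,c]$, $[e,f]$ and $[d,3/4]$; $u_\alpha$ is strictly decreasing on $[0,1/4]$ and $[f,d]$ and strictly increasing on $[c,e]$ and $[3/4,1]$, so that its interior minima are attained on $[1/4,c]$ and $[d,3/4]$ and its interior maximum on $[e,f]$. Consider $$u_t-L(u_x)_x=-f_{\min\{t,\alpha\}}(x)\ \text{ in } I\times(0,\infty),\qquad u(0,t)=u(1,t)=0,\qquad u|_{t=0}=u_0 .$$ The function $u(x,t)=u_0(x)$ is a weak solution of this problem on $I\times(0,12)$. Every weak solution $u$ on $I\times(0,\infty)$ is, after modification on a null set of times, continuous on $[0,1]\times[0,\infty)$; it then satisfies $u(x,t)=u_0(x)$ for all $x\in[0,1]$ and $0\le t\le 12$, and, as $t\to\infty$, $u(\cdot,t)\to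 u_\alpha$ uniformly on $[0,1]$ and exponentially in $L_2(I)$: $\|u(\cdot,t)-u_\alpha\|_{L_2(I)}\le Ce^{-rt}$ for all $t\ge 0$, with constants $C$ and $r>0$ depending only on $\alpha$. -/

import Mathlib

open Set Filter Topology MeasureTheory
open scoped ContDiff NNReal ENNReal

namespace FacetBreaking

/-- The maximal monotone graph of the sign function: `{-1}` for `p < 0`, `[-1, 1]` for `p = 0`
and `{1}` for `p > 0`. -/
def sgnGraph (p : ℝ) : Set ℝ :=
  {s | (p < 0 → s = -1) ∧ (p = 0 → s ∈ Icc (-1) 1) ∧ (0 < p → s = 1)}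

/-- The multivalued operator `L(p) = p + sgn p`. -/
def L₁ (p : ℝ) : Set ℝ := {q | ∃ s ∈ sgnGraph p, q = p + s}

/-- `v` belongs to `W^{1,1}_0(0,1)`: it is absolutely continuous on `[0,1]` and vanishes at
both ends. Its weak derivative is then the a.e. defined classical derivative. -/
def ZeroDirichlet (v : ℝ → ℝ) : Prop :=
  AbsolutelyContinuousOnInterval v 0 1 ∧ v 0 = 0 ∧ v 1 = 0

/-- `v` is a (weak) solution of `L(v_x)_x = f` in `(0,1)`, `v(0) = v(1) = 0`: there is an
integrable selection `σ ∈ L(v_x)` with `σ_x = f` in the sense of distributions. -/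
def IsSteadySolution (f v : ℝ → ℝ) : Prop :=
  ZeroDirichlet v ∧
  ∃ σ : ℝ → ℝ, IntegrableOn σ (Ioo 0 1) ∧
    (∀ᵐ x ∂(volume.restrict (Ioo (0 : ℝ) 1)), σ x ∈ L₁ (deriv v x)) ∧
    ∀ φ : ℝ → ℝ, ContDiff ℝ ∞ φ → HasCompactSupport φ → tsupport φ ⊆ Ioo 0 1 →
      ∫ x in Ioo (0 : ℝ) 1, σ x * deriv φ x = -∫ x in Ioo (0 : ℝ) 1, f x * φ x

/-- The space-time cylinder `(0,1) × (0,T)`; the first coordinate is space. -/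
def cylinder (T : ℝ) : Set (ℝ × ℝ) := Ioo 0 1 ×ˢ Ioo 0 T

/-- `u` (written `u x t`) is a weak solution on `(0,1) × (0,T)` of
`u_t - L(u_x)_x = F`, `u(0,t) = u(1,t) = 0`, `u(·,0) = u₀`:
`u ∈ L_∞(0,T; L_2(0,1))`, `u(·,t) ∈ W^{1,1}_0(0,1)` for a.e. `t`, and there is
`σ ∈ L_1(0,T; L_1(0,1))` with `σ ∈ L(u_x)` a.e. such that the equation and the initial condition
hold when tested with smooth functions of compact support in `(0,1) × [0,T)`. -/
def IsWeakSolution (T : ℝ) (F : ℝ → ℝ → ℝ) (u₀ : ℝ → ℝ) (u : ℝ → ℝ → ℝ) : Prop :=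
  AEStronglyMeasurable (fun p : ℝ × ℝ => u p.1 p.2) (volume.restrict (cylinder T)) ∧
  (∃ M : ℝ≥0, ∀ᵐ t ∂(volume.restrict (Ioo 0 T)),
    eLpNorm (fun x => u x t) 2 (volume.restrict (Ioo 0 1)) ≤ M) ∧
  (∀ᵐ t ∂(volume.restrict (Ioo 0 T)), ZeroDirichlet (fun x => u x t)) ∧
  ∃ σ : ℝ × ℝ → ℝ, IntegrableOn σ (cylinder T) ∧
    (∀ᵐ p ∂(volume.restrict (cylinder T)), σ p ∈ L₁ (deriv (fun y => u y p.2) p.1)) ∧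
    ∀ φ : ℝ × ℝ → ℝ, ContDiff ℝ ∞ φ → HasCompactSupport φ → tsupport φ ⊆ Ioo 0 1 ×ˢ Iio T →
      ∫ p in cylinder T, (-(u p.1 p.2 * deriv (fun s => φ (p.1, s)) p.2)
          + σ p * deriv (fun y => φ (y, p.2)) p.1)
        = (∫ p in cylinder T, F p.1 p.2 * φ p) + ∫ x in Ioo (0 : ℝ) 1, u₀ x * φ (x, 0)

/-- A weak solution on `(0,1) × (0,∞)`. -/
def IsGlobalWeakSolution (F : ℝ → ℝ → ℝ) (u₀ : ℝ → ℝ) (u : ℝ → ℝ → ℝ) : Prop :=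
  ∀ T : ℝ, 0 < T → IsWeakSolution T F u₀ u

/-- `4 + β (-2 χ_[3/8,5/8] + χ_[1/4,3/4])`. -/
noncomputable def steadyForce (β x : ℝ) : ℝ :=
  4 + β * (-2 * (Icc (3 / 8 : ℝ) (5 / 8)).indicator 1 x + (Icc (1 / 4 : ℝ) (3 / 4)).indicator 1 x)

/-- `4 + min{t,α} (-2 χ_[3/8,5/8] + χ_[1/4,3/4])`. -/
noncomputable def breakingForce (α x t : ℝ) : ℝ := steadyForce (min t α) x

/-- `v` is constant on `[a,b]`. -/
def FlatOn (v : ℝ → ℝ) (a b : ℝ) : Prop := ∀ x ∈ Icc a b, v x = v a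

/-- `[a,b]` is a facet of `v : [0,1] → ℝ`: a maximal nondegenerate interval on which `v` is
constant. -/
def IsFacet (v : ℝ → ℝ) (a b : ℝ) : Prop :=
  0 ≤ a ∧ a < b ∧ b ≤ 1 ∧ FlatOn v a b ∧
  ∀ a' b' : ℝ, 0 ≤ a' → a' ≤ a → b ≤ b' → b' ≤ 1 → FlatOn v a' b' → a' = a ∧ b' = b

end FacetBreaking

/-!
The operator `L` has the single-valued inverse `soft` (soft thresholding), so everything is read off
from the flux `σ`, with `u_x = soft σ`.

*Steady states.* The flux of a steady solution is a primitive of the force. The forces are even about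
`1/2`, and the odd primitive `steadyFlux β` gives a slope whose integral over `(0, 1)` vanishes; by
monotonicity of `soft` no other constant of integration gives another solution (`eqOn_steady`). The
facets are the components of the set where the flux lies in `[-1, 1]`. For `β ≤ 12` the perturbation
of the force changes the flux without moving it out of `[-1, 1]` on `[1/4, 3/4]`, so that the slope
is that for `β = 0` (`steadySlope_eq_of_le`): this is why the initial state persists until the time
`12`. For `α > 12` the flux crosses `±1` inside, and the facet breaks into three.

*Evolution.* The tool is the energy inequality for the difference of two solutions
(`Sol.energy_sub_le`): by monotonicity of `L`, if the sources differ by at most `B`, then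
`‖w(t)‖² + ∫_s^t ‖w_x‖² ≤ ‖w(s)‖² + B² (t - s)` for `w = u₁ - u₂` and almost all `s < t`. A weak
solution has no time derivative that could be used as a multiplier, so the inequality is proved for
Steklov averages in time. For almost every time the averaged equation says that the averaged flux is
absolutely continuous in space (`ae_eq_primitive_of_weak_deriv`), which makes the product with the
averaged gradient integrable; then Fatou's lemma applies. Extending a solution by the initial state
to negative times (`IsWeakSolution.exists_sol`) builds the initial condition into the equation.

Comparison with various second solutions gives the rest. The stationary solution with the initial
state gives `u = u₀` before the time `12`. A translate in time gives Lipschitz continuity in time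
with values in `L²` (`Sol.exists_lipschitz`), since the source is Lipschitz in time and constant
after the time `α`. The zero solution then bounds `u_x` in `L²` uniformly in time
(`Sol.ae_integral_sq_soft_le`). The final steady state gives, by the Poincaré inequality, exponential
decay in `L²` (`Sol.sub_sq_decay`). Interpolation between `L²` and the gradient bound turns the
second estimate into Hölder continuity in time, whence the continuous representative
(`exists_continuous_eq`), and the last one into uniform convergence.
-/

namespace FacetBreaking

/-! ### Test functions and distributional derivatives on an interval -/

/-- `φ` is a test function on `(a, b)`: smooth with compact support in `(a, b)`. -/
structure IsTest (a b : ℝ) (φ : ℝ → ℝ) : Prop where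
  smooth : ContDiff ℝ ∞ φ
  compact : HasCompactSupport φ
  supp : tsupport φ ⊆ Ioo a b

namespace IsTest

variable {a b : ℝ} {φ : ℝ → ℝ}

lemma eq_zero (h : IsTest a b φ) {x : ℝ} (hx : x ∉ Ioo a b) : φ x = 0 :=
  image_eq_zero_of_notMem_tsupport fun hx' => hx (h.supp hx')

lemma differentiable (h : IsTest a b φ) : Differentiable ℝ φ :=
  h.smooth.differentiable (by simp)

lemma continuous (h : IsTest a b φ) : Continuous φ := h.smooth.continuous

lemma continuous_deriv (h : IsTest a b φ) : Continuous (deriv φ) :=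
  h.smooth.continuous_deriv (by simp)

lemma exists_bound (h : IsTest a b φ) : ∃ C, 0 ≤ C ∧ ∀ x, |φ x| ≤ C := by
  obtain ⟨C, hC⟩ := h.compact.exists_bound_of_continuous h.continuous
  exact ⟨C, (norm_nonneg _).trans (hC 0), hC⟩

lemma deriv (h : IsTest a b φ) : IsTest a b (deriv φ) where
  smooth := by
    have := contDiff_infty_iff_deriv.1 h.smooth
    exact this.2
  compact := h.compact.deriv
  supp := (closure_mono (support_deriv_subset)).trans (by
    rw [(isClosed_tsupport φ).closure_eq]; exact h.supp)

lemma absolutelyContinuous (h : IsTest a b φ) (c d : ℝ) :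
    AbsolutelyContinuousOnInterval φ c d :=
  ContDiffOn.absolutelyContinuousOnInterval ((h.smooth.of_le (by simp)).contDiffOn)

lemma sub_const_mul {ψ : ℝ → ℝ} (h : IsTest a b φ) (h' : IsTest a b ψ) (c : ℝ) :
    IsTest a b (fun x => φ x - c * ψ x) where
  smooth := h.smooth.sub (contDiff_const.mul h'.smooth)
  compact := h.compact.sub (h'.compact.mul_left)
  supp := by
    refine (tsupport_sub _ _).trans (union_subset h.supp ?_)
    exact (tsupport_mul_subset_right (f := fun _ => c) (g := ψ)).trans h'.supp

/-- A test function of zero mean is the derivative of a test function. -/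
lemma exists_primitive (h : IsTest a b φ) (h0 : ∫ x in a..b, φ x = 0) :
    ∃ Φ, IsTest a b Φ ∧ _root_.deriv Φ = φ := by
  have hd : ∀ x, HasDerivAt (fun x => ∫ y in a..x, φ y) (φ x) x := fun x =>
    intervalIntegral.integral_hasDerivAt_right (h.continuous.intervalIntegrable _ _)
      (h.continuous.stronglyMeasurableAtFilter _ _) h.continuous.continuousAt
  have hd' : _root_.deriv (fun x => ∫ y in a..x, φ y) = φ := funext fun x => (hd x).deriv
  -- the primitive vanishes to the left of the support of `φ` and, by the zero mean, to its right
  have key : Function.support (fun x => ∫ y in a..x, φ y) ⊆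
      {x | ∃ y ∈ tsupport φ, y ≤ x} ∩ {x | ∃ y ∈ tsupport φ, x ≤ y} := by
    intro x hx
    constructor
    · by_contra hcon
      simp only [Set.mem_ofPred_eq, not_exists, not_and, not_le] at hcon
      apply hx
      rcases le_total a x with hax | hax
      · refine intervalIntegral.integral_zero_ae (Eventually.of_forall fun y hy => ?_)
        rw [uIoc_of_le hax] at hy
        by_contra hne
        exact absurd (hcon y (subset_tsupport _ hne)) (not_lt.2 hy.2)
      · refine intervalIntegral.integral_zero_ae (Eventually.of_forall fun y hy => ?_)
        rw [uIoc_of_ge hax] at hy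
        exact h.eq_zero fun hy' => absurd hy'.1 (not_lt.2 hy.2)
    · by_contra hcon
      simp only [Set.mem_ofPred_eq, not_exists, not_and, not_le] at hcon
      apply hx
      have : ∫ y in a..x, φ y = -∫ y in x..b, φ y := by
        rw [eq_neg_iff_add_eq_zero, intervalIntegral.integral_add_adjacent_intervals
          (h.continuous.intervalIntegrable _ _) (h.continuous.intervalIntegrable _ _), h0]
      simp only [this, neg_eq_zero]
      rcases le_total x b with hax | hax
      · refine intervalIntegral.integral_zero_ae (Eventually.of_forall fun y hy => ?_)
        rw [uIoc_of_le hax] at hy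
        by_contra hne
        exact absurd (hcon y (subset_tsupport _ hne)) (not_lt.2 hy.1.le)
      · refine intervalIntegral.integral_zero_ae (Eventually.of_forall fun y hy => ?_)
        rw [uIoc_of_ge hax] at hy
        exact h.eq_zero fun hy' => absurd hy'.2 (not_lt.2 hy.1.le)
  have hsub : ∃ c d : ℝ, Icc c d ⊆ Ioo a b ∧ tsupport φ ⊆ Icc c d := by
    rcases (tsupport φ).eq_empty_or_nonempty with he | hne
    · exact ⟨1, 0, by simp, by simp [he]⟩
    · obtain ⟨c, hc, hcm⟩ := h.compact.isCompact.exists_isLeast hne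
      obtain ⟨d, hd, hdm⟩ := h.compact.isCompact.exists_isGreatest hne
      exact ⟨c, d, fun x hx => ⟨(h.supp hc).1.trans_le hx.1, hx.2.trans_lt (h.supp hd).2⟩,
        fun x hx => ⟨hcm hx, hdm hx⟩⟩
  obtain ⟨c, d, hcd, hs⟩ := hsub
  have key' : tsupport (fun x => ∫ y in a..x, φ y) ⊆ Icc c d := by
    refine closure_minimal (key.trans ?_) isClosed_Icc
    rintro x ⟨⟨y, hy, hyx⟩, ⟨z, hz, hxz⟩⟩
    exact ⟨(hs hy).1.trans hyx, hxz.trans (hs hz).2⟩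
  refine ⟨fun x => ∫ y in a..x, φ y, ⟨?_, ?_, key'.trans hcd⟩, hd'⟩
  · rw [contDiff_infty_iff_deriv, hd']
    exact ⟨fun x => (hd x).differentiableAt, h.smooth⟩
  · exact HasCompactSupport.of_support_subset_isCompact isCompact_Icc
      ((subset_tsupport _).trans key')

end IsTest

/-- There is a test function with integral one. -/
lemma exists_isTest_integral_one {a b : ℝ} (hab : a < b) :
    ∃ χ, IsTest a b χ ∧ ∫ x in a..b, χ x = 1 := by
  let B : ContDiffBump ((a + b) / 2) := ⟨(b - a) / 8, (b - a) / 4, by linarith, by linarith⟩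
  have hs : tsupport (B.normed volume) ⊆ Ioo a b := by
    rw [B.tsupport_normed_eq, Real.closedBall_eq_Icc]
    intro x hx
    simp only [B, mem_Icc] at hx
    constructor <;> linarith [hx.1, hx.2]
  refine ⟨B.normed volume, ⟨B.contDiff_normed, B.hasCompactSupport_normed, hs⟩, ?_⟩
  rw [← B.integral_normed (μ := volume), intervalIntegral.integral_of_le hab.le]
  refine setIntegral_eq_integral_of_forall_compl_eq_zero fun x hx => ?_
  exact image_eq_zero_of_notMem_tsupport fun hx' => hx (Ioo_subset_Ioc_self (hs hx'))

lemma absolutelyContinuous_primitive {a b : ℝ} {f : ℝ → ℝ} (hf : IntervalIntegrable f volume a b)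
    (k : ℝ) : AbsolutelyContinuousOnInterval (fun x => k + ∫ y in a..x, f y) a b := by
  have h1 : AbsolutelyContinuousOnInterval (fun _ : ℝ => k) a b :=
    ContDiffOn.absolutelyContinuousOnInterval contDiffOn_const
  exact h1.fun_add (hf.absolutelyContinuousOnInterval_intervalIntegral (by simp))

lemma ae_deriv_primitive {a b : ℝ} {f : ℝ → ℝ} (hf : IntervalIntegrable f volume a b)
    (k : ℝ) : ∀ᵐ x, x ∈ uIcc a b → deriv (fun x => k + ∫ y in a..x, f y) x = f x := by
  filter_upwards [hf.ae_hasDerivAt_integral] with x hx hx'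
  exact ((hx hx' a (by simp)).const_add k).deriv

/-- Integration by parts for two primitives of integrable functions. -/
lemma integral_primitive_mul {a b : ℝ} {f g : ℝ → ℝ} (hf : IntervalIntegrable f volume a b)
    (hg : IntervalIntegrable g volume a b) (k l : ℝ) :
    ∫ x in a..b, (k + ∫ y in a..x, f y) * g x =
      (k + ∫ y in a..b, f y) * (l + ∫ y in a..b, g y) - k * l
        - ∫ x in a..b, f x * (l + ∫ y in a..x, g y) := by
  have h := (absolutelyContinuous_primitive hf k).integral_mul_deriv_eq_deriv_mul
    (absolutelyContinuous_primitive hg l)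
  simp only [intervalIntegral.integral_same, add_zero] at h
  have e1 : ∫ x in a..b, (k + ∫ y in a..x, f y) * g x =
      ∫ x in a..b, (k + ∫ y in a..x, f y) * deriv (fun x => l + ∫ y in a..x, g y) x := by
    refine intervalIntegral.integral_congr_ae ?_
    filter_upwards [ae_deriv_primitive hg l] with x hx hx'
    rw [hx (uIoc_subset_uIcc hx')]
  have e2 : ∫ x in a..b, f x * (l + ∫ y in a..x, g y) =
      ∫ x in a..b, deriv (fun x => k + ∫ y in a..x, f y) x * (l + ∫ y in a..x, g y) := by
    refine intervalIntegral.integral_congr_ae ?_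
    filter_upwards [ae_deriv_primitive hf k] with x hx hx'
    rw [hx (uIoc_subset_uIcc hx')]
  rw [e1, e2, h]

lemma integral_primitive_mul_self {a b : ℝ} {f : ℝ → ℝ} (hf : IntervalIntegrable f volume a b)
    (k : ℝ) : 2 * ∫ x in a..b, (k + ∫ y in a..x, f y) * f x =
      (k + ∫ y in a..b, f y) ^ 2 - k ^ 2 := by
  have h := integral_primitive_mul hf hf k k
  simp_rw [mul_comm (f _)] at h
  linarith

lemma integral_primitive_mul_deriv_test {a b : ℝ} {g φ : ℝ → ℝ}
    (hg : IntervalIntegrable g volume a b) (hφ : IsTest a b φ) (k : ℝ) :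
    ∫ x in a..b, (k + ∫ y in a..x, g y) * deriv φ x = -∫ x in a..b, g x * φ x := by
  rw [(absolutelyContinuous_primitive hg k).integral_mul_deriv_eq_deriv_mul
    (hφ.absolutelyContinuous a b), hφ.eq_zero (x := a) (by simp), hφ.eq_zero (x := b) (by simp)]
  simp only [mul_zero, sub_zero, zero_sub, neg_inj]
  refine intervalIntegral.integral_congr_ae ?_
  filter_upwards [ae_deriv_primitive hg k] with x hx hx'
  rw [hx (uIoc_subset_uIcc hx')]

lemma intervalIntegrable_mul_test {a b c d : ℝ} {g φ : ℝ → ℝ}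
    (hg : IntervalIntegrable g volume a b) (hφ : IsTest c d φ) :
    IntervalIntegrable (fun x => g x * φ x) volume a b :=
  hg.mul_continuousOn hφ.continuous.continuousOn

/-- An integrable function whose distributional derivative on `(a, b)` is an integrable `g`
agrees almost everywhere with a primitive of `g`. -/
theorem ae_eq_primitive_of_weak_deriv {a b : ℝ} (hab : a < b) {f g : ℝ → ℝ}
    (hf : IntervalIntegrable f volume a b) (hg : IntervalIntegrable g volume a b)
    (h : ∀ φ, IsTest a b φ → ∫ x in a..b, f x * deriv φ x = -∫ x in a..b, g x * φ x) :
    ∃ c, ∀ᵐ x, x ∈ Ioo a b → f x = c + ∫ y in a..x, g y := by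
  obtain ⟨χ, hχ, hχ1⟩ := exists_isTest_integral_one hab
  set k : ℝ → ℝ := fun x => f x - ∫ y in a..x, g y with hk
  have hG : ContinuousOn (fun x => ∫ y in a..x, g y) (uIcc a b) :=
    intervalIntegral.continuousOn_primitive_interval' hg (by simp)
  have hki : IntervalIntegrable k volume a b := hf.sub hG.intervalIntegrable
  have hk0 : ∀ φ, IsTest a b φ → ∫ x in a..b, k x * deriv φ x = 0 := by
    intro φ hφ
    have h1 := h φ hφ
    have h2 := integral_primitive_mul_deriv_test hg hφ 0
    simp only [zero_add] at h2
    simp only [hk, sub_mul]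
    rw [intervalIntegral.integral_sub (intervalIntegrable_mul_test hf hφ.deriv)
      (intervalIntegrable_mul_test hG.intervalIntegrable hφ.deriv), h1, h2, sub_self]
  -- tested with `θ - (∫ θ) χ`, a derivative, `k` integrates to zero: so `k` is the constant `c`
  set c := ∫ x in a..b, k x * χ x with hc
  have hkc : IntervalIntegrable (fun x => k x - c) volume a b := hki.sub intervalIntegrable_const
  have hz := isOpen_Ioo.ae_eq_zero_of_integral_contDiff_smul_eq_zero (μ := volume) (U := Ioo a b)
    (f := fun x => k x - c)
    ((((intervalIntegrable_iff_integrableOn_Ioo_of_le hab.le).1 hkc)).locallyIntegrableOn) (by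
    intro θ hθ1 hθ2 hθ3
    have hθ : IsTest a b θ := ⟨hθ1, hθ2, hθ3⟩
    have e1 : ∫ x, θ x • (k x - c) = ∫ x in a..b, (k x - c) * θ x := by
      rw [intervalIntegral.integral_of_le hab.le,
        setIntegral_eq_integral_of_forall_compl_eq_zero]
      · simp only [smul_eq_mul, mul_comm]
      · intro x hx
        rw [hθ.eq_zero fun hx' => hx (Ioo_subset_Ioc_self hx'), mul_zero]
    obtain ⟨Φ, hΦ, hΦ'⟩ := (hθ.sub_const_mul hχ (∫ x in a..b, θ x)).exists_primitive (by
      have i1 : IntervalIntegrable θ volume a b := hθ.continuous.intervalIntegrable _ _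
      have i2 : IntervalIntegrable χ volume a b := hχ.continuous.intervalIntegrable _ _
      rw [intervalIntegral.integral_sub i1 (i2.const_mul _),
        intervalIntegral.integral_const_mul, hχ1, mul_one, sub_self])
    have h3 := hk0 Φ hΦ
    rw [hΦ'] at h3
    have e2 : ∫ x in a..b, k x * (θ x - (∫ x in a..b, θ x) * χ x) =
        (∫ x in a..b, k x * θ x) - (∫ x in a..b, θ x) * c := by
      rw [hc, ← intervalIntegral.integral_const_mul, ← intervalIntegral.integral_sub
        (intervalIntegrable_mul_test hki hθ)
        ((intervalIntegrable_mul_test hki hχ).const_mul _)]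
      exact intervalIntegral.integral_congr fun x _ => by ring
    have i1 : IntervalIntegrable θ volume a b := hθ.continuous.intervalIntegrable _ _
    simp only [sub_mul] at e1
    rw [e1, intervalIntegral.integral_sub (intervalIntegrable_mul_test hki hθ)
      (i1.const_mul c), intervalIntegral.integral_const_mul]
    linarith [h3, e2])
  refine ⟨c, ?_⟩
  filter_upwards [hz] with x hx hx'
  have := hx hx'
  simp only [hk] at this
  linarith

/-- Integration against an integrable function is continuous on `C([a, b])`. -/
lemma lipschitzWith_integral_mul {a b : ℝ} (hab : a ≤ b) {q : ℝ → ℝ}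
    (hq : IntervalIntegrable q volume a b) :
    LipschitzWith (∫ x in a..b, |q x|).toNNReal
      (fun ξ : C(Icc a b, ℝ) => ∫ x in a..b, q x * ξ (projIcc a b hab x)) := by
  have hi : ∀ ξ : C(Icc a b, ℝ),
      IntervalIntegrable (fun x => q x * ξ (projIcc a b hab x)) volume a b := fun ξ =>
    hq.mul_continuousOn (ξ.continuous.comp continuous_projIcc).continuousOn
  refine LipschitzWith.of_dist_le_mul fun ξ ζ => ?_
  have h0 : 0 ≤ ∫ x in a..b, |q x| :=
    intervalIntegral.integral_nonneg hab fun x _ => abs_nonneg _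
  rw [Real.dist_eq, ← intervalIntegral.integral_sub (hi ξ) (hi ζ), Real.coe_toNNReal _ h0,
    ← intervalIntegral.integral_mul_const]
  refine (intervalIntegral.abs_integral_le_integral_abs hab).trans
    (intervalIntegral.integral_mono_on hab ((hi ξ).sub (hi ζ)).abs (hq.abs.mul_const _)
      fun x _ => ?_)
  rw [← mul_sub, abs_mul]
  refine mul_le_mul_of_nonneg_left ?_ (abs_nonneg _)
  rw [← Real.dist_eq]
  exact ContinuousMap.dist_apply_le_dist _

/-- The exceptional null set in a family of integral identities tested with all test functions
can be chosen independently of the test function, by separability of `C([a, b])²`. -/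
theorem ae_forall_test {a b : ℝ} (hab : a ≤ b) {μ : Measure ℝ} {q R : ℝ → ℝ → ℝ}
    (hq : ∀ᵐ τ ∂μ, IntervalIntegrable (fun x => q x τ) volume a b)
    (hR : ∀ᵐ τ ∂μ, IntervalIntegrable (fun x => R x τ) volume a b)
    (h : ∀ φ, IsTest a b φ → ∀ᵐ τ ∂μ,
      ∫ x in a..b, R x τ * deriv φ x = -∫ x in a..b, q x τ * φ x) :
    ∀ᵐ τ ∂μ, ∀ φ, IsTest a b φ →
      ∫ x in a..b, R x τ * deriv φ x = -∫ x in a..b, q x τ * φ x := by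
  let e : {φ // IsTest a b φ} → C(Icc a b, ℝ) × C(Icc a b, ℝ) := fun φ =>
    (⟨fun x => φ.1 x, φ.2.continuous.comp continuous_subtype_val⟩,
      ⟨fun x => deriv φ.1 x, φ.2.continuous_deriv.comp continuous_subtype_val⟩)
  let : TopologicalSpace {φ // IsTest a b φ} := TopologicalSpace.induced e inferInstance
  have : SecondCountableTopology {φ // IsTest a b φ} :=
    TopologicalSpace.secondCountableTopology_induced _ _ e
  have he : Continuous e := continuous_induced_dom
  obtain ⟨D, hDc, hD⟩ := TopologicalSpace.exists_countable_dense {φ // IsTest a b φ}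
  have hae : ∀ᵐ τ ∂μ, ∀ φ ∈ D,
      ∫ x in a..b, R x τ * deriv φ.1 x = -∫ x in a..b, q x τ * φ.1 x :=
    (ae_ball_iff hDc).2 fun φ _ => h φ.1 φ.2
  filter_upwards [hq, hR, hae] with τ hq hR hae φ hφ
  have e1 : ∀ φ : {φ // IsTest a b φ}, ∫ x in a..b, R x τ * deriv φ.1 x =
      ∫ x in a..b, R x τ * (e φ).2 (projIcc a b hab x) := fun φ => by
    refine intervalIntegral.integral_congr fun x hx => ?_
    rw [uIcc_of_le hab] at hx
    simp [e, projIcc_of_mem hab hx]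
  have e2 : ∀ φ : {φ // IsTest a b φ}, ∫ x in a..b, q x τ * φ.1 x =
      ∫ x in a..b, q x τ * (e φ).1 (projIcc a b hab x) := fun φ => by
    refine intervalIntegral.integral_congr fun x hx => ?_
    rw [uIcc_of_le hab] at hx
    simp [e, projIcc_of_mem hab hx]
  have key : (fun φ : {φ // IsTest a b φ} => ∫ x in a..b, R x τ * (e φ).2 (projIcc a b hab x)) =
      fun φ => -∫ x in a..b, q x τ * (e φ).1 (projIcc a b hab x) := by
    refine Continuous.ext_on hD
      ((lipschitzWith_integral_mul hab hR).continuous.comp (continuous_snd.comp he))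
      ((lipschitzWith_integral_mul hab hq).continuous.comp (continuous_fst.comp he)).neg ?_
    intro φ hφ
    simp only [← e1, ← e2]
    exact hae φ hφ
  have := congrFun key ⟨φ, hφ⟩
  simp only [← e1, ← e2] at this
  exact this

/-! ### Steklov averages -/

/-- The Steklov average `h⁻¹ ∫_τ^{τ+h} z`. -/
noncomputable def stek (h : ℝ) (z : ℝ → ℝ) (τ : ℝ) : ℝ := h⁻¹ * ∫ r in τ..τ + h, z r

lemma intervalIntegrable_of_locallyIntegrable {z : ℝ → ℝ} (hz : LocallyIntegrable z volume)
    (c d : ℝ) : IntervalIntegrable z volume c d :=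
  (hz.integrableOn_isCompact isCompact_uIcc).intervalIntegrable

lemma tendsto_stek_of_hasDerivAt {z : ℝ → ℝ} (hz : LocallyIntegrable z volume) {τ : ℝ}
    (hd : HasDerivAt (fun x => ∫ r in (0 : ℝ)..x, z r) (z τ) τ) :
    Tendsto (fun n : ℕ => stek (1 / ((n : ℝ) + 1)) z τ) atTop (𝓝 (z τ)) := by
  have h1 := hd.tendsto_slope_zero_right
  have h2 : Tendsto (fun n : ℕ => 1 / ((n : ℝ) + 1)) atTop (𝓝[>] 0) :=
    tendsto_nhdsWithin_iff.2 ⟨tendsto_one_div_add_atTop_nhds_zero_nat,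
      Eventually.of_forall fun n => by simp only [mem_Ioi]; positivity⟩
  refine (h1.comp h2).congr fun n => ?_
  simp only [Function.comp, stek, smul_eq_mul]
  rw [intervalIntegral.integral_interval_sub_left
    (intervalIntegrable_of_locallyIntegrable hz _ _)
    (intervalIntegrable_of_locallyIntegrable hz _ _)]

/-- Lebesgue's differentiation theorem for Steklov averages. -/
lemma ae_tendsto_stek {z : ℝ → ℝ} (hz : LocallyIntegrable z volume) :
    ∀ᵐ τ, Tendsto (fun n : ℕ => stek (1 / ((n : ℝ) + 1)) z τ) atTop (𝓝 (z τ)) := by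
  filter_upwards [LocallyIntegrable.ae_hasDerivAt_integral hz] with τ hτ
  exact tendsto_stek_of_hasDerivAt hz (hτ 0)

lemma intervalIntegrable_comp_add {z : ℝ → ℝ} (hz : ∀ c d, IntervalIntegrable z volume c d)
    (h s t : ℝ) : IntervalIntegrable (fun r => z (r + h)) volume s t := by
  simpa using (hz (s + h) (t + h)).comp_add_right h

/-- A Steklov average is absolutely continuous; its derivative is a difference quotient. -/
lemma stek_eq_primitive {z : ℝ → ℝ} (hz : ∀ c d, IntervalIntegrable z volume c d) (h s τ : ℝ) :
    stek h z τ = stek h z s + ∫ r in s..τ, h⁻¹ * (z (r + h) - z r) := by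
  rw [intervalIntegral.integral_const_mul, intervalIntegral.integral_sub
    (intervalIntegrable_comp_add hz h s τ) (hz s τ), intervalIntegral.integral_comp_add_right]
  have h1 := intervalIntegral.integral_add_adjacent_intervals (hz s (s + h)) (hz (s + h) (τ + h))
  have h2 := intervalIntegral.integral_add_adjacent_intervals (hz s τ) (hz τ (τ + h))
  have h3 : ∫ r in τ..τ + h, z r =
      (∫ r in s..s + h, z r) + ((∫ r in s + h..τ + h, z r) - ∫ r in s..τ, z r) := by linarith
  simp only [stek]
  rw [h3]
  ring

/-- The chain rule for the square of a Steklov average. -/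
lemma stek_sq_sub {z : ℝ → ℝ} (hz : ∀ c d, IntervalIntegrable z volume c d) (h s t : ℝ) :
    stek h z t ^ 2 - stek h z s ^ 2 =
      2 * ∫ τ in s..t, stek h z τ * (h⁻¹ * (z (τ + h) - z τ)) := by
  have hi : IntervalIntegrable (fun r => h⁻¹ * (z (r + h) - z r)) volume s t :=
    ((intervalIntegrable_comp_add hz h s t).sub (hz s t)).const_mul _
  have := integral_primitive_mul_self hi (stek h z s)
  simp_rw [← stek_eq_primitive hz] at this
  exact this.symm

/-- Jensen's inequality for a Steklov average. -/
lemma stek_sq_le {z : ℝ → ℝ} {h s : ℝ} (hh : 0 < h) (hz : IntervalIntegrable z volume s (s + h))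
    (hz2 : IntervalIntegrable (fun r => z r ^ 2) volume s (s + h)) :
    stek h z s ^ 2 ≤ stek h (fun r => z r ^ 2) s := by
  have h0 : 0 ≤ ∫ r in s..s + h, (z r - stek h z s) ^ 2 :=
    intervalIntegral.integral_nonneg (by linarith) fun x _ => sq_nonneg _
  have h1 : ∫ r in s..s + h, (z r - stek h z s) ^ 2 =
      (∫ r in s..s + h, z r ^ 2) - 2 * stek h z s * (∫ r in s..s + h, z r)
        + h * stek h z s ^ 2 := by
    have : ∀ r, (z r - stek h z s) ^ 2 = z r ^ 2 - 2 * stek h z s * z r + stek h z s ^ 2 :=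
      fun r => by ring
    simp_rw [this]
    rw [intervalIntegral.integral_add (hz2.sub (hz.const_mul _)) intervalIntegrable_const,
      intervalIntegral.integral_sub hz2 (hz.const_mul _), intervalIntegral.integral_const_mul,
      intervalIntegral.integral_const]
    simp
  have h2 : ∫ r in s..s + h, z r = h * stek h z s := by
    simp only [stek]; field_simp
  have h3 : ∫ r in s..s + h, z r ^ 2 = h * stek h (fun r => z r ^ 2) s := by
    simp only [stek]; field_simp
  rw [h1, h2, h3] at h0
  nlinarith

lemma abs_stek_le {z : ℝ → ℝ} {h s C : ℝ} (hh : 0 < h) (hz : ∀ r, |z r| ≤ C) :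
    |stek h z s| ≤ C := by
  have := intervalIntegral.norm_integral_le_of_norm_le_const (a := s) (b := s + h) (f := z) (C := C)
    fun x _ => hz x
  simp only [add_sub_cancel_left, Real.norm_eq_abs, abs_of_pos hh] at this
  rw [stek, abs_mul, abs_of_pos (inv_pos.2 hh), inv_mul_le_iff₀ hh]
  linarith

/-! ### Parametric integrals over intervals -/

lemma measurable_parametric_intervalIntegral {α : Type*} [MeasurableSpace α] {f : α → ℝ → ℝ}
    {a b : α → ℝ} (hf : Measurable (Function.uncurry f)) (ha : Measurable a) (hb : Measurable b) :
    Measurable fun z => ∫ r in a z..b z, f z r := by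
  have key : ∀ {a b : α → ℝ}, Measurable a → Measurable b →
      Measurable fun z => ∫ r in Ioc (a z) (b z), f z r := by
    intro a b ha hb
    have hm : MeasurableSet {q : α × ℝ | q.2 ∈ Ioc (a q.1) (b q.1)} :=
      (measurableSet_lt (ha.comp measurable_fst) measurable_snd).inter
        (measurableSet_le measurable_snd (hb.comp measurable_fst))
    have h1 : Measurable ({q : α × ℝ | q.2 ∈ Ioc (a q.1) (b q.1)}.indicator
      (Function.uncurry f)) := hf.indicator hm
    have h2 := (h1.stronglyMeasurable.integral_prod_right' (ν := volume)).measurable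
    convert! h2 using 2 with z
    rw [← integral_indicator measurableSet_Ioc]
    rfl
  simp only [intervalIntegral]
  exact (key ha hb).sub (key hb ha)

lemma measurable_primitive {p : ℝ → ℝ → ℝ} (hp : Measurable (Function.uncurry p)) :
    Measurable (Function.uncurry fun x t => ∫ y in (0 : ℝ)..x, p y t) := by
  refine measurable_parametric_intervalIntegral (α := ℝ × ℝ) (f := fun z y => p y z.2) ?_
    measurable_const measurable_fst
  exact hp.comp (measurable_snd.prodMk (measurable_snd.comp measurable_fst))

lemma measurable_stek {p : ℝ → ℝ → ℝ} (hp : Measurable (Function.uncurry p)) (h : ℝ) :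
    Measurable (Function.uncurry fun x τ => stek h (p x) τ) := by
  refine (measurable_parametric_intervalIntegral (α := ℝ × ℝ) (f := fun z r => p z.1 r) ?_
    measurable_snd (measurable_snd.add_const h)).const_mul _
  exact hp.comp ((measurable_fst.comp measurable_fst).prodMk measurable_snd)

/-- Convergence of Steklov averages in the second variable, almost everywhere in both orders. -/
lemma ae_ae_tendsto_stek {μ : Measure ℝ} [SFinite μ] {f : ℝ → ℝ → ℝ}
    (hf : Measurable (Function.uncurry f)) (hi : ∀ᵐ x ∂μ, LocallyIntegrable (f x) volume) :
    ∀ᵐ τ, ∀ᵐ x ∂μ,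
      Tendsto (fun n : ℕ => stek (1 / ((n : ℝ) + 1)) (f x) τ) atTop (𝓝 (f x τ)) := by
  have hm : MeasurableSet {z : ℝ × ℝ |
      Tendsto (fun n : ℕ => stek (1 / ((n : ℝ) + 1)) (f z.1) z.2) atTop (𝓝 (f z.1 z.2))} := by
    have : {z : ℝ × ℝ |
        Tendsto (fun n : ℕ => stek (1 / ((n : ℝ) + 1)) (f z.1) z.2) atTop (𝓝 (f z.1 z.2))} =
        {z : ℝ × ℝ | Tendsto (fun n : ℕ => stek (1 / ((n : ℝ) + 1)) (f z.1) z.2 - f z.1 z.2)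
          atTop (𝓝 0)} := by
      ext z
      exact tendsto_sub_nhds_zero_iff.symm
    rw [this]
    exact measurableSet_tendsto (𝓝 (0 : ℝ)) fun n => (measurable_stek hf _).sub hf
  rw [← Measure.ae_ae_comm hm]
  filter_upwards [hi] with x hx
  exact ae_tendsto_stek hx

/-! ### The energy inequality -/

lemma intervalIntegral_swap {F : ℝ → ℝ → ℝ} {a b c d : ℝ}
    (h : Integrable (Function.uncurry F)
      ((volume.restrict (uIoc a b)).prod (volume.restrict (uIoc c d)))) :
    ∫ x in a..b, ∫ y in c..d, F x y = ∫ y in c..d, ∫ x in a..b, F x y := by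
  refine intervalIntegral_intervalIntegral_swap ?_
  rwa [IntegrableOn, Measure.volume_eq_prod, ← Measure.prod_restrict]

/-- The spatial primitive `∫_0^x p(y, t) dy`. -/
noncomputable def prim (p : ℝ → ℝ → ℝ) (x t : ℝ) : ℝ := ∫ y in (0 : ℝ)..x, p y t

/-- The data of the equation `w_t = (p + s)_x + g` on `(0, 1) × (a, b)` for `w = prim p`, which
vanishes at both ends: `p = w_x` is integrable, `s` is a bounded function with the sign of `p`,
`|g| ≤ B`, and `‖w(·, t)‖² ≤ M` in `L²(0, 1)`. The equation is tested in space and integrated in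
time, with `k ψ` the value at time `a` of `w` paired with `ψ`. The functions live on the whole plane
(in applications they vanish off the cylinder), so that no time translation leaves their domain. -/
structure EnergyData (a b B M : ℝ) (p s g : ℝ → ℝ → ℝ) : Prop where
  meas_p : Measurable (Function.uncurry p)
  int_p : Integrable (Function.uncurry p) (volume.prod volume)
  meas_s : Measurable (Function.uncurry s)
  abs_s : ∀ x t, |s x t| ≤ 2
  sign : ∀ x t, 0 ≤ s x t * p x t
  meas_g : Measurable (Function.uncurry g)
  abs_g : ∀ x t, |g x t| ≤ B
  right : ∀ᵐ t, t ∈ Ioo a b → prim p 1 t = 0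
  bound : ∀ᵐ t, t ∈ Ioo a b → ∫ x in (0 : ℝ)..1, prim p x t ^ 2 ≤ M
  weak : ∃ k : (ℝ → ℝ) → ℝ, ∀ ψ, IsTest 0 1 ψ → ∀ᵐ t, t ∈ Ioo a b →
    ∫ x in (0 : ℝ)..1, prim p x t * ψ x =
      k ψ + ∫ τ in a..t, ∫ x in (0 : ℝ)..1, (-(p x τ + s x τ) * deriv ψ x + g x τ * ψ x)

namespace EnergyData

variable {a b B M : ℝ} {p s g : ℝ → ℝ → ℝ}

lemma measurable_prim (H : EnergyData a b B M p s g) : Measurable (Function.uncurry (prim p)) :=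
  measurable_primitive H.meas_p

lemma ae_integrable_left (H : EnergyData a b B M p s g) : ∀ᵐ t, Integrable (fun x => p x t) :=
  H.int_p.prod_left_ae

lemma ae_integrable_right (H : EnergyData a b B M p s g) : ∀ᵐ x, Integrable (p x) :=
  H.int_p.prod_right_ae

lemma integrable_norm (H : EnergyData a b B M p s g) : Integrable (fun t => ∫ x, |p x t|) :=
  H.int_p.integral_norm_prod_right

lemma ae_abs_prim_le (H : EnergyData a b B M p s g) :
    ∀ᵐ t, ∀ x ∈ Icc (0 : ℝ) 1, |prim p x t| ≤ ∫ x, |p x t| := by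
  filter_upwards [H.ae_integrable_left] with t ht x hx
  refine (intervalIntegral.abs_integral_le_integral_abs hx.1).trans ?_
  rw [intervalIntegral.integral_of_le hx.1]
  exact setIntegral_le_integral ht.abs (Eventually.of_forall fun _ => abs_nonneg _)

lemma integrable_prim (H : EnergyData a b B M p s g) {x : ℝ} (hx : x ∈ Icc (0 : ℝ) 1) :
    Integrable (prim p x) := by
  refine H.integrable_norm.mono' (H.measurable_prim.comp
    (measurable_const.prodMk measurable_id)).aestronglyMeasurable ?_
  filter_upwards [H.ae_abs_prim_le] with t ht
  exact ht x hx

lemma intervalIntegrable_prim (H : EnergyData a b B M p s g) {x : ℝ} (hx : x ∈ Icc (0 : ℝ) 1)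
    (c d : ℝ) : IntervalIntegrable (prim p x) volume c d :=
  (H.integrable_prim hx).intervalIntegrable

lemma integrable_prim_prod (H : EnergyData a b B M p s g) :
    Integrable (Function.uncurry (prim p)) ((volume.restrict (Ioc 0 1)).prod volume) := by
  refine (H.integrable_norm.comp_snd (volume.restrict (Ioc (0 : ℝ) 1))).mono'
    H.measurable_prim.aestronglyMeasurable ?_
  have h1 : ∀ᵐ z ∂((volume.restrict (Ioc (0 : ℝ) 1)).prod (volume : Measure ℝ)),
      z.1 ∈ Ioc (0 : ℝ) 1 :=
    Measure.quasiMeasurePreserving_fst.ae (ae_restrict_mem measurableSet_Ioc)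
  have h2 := (Measure.quasiMeasurePreserving_snd
    (μ := volume.restrict (Ioc (0 : ℝ) 1)) (ν := (volume : Measure ℝ))).ae H.ae_abs_prim_le
  filter_upwards [h1, h2] with z hz1 hz2
  exact hz2 z.1 (Ioc_subset_Icc_self hz1)

lemma integrable_p_Ioc (H : EnergyData a b B M p s g) (A A' : Set ℝ) :
    Integrable (Function.uncurry p) ((volume.restrict A).prod (volume.restrict A')) := by
  rw [Measure.prod_restrict]
  exact H.int_p.integrableOn

/-- Steklov averages of `p` are integrable in space, at every time. -/
lemma intervalIntegrable_stek_p (H : EnergyData a b B M p s g) (h τ : ℝ) (c d : ℝ) :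
    IntervalIntegrable (fun x => stek h (p x) τ) volume c d := by
  have key : ∀ c d : ℝ, Integrable fun x => ∫ r in Ioc c d, p x r := fun c d => by
    have := (H.integrable_p_Ioc univ (Ioc c d)).integral_prod_left
    rwa [Measure.restrict_univ] at this
  refine IntervalIntegrable.const_mul ?_ _
  exact ((key _ _).sub (key _ _)).intervalIntegrable

lemma stek_prim (H : EnergyData a b B M p s g) (h τ x : ℝ) :
    stek h (prim p x) τ = ∫ y in (0 : ℝ)..x, stek h (p y) τ := by
  simp only [stek, prim]
  rw [intervalIntegral.integral_const_mul, intervalIntegral_swap]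
  exact (H.integrable_p_Ioc _ _).swap

lemma abs_stek_prim_le (H : EnergyData a b B M p s g) {h : ℝ} (hh : 0 < h) (τ : ℝ) {x : ℝ}
    (hx : x ∈ Icc (0 : ℝ) 1) :
    |stek h (prim p x) τ| ≤ h⁻¹ * ∫ t, ∫ y, |p y t| := by
  rw [stek, abs_mul, abs_of_pos (inv_pos.2 hh)]
  refine mul_le_mul_of_nonneg_left ?_ (inv_pos.2 hh).le
  have hle : τ ≤ τ + h := by linarith
  refine (intervalIntegral.abs_integral_le_integral_abs hle).trans ?_
  rw [intervalIntegral.integral_of_le hle]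
  refine (setIntegral_le_integral (H.integrable_prim hx).abs
    (Eventually.of_forall fun _ => abs_nonneg _)).trans ?_
  refine integral_mono_ae (H.integrable_prim hx).abs H.integrable_norm ?_
  filter_upwards [H.ae_abs_prim_le] with t ht
  exact ht x hx

/-- The product of the Steklov average of `w` with its time derivative is integrable. -/
lemma integrable_stek_mul (H : EnergyData a b B M p s g) {h : ℝ} (hh : 0 < h) (A : Set ℝ) :
    Integrable (Function.uncurry fun x τ => stek h (prim p x) τ *
      (h⁻¹ * (prim p x (τ + h) - prim p x τ)))
      ((volume.restrict (Ioc 0 1)).prod (volume.restrict A)) := by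
  have i1 := H.integrable_prim_prod
  have i2 : Integrable (Function.uncurry fun x τ => prim p x (τ + h))
      ((volume.restrict (Ioc 0 1)).prod volume) := by
    have := (MeasurePreserving.id (volume.restrict (Ioc (0 : ℝ) 1))).prod
      (measurePreserving_add_right (volume : Measure ℝ) h)
    exact (this.integrable_comp H.measurable_prim.aestronglyMeasurable).2 i1
  have i3 := ((i2.sub i1).const_mul h⁻¹).mono_measure
    (Measure.prod_mono le_rfl (Measure.restrict_le_self (s := A) (μ := (volume : Measure ℝ))))
  refine i3.bdd_mul (c := h⁻¹ * ∫ t, ∫ y, |p y t|)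
    (measurable_stek H.measurable_prim h).aestronglyMeasurable ?_
  have h1 : ∀ᵐ z ∂((volume.restrict (Ioc (0 : ℝ) 1)).prod (volume.restrict A)),
      z.1 ∈ Ioc (0 : ℝ) 1 :=
    Measure.quasiMeasurePreserving_fst.ae (ae_restrict_mem measurableSet_Ioc)
  filter_upwards [h1] with z hz
  exact H.abs_stek_prim_le hh z.2 (Ioc_subset_Icc_self hz)

/-- The time derivative of the energy of a Steklov average. -/
lemma stek_energy_identity (H : EnergyData a b B M p s g) {h σ t : ℝ} (hh : 0 < h) (hst : σ ≤ t) :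
    (∫ x in (0 : ℝ)..1, stek h (prim p x) t ^ 2) - ∫ x in (0 : ℝ)..1, stek h (prim p x) σ ^ 2 =
      2 * ∫ τ in σ..t, ∫ x in (0 : ℝ)..1,
        stek h (prim p x) τ * (h⁻¹ * (prim p x (τ + h) - prim p x τ)) := by
  have hb : ∀ τ, IntervalIntegrable (fun x => stek h (prim p x) τ ^ 2) volume 0 1 := fun τ => by
    rw [intervalIntegrable_iff_integrableOn_Ioc_of_le zero_le_one]
    refine Integrable.mono' (g := fun _ => (h⁻¹ * ∫ t, ∫ y, |p y t|) ^ 2)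
      (integrable_const _) (((measurable_stek H.measurable_prim h).comp
        (measurable_id.prodMk measurable_const)).pow_const 2).aestronglyMeasurable ?_
    filter_upwards [ae_restrict_mem measurableSet_Ioc] with x hx
    have := H.abs_stek_prim_le hh τ (Ioc_subset_Icc_self hx)
    rw [Real.norm_eq_abs, abs_pow]
    exact pow_le_pow_left₀ (abs_nonneg _) this 2
  rw [← intervalIntegral.integral_sub (hb t) (hb σ)]
  have e : ∫ x in (0 : ℝ)..1, (stek h (prim p x) t ^ 2 - stek h (prim p x) σ ^ 2) =
      ∫ x in (0 : ℝ)..1, 2 * ∫ τ in σ..t,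
        stek h (prim p x) τ * (h⁻¹ * (prim p x (τ + h) - prim p x τ)) := by
    refine intervalIntegral.integral_congr fun x hx => ?_
    rw [uIcc_of_le zero_le_one] at hx
    exact stek_sq_sub (H.intervalIntegrable_prim hx) h σ t
  rw [e, intervalIntegral.integral_const_mul, intervalIntegral_swap]
  rw [uIoc_of_le zero_le_one, uIoc_of_le hst]
  exact H.integrable_stek_mul hh _

lemma integrable_flux (H : EnergyData a b B M p s g) {ψ : ℝ → ℝ} (hψ : IsTest 0 1 ψ) {A A' : Set ℝ}
    (hA : volume A ≠ ⊤) (hA' : volume A' ≠ ⊤) :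
    Integrable (Function.uncurry fun x τ => -(p x τ + s x τ) * deriv ψ x + g x τ * ψ x)
      ((volume.restrict A).prod (volume.restrict A')) := by
  have : IsFiniteMeasure (volume.restrict A) := ⟨by simpa using hA.lt_top⟩
  have : IsFiniteMeasure (volume.restrict A') := ⟨by simpa using hA'.lt_top⟩
  obtain ⟨C, hC0, hC⟩ := hψ.exists_bound
  obtain ⟨C', hC0', hC'⟩ := hψ.deriv.exists_bound
  have is : Integrable (Function.uncurry s) ((volume.restrict A).prod (volume.restrict A')) :=
    (integrable_const (2 : ℝ)).mono' H.meas_s.aestronglyMeasurable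
      (Eventually.of_forall fun z => H.abs_s z.1 z.2)
  have ig : Integrable (Function.uncurry g) ((volume.restrict A).prod (volume.restrict A')) :=
    (integrable_const B).mono' H.meas_g.aestronglyMeasurable
      (Eventually.of_forall fun z => H.abs_g z.1 z.2)
  have m1 : Measurable fun z : ℝ × ℝ => deriv ψ z.1 :=
    hψ.continuous_deriv.measurable.comp measurable_fst
  have m2 : Measurable fun z : ℝ × ℝ => ψ z.1 := hψ.continuous.measurable.comp measurable_fst
  exact (((H.integrable_p_Ioc A A').add is).neg.mul_bdd (c := C') m1.aestronglyMeasurable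
    (Eventually.of_forall fun z => hC' z.1)).add (ig.mul_bdd (c := C) m2.aestronglyMeasurable
    (Eventually.of_forall fun z => hC z.1))

lemma integral_stek_p_eq_zero (H : EnergyData a b B M p s g) {h τ : ℝ} (hh : 0 < h)
    (h1 : a ≤ τ) (h2 : τ + h ≤ b) : ∫ y in (0 : ℝ)..1, stek h (p y) τ = 0 := by
  rw [← H.stek_prim, stek, intervalIntegral.integral_zero_ae, mul_zero]
  have hne : ∀ᵐ t : ℝ, t ≠ b := by simp [ae_iff, measure_singleton]
  filter_upwards [H.right, hne] with t ht htb ht'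
  rw [uIoc_of_le (by linarith)] at ht'
  exact ht ⟨h1.trans_lt ht'.1, lt_of_le_of_ne (ht'.2.trans h2) htb⟩

lemma intervalIntegrable_s (H : EnergyData a b B M p s g) (x c d : ℝ) :
    IntervalIntegrable (s x) volume c d := by
  refine (intervalIntegrable_const (c := (2 : ℝ))).mono_fun
    (H.meas_s.comp (measurable_const.prodMk measurable_id)).aestronglyMeasurable
    (Eventually.of_forall fun t => ?_)
  simpa using H.abs_s x t

lemma intervalIntegrable_g (H : EnergyData a b B M p s g) (x c d : ℝ) :
    IntervalIntegrable (g x) volume c d := by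
  refine (intervalIntegrable_const (c := B)).mono_fun
    (H.meas_g.comp (measurable_const.prodMk measurable_id)).aestronglyMeasurable
    (Eventually.of_forall fun t => ?_)
  exact (H.abs_g x t).trans (le_abs_self B)

lemma intervalIntegrable_stek_of_bound {f : ℝ → ℝ → ℝ} {C h : ℝ} (hh : 0 < h)
    (hf : Measurable (Function.uncurry f)) (hC : ∀ x t, |f x t| ≤ C) (τ c d : ℝ) :
    IntervalIntegrable (fun x => stek h (f x) τ) volume c d := by
  refine (intervalIntegrable_const (c := C)).mono_fun
    ((measurable_stek hf h).comp (measurable_id.prodMk measurable_const)).aestronglyMeasurable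
    (Eventually.of_forall fun t => ?_)
  exact (abs_stek_le hh (hC t)).trans (le_abs_self C)

lemma ae_intervalIntegrable_prim (H : EnergyData a b B M p s g) :
    ∀ᵐ τ, IntervalIntegrable (fun x => prim p x τ) volume 0 1 := by
  filter_upwards [H.ae_integrable_left] with τ hτ
  exact (intervalIntegral.continuousOn_primitive_interval'
    (hτ.intervalIntegrable (a := 0) (b := 1)) (by simp)).intervalIntegrable

lemma ae_shift {P : ℝ → Prop} (h : ℝ) (hP : ∀ᵐ τ, P τ) : ∀ᵐ τ, P (τ + h) :=
  (measurePreserving_add_right (volume : Measure ℝ) h).quasiMeasurePreserving.ae hP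

/-- For almost every time the Steklov averaged equation holds in the sense of distributions
in space. -/
lemma ae_stek_weak (H : EnergyData a b B M p s g) {h : ℝ} (hh : 0 < h) :
    ∀ᵐ τ ∂volume.restrict (Ioo a (b - h)), ∀ φ, IsTest 0 1 φ →
      ∫ x in (0 : ℝ)..1, (stek h (p x) τ + stek h (s x) τ) * deriv φ x =
        -∫ x in (0 : ℝ)..1, (h⁻¹ * (prim p x (τ + h) - prim p x τ) - stek h (g x) τ) * φ x := by
  obtain ⟨k, hk⟩ := H.weak
  refine ae_forall_test zero_le_one ?_ ?_ fun φ hφ => ?_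
  · refine ae_restrict_of_ae ?_
    filter_upwards [H.ae_intervalIntegrable_prim, ae_shift h H.ae_intervalIntegrable_prim]
      with τ h1 h2
    exact ((h2.sub h1).const_mul _).sub
      (intervalIntegrable_stek_of_bound hh H.meas_g H.abs_g τ 0 1)
  · exact Eventually.of_forall fun τ => (H.intervalIntegrable_stek_p h τ 0 1).add
      (intervalIntegrable_stek_of_bound hh H.meas_s H.abs_s τ 0 1)
  · rw [ae_restrict_iff' measurableSet_Ioo]
    filter_upwards [hk φ hφ, ae_shift h (hk φ hφ), H.ae_intervalIntegrable_prim,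
      ae_shift h H.ae_intervalIntegrable_prim] with τ h1 h2 i1 i2 hτ
    have e1 := h1 ⟨hτ.1, by linarith [hτ.2]⟩
    have e2 := h2 ⟨by linarith [hτ.1], by linarith [hτ.2]⟩
    have hJ : ∀ c d : ℝ, IntervalIntegrable (fun τ => ∫ x in (0 : ℝ)..1,
        (-(p x τ + s x τ) * deriv φ x + g x τ * φ x)) volume c d := by
      intro c d
      rw [intervalIntegrable_iff]
      simp only [intervalIntegral.integral_of_le zero_le_one]
      exact (H.integrable_flux hφ (A := Ioc 0 1) (A' := uIoc c d) (by simp)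
        (by simp [uIoc])).integral_prod_right
    have e3 : (∫ τ in a..τ + h, ∫ x in (0 : ℝ)..1,
        (-(p x τ + s x τ) * deriv φ x + g x τ * φ x)) -
        (∫ τ in a..τ, ∫ x in (0 : ℝ)..1, (-(p x τ + s x τ) * deriv φ x + g x τ * φ x)) =
        ∫ x in (0 : ℝ)..1, ∫ r in τ..τ + h, (-(p x r + s x r) * deriv φ x + g x r * φ x) := by
      rw [intervalIntegral.integral_interval_sub_left (hJ _ _) (hJ _ _), intervalIntegral_swap]
      exact (H.integrable_flux hφ (A := uIoc 0 1) (A' := uIoc τ (τ + h))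
        (by simp [uIoc]) (by simp [uIoc])).swap
    have e4 : ∫ x in (0 : ℝ)..1, ∫ r in τ..τ + h,
        (-(p x r + s x r) * deriv φ x + g x r * φ x) =
        ∫ x in (0 : ℝ)..1, h * (-((stek h (p x) τ + stek h (s x) τ) * deriv φ x) +
          stek h (g x) τ * φ x) := by
      refine intervalIntegral.integral_congr_ae ?_
      filter_upwards [H.ae_integrable_right] with x hx _
      have j1 : IntervalIntegrable (p x) volume τ (τ + h) := hx.intervalIntegrable
      have j2 := H.intervalIntegrable_s x τ (τ + h)
      have j3 := H.intervalIntegrable_g x τ (τ + h)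
      have j4 : IntervalIntegrable (fun r => -(p x r + s x r)) volume τ (τ + h) :=
        (j1.add j2).neg
      rw [intervalIntegral.integral_add (j4.mul_const _) (j3.mul_const _),
        intervalIntegral.integral_mul_const, intervalIntegral.integral_mul_const,
        intervalIntegral.integral_neg, intervalIntegral.integral_add j1 j2]
      simp only [stek]
      field_simp
    have i3 : IntervalIntegrable (fun x => prim p x τ * φ x) volume 0 1 :=
      intervalIntegrable_mul_test i1 hφ
    have i4 : IntervalIntegrable (fun x => prim p x (τ + h) * φ x) volume 0 1 :=
      intervalIntegrable_mul_test i2 hφ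
    have i5 : IntervalIntegrable (fun x => (stek h (p x) τ + stek h (s x) τ) * deriv φ x)
        volume 0 1 :=
      intervalIntegrable_mul_test ((H.intervalIntegrable_stek_p h τ 0 1).add
        (intervalIntegrable_stek_of_bound hh H.meas_s H.abs_s τ 0 1)) hφ.deriv
    have i6 : IntervalIntegrable (fun x => stek h (g x) τ * φ x) volume 0 1 :=
      intervalIntegrable_mul_test
        (intervalIntegrable_stek_of_bound hh H.meas_g H.abs_g τ 0 1) hφ
    have i7 : IntervalIntegrable
        (fun x => -((stek h (p x) τ + stek h (s x) τ) * deriv φ x)) volume 0 1 := i5.neg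
    rw [intervalIntegral.integral_const_mul, intervalIntegral.integral_add i7 i6,
      intervalIntegral.integral_neg] at e4
    have e5 : ∫ x in (0 : ℝ)..1,
        (h⁻¹ * (prim p x (τ + h) - prim p x τ) - stek h (g x) τ) * φ x =
        h⁻¹ * ((∫ x in (0 : ℝ)..1, prim p x (τ + h) * φ x) -
          ∫ x in (0 : ℝ)..1, prim p x τ * φ x) - ∫ x in (0 : ℝ)..1, stek h (g x) τ * φ x := by
      rw [← intervalIntegral.integral_sub i4 i3, ← intervalIntegral.integral_const_mul,
        ← intervalIntegral.integral_sub ((i4.sub i3).const_mul _) i6]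
      exact intervalIntegral.integral_congr fun x _ => by ring
    have e6 : (∫ x in (0 : ℝ)..1, prim p x (τ + h) * φ x) -
        (∫ x in (0 : ℝ)..1, prim p x τ * φ x) =
        h * (-(∫ x in (0 : ℝ)..1, (stek h (p x) τ + stek h (s x) τ) * deriv φ x) +
          ∫ x in (0 : ℝ)..1, stek h (g x) τ * φ x) := by
      rw [← e4, ← e3, e1, e2]; ring
    rw [e5, e6]
    field_simp
    ring

end EnergyData

namespace EnergyData

variable {a b B M : ℝ} {p s g : ℝ → ℝ → ℝ}

/-- The Steklov averaged equation tested with the average of `w` itself. Writing `P`, `S`, `G` for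
the averages of `p`, `s`, `g`, this gives `∫ P (P + S) + ∫ w_h ∂ₜw_h = ∫ w_h G`, and half of `∫ P²`
absorbs the right-hand side. -/
lemma ae_stek_dissipation (H : EnergyData a b B M p s g) {h : ℝ} (hh : 0 < h) :
    ∀ᵐ τ ∂volume.restrict (Ioo a (b - h)),
      IntervalIntegrable (fun x => stek h (p x) τ ^ 2 / 2 + stek h (p x) τ * stek h (s x) τ + 2)
        volume 0 1 ∧
      (∫ x in (0 : ℝ)..1, (stek h (p x) τ ^ 2 / 2 + stek h (p x) τ * stek h (s x) τ + 2)) +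
        (∫ x in (0 : ℝ)..1, stek h (prim p x) τ * (h⁻¹ * (prim p x (τ + h) - prim p x τ))) ≤
        B ^ 2 / 2 + 2 := by
  filter_upwards [H.ae_stek_weak hh, ae_restrict_mem measurableSet_Ioo,
    ae_restrict_of_ae H.ae_intervalIntegrable_prim,
    ae_restrict_of_ae (ae_shift h H.ae_intervalIntegrable_prim)] with τ hτ hmem hw1 hw2
  set P : ℝ → ℝ := fun x => stek h (p x) τ with hP
  set S : ℝ → ℝ := fun x => stek h (s x) τ with hS
  set G : ℝ → ℝ := fun x => stek h (g x) τ with hG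
  set D : ℝ → ℝ := fun x => h⁻¹ * (prim p x (τ + h) - prim p x τ) with hD
  have iP : IntervalIntegrable P volume 0 1 := H.intervalIntegrable_stek_p h τ 0 1
  have iS : IntervalIntegrable S volume 0 1 :=
    intervalIntegrable_stek_of_bound hh H.meas_s H.abs_s τ 0 1
  have iG : IntervalIntegrable G volume 0 1 :=
    intervalIntegrable_stek_of_bound hh H.meas_g H.abs_g τ 0 1
  have iD : IntervalIntegrable D volume 0 1 := (hw2.sub hw1).const_mul _
  have iq : IntervalIntegrable (fun x => D x - G x) volume 0 1 := iD.sub iG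
  -- the averaged flux is absolutely continuous, so it may be multiplied by the integrable `P`
  obtain ⟨c, hc⟩ := ae_eq_primitive_of_weak_deriv zero_lt_one (iP.add iS) iq hτ
  have hc' : ∀ᵐ x, x ∈ uIoc (0 : ℝ) 1 → P x + S x = c + ∫ y in (0 : ℝ)..x, (D y - G y) := by
    have hne : ∀ᵐ t : ℝ, t ≠ 1 := by simp [ae_iff, measure_singleton]
    filter_upwards [hc, hne] with x hx hx1 hx'
    rw [uIoc_of_le zero_le_one] at hx'
    exact hx ⟨hx'.1, lt_of_le_of_ne hx'.2 hx1⟩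
  have hcont : ContinuousOn (fun x => c + ∫ y in (0 : ℝ)..x, (D y - G y)) (uIcc 0 1) :=
    (absolutelyContinuous_primitive iq c).continuousOn
  have iPQ : IntervalIntegrable (fun x => P x * (P x + S x)) volume 0 1 := by
    refine (iP.mul_continuousOn hcont).congr_ae ?_
    rw [EventuallyEq, ae_restrict_iff' measurableSet_uIoc]
    filter_upwards [hc'] with x hx hx'
    rw [hx hx']
  have bS : ∀ x, |S x| ≤ 2 := fun x => abs_stek_le hh (H.abs_s x)
  have bG : ∀ x, |G x| ≤ B := fun x => abs_stek_le hh (H.abs_g x)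
  have iPS : IntervalIntegrable (fun x => P x * S x) volume 0 1 := by
    rw [intervalIntegrable_iff] at iP iS ⊢
    exact iP.mul_bdd (c := 2) iS.aestronglyMeasurable (Eventually.of_forall bS)
  -- square integrability of `P` is not assumed: it comes from the regularity of the flux
  have iP2 : IntervalIntegrable (fun x => P x ^ 2) volume 0 1 := by
    refine (iPQ.sub iPS).congr fun x _ => ?_
    ring
  have hB : 0 ≤ B := (abs_nonneg _).trans (bG 0)
  have hv : ∀ x, stek h (prim p x) τ = 0 + ∫ y in (0 : ℝ)..x, P y := fun x => by
    rw [zero_add, H.stek_prim]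
  have hP1 : ∫ y in (0 : ℝ)..1, P y = 0 :=
    H.integral_stek_p_eq_zero hh hmem.1.le (by linarith [hmem.2])
  have hvc : ContinuousOn (fun x => 0 + ∫ y in (0 : ℝ)..x, P y) (uIcc 0 1) :=
    (absolutelyContinuous_primitive iP 0).continuousOn
  have e1 := integral_primitive_mul iP iq 0 c
  rw [hP1] at e1
  have e2 : ∫ x in (0 : ℝ)..1, P x * (c + ∫ y in (0 : ℝ)..x, (D y - G y)) =
      ∫ x in (0 : ℝ)..1, P x * (P x + S x) := by
    refine intervalIntegral.integral_congr_ae ?_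
    filter_upwards [hc'] with x hx hx'
    rw [hx hx']
  rw [e2] at e1
  have ivD := iD.continuousOn_mul hvc
  have ivG := iG.continuousOn_mul hvc
  have e3 : ∫ x in (0 : ℝ)..1, (0 + ∫ y in (0 : ℝ)..x, P y) * (D x - G x) =
      (∫ x in (0 : ℝ)..1, (0 + ∫ y in (0 : ℝ)..x, P y) * D x) -
        ∫ x in (0 : ℝ)..1, (0 + ∫ y in (0 : ℝ)..x, P y) * G x := by
    rw [← intervalIntegral.integral_sub ivD ivG]
    exact intervalIntegral.integral_congr fun x _ => by ring
  have e4 : ∫ x in (0 : ℝ)..1, (0 + ∫ y in (0 : ℝ)..x, P y) * G x ≤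
      B * ∫ x in (0 : ℝ)..1, |P x| := by
    have : ∫ x in (0 : ℝ)..1, (0 + ∫ y in (0 : ℝ)..x, P y) * G x ≤
        ∫ x in (0 : ℝ)..1, B * ∫ x in (0 : ℝ)..1, |P x| := by
      refine intervalIntegral.integral_mono_on zero_le_one ivG intervalIntegrable_const
        fun x hx => ?_
      rw [zero_add]
      have h1 : |∫ y in (0 : ℝ)..x, P y| ≤ ∫ y in (0 : ℝ)..1, |P y| :=
        (intervalIntegral.abs_integral_le_integral_abs hx.1).trans
          (intervalIntegral.integral_mono_interval le_rfl hx.1 hx.2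
            (Eventually.of_forall fun _ => abs_nonneg _) iP.abs)
      calc (∫ y in (0 : ℝ)..x, P y) * G x ≤ |∫ y in (0 : ℝ)..x, P y| * |G x| := by
            rw [← abs_mul]; exact le_abs_self _
        _ ≤ (∫ y in (0 : ℝ)..1, |P y|) * B :=
            mul_le_mul h1 (bG x) (abs_nonneg _) ((abs_nonneg _).trans h1)
        _ = _ := mul_comm _ _
    simpa using this
  have e5 : B * ∫ x in (0 : ℝ)..1, |P x| ≤ B ^ 2 / 2 + (∫ x in (0 : ℝ)..1, P x ^ 2) / 2 := by
    rw [← intervalIntegral.integral_const_mul]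
    have : ∫ x in (0 : ℝ)..1, B * |P x| ≤ ∫ x in (0 : ℝ)..1, (B ^ 2 / 2 + P x ^ 2 / 2) := by
      refine intervalIntegral.integral_mono_on zero_le_one (iP.abs.const_mul _)
        (intervalIntegrable_const.add (iP2.div_const _)) fun x _ => ?_
      nlinarith [sq_nonneg (B - |P x|), sq_abs (P x)]
    rw [intervalIntegral.integral_add intervalIntegrable_const (iP2.div_const _),
      intervalIntegral.integral_div] at this
    simpa using this
  have i1 : IntervalIntegrable (fun x => P x ^ 2 / 2 + P x * S x) volume 0 1 :=
    (iP2.div_const 2).add iPS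
  have e6 : ∫ x in (0 : ℝ)..1, (P x ^ 2 / 2 + P x * S x + 2) =
      (∫ x in (0 : ℝ)..1, P x * (P x + S x)) - (∫ x in (0 : ℝ)..1, P x ^ 2) / 2 + 2 := by
    have e7 : ∫ x in (0 : ℝ)..1, P x * (P x + S x) =
        (∫ x in (0 : ℝ)..1, P x ^ 2) + ∫ x in (0 : ℝ)..1, P x * S x := by
      rw [← intervalIntegral.integral_add iP2 iPS]
      exact intervalIntegral.integral_congr fun x _ => by ring
    rw [intervalIntegral.integral_add i1 intervalIntegrable_const,
      intervalIntegral.integral_add (iP2.div_const 2) iPS, intervalIntegral.integral_div, e7]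
    simp
    ring
  refine ⟨i1.add intervalIntegrable_const, ?_⟩
  rw [e6]
  simp_rw [hv]
  linarith

/-- The energy inequality for the Steklov averages, before passing to the limit. The summand `2`
makes the dissipation integrand nonnegative, so that Fatou's lemma applies to it. -/
lemma stek_energy_le (H : EnergyData a b B M p s g) {h σ t : ℝ} (hh : 0 < h) (ha : a ≤ σ)
    (hst : σ ≤ t) (hb : t + h ≤ b) :
    (∫⁻ τ in Ioc σ t, ∫⁻ x in Ioc (0 : ℝ) 1, ENNReal.ofReal
        (stek h (p x) τ ^ 2 / 2 + stek h (p x) τ * stek h (s x) τ + 2)) +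
      ENNReal.ofReal ((∫ x in (0 : ℝ)..1, stek h (prim p x) t ^ 2) / 2) ≤
      ENNReal.ofReal ((B ^ 2 / 2 + 2) * (t - σ) +
        (∫ x in (0 : ℝ)..1, stek h (prim p x) σ ^ 2) / 2) := by
  set E : ℝ → ℝ := fun τ =>
    ∫ x in (0 : ℝ)..1, stek h (prim p x) τ * (h⁻¹ * (prim p x (τ + h) - prim p x τ)) with hE
  have hnn : ∀ x τ, 0 ≤ stek h (p x) τ ^ 2 / 2 + stek h (p x) τ * stek h (s x) τ + 2 := by
    intro x τ
    have h1 := abs_le.1 (abs_stek_le hh (H.abs_s x) (s := τ))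
    nlinarith [sq_nonneg (stek h (p x) τ + stek h (s x) τ)]
  have hne : ∀ᵐ τ : ℝ, τ ≠ b - h := by simp [ae_iff, measure_singleton]
  have hae : ∀ᵐ τ ∂volume.restrict (Ioc σ t),
      (∫⁻ x in Ioc (0 : ℝ) 1, ENNReal.ofReal
        (stek h (p x) τ ^ 2 / 2 + stek h (p x) τ * stek h (s x) τ + 2)) ≤
        ENNReal.ofReal (B ^ 2 / 2 + 2 - E τ) ∧ 0 ≤ B ^ 2 / 2 + 2 - E τ := by
    have h1 := H.ae_stek_dissipation hh
    rw [ae_restrict_iff' measurableSet_Ioo] at h1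
    rw [ae_restrict_iff' measurableSet_Ioc]
    filter_upwards [h1, hne] with τ hτ hτ' hmem
    obtain ⟨h2, h3⟩ := hτ ⟨ha.trans_lt hmem.1, lt_of_le_of_ne (by linarith [hmem.2]) hτ'⟩
    have h4 : 0 ≤ ∫ x in (0 : ℝ)..1,
        (stek h (p x) τ ^ 2 / 2 + stek h (p x) τ * stek h (s x) τ + 2) :=
      intervalIntegral.integral_nonneg zero_le_one fun x _ => hnn x τ
    refine ⟨?_, by linarith⟩
    rw [← ofReal_integral_eq_lintegral_ofReal
      ((intervalIntegrable_iff_integrableOn_Ioc_of_le zero_le_one).1 h2)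
      (Eventually.of_forall fun x => hnn x τ), ← intervalIntegral.integral_of_le zero_le_one]
    exact ENNReal.ofReal_le_ofReal (by linarith)
  have iE : IntegrableOn E (Ioc σ t) := by
    have := (H.integrable_stek_mul hh (Ioc σ t)).integral_prod_right
    simp only [hE, intervalIntegral.integral_of_le zero_le_one]
    exact this
  have i2 : IntegrableOn (fun τ => B ^ 2 / 2 + 2 - E τ) (Ioc σ t) :=
    (integrableOn_const (by simp)).sub iE
  have h5 : (∫⁻ τ in Ioc σ t, ∫⁻ x in Ioc (0 : ℝ) 1, ENNReal.ofReal
        (stek h (p x) τ ^ 2 / 2 + stek h (p x) τ * stek h (s x) τ + 2)) ≤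
      ENNReal.ofReal (∫ τ in Ioc σ t, (B ^ 2 / 2 + 2 - E τ)) := by
    rw [ofReal_integral_eq_lintegral_ofReal i2 (hae.mono fun τ h => h.2)]
    exact lintegral_mono_ae (hae.mono fun τ h => h.1)
  have h6 : 0 ≤ ∫ τ in Ioc σ t, (B ^ 2 / 2 + 2 - E τ) :=
    integral_nonneg_of_ae (hae.mono fun τ h => h.2)
  have h7 : ∫ τ in Ioc σ t, (B ^ 2 / 2 + 2 - E τ) =
      (B ^ 2 / 2 + 2) * (t - σ) - ∫ τ in σ..t, E τ := by
    rw [intervalIntegral.integral_of_le hst, integral_sub (integrable_const _) iE]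
    simp [hst]
    ring
  have h8 := H.stek_energy_identity hh hst
  have h9 : 0 ≤ ∫ x in (0 : ℝ)..1, stek h (prim p x) t ^ 2 :=
    intervalIntegral.integral_nonneg zero_le_one fun x _ => sq_nonneg _
  refine (add_le_add_left h5 _).trans ?_
  rw [← ENNReal.ofReal_add h6 (by positivity), h7]
  refine ENNReal.ofReal_le_ofReal ?_
  simp only [hE]
  linarith

lemma measurable_energy (H : EnergyData a b B M p s g) :
    Measurable fun r => ∫ x in (0 : ℝ)..1, prim p x r ^ 2 := by
  refine measurable_parametric_intervalIntegral (α := ℝ) (f := fun r x => prim p x r ^ 2) ?_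
    measurable_const measurable_const
  exact (H.measurable_prim.comp (measurable_snd.prodMk measurable_fst)).pow_const 2

lemma integrable_energy (H : EnergyData a b B M p s g) :
    Integrable ((Ioo a b).indicator fun r => ∫ x in (0 : ℝ)..1, prim p x r ^ 2) := by
  rw [integrable_indicator_iff measurableSet_Ioo]
  refine Integrable.mono' (g := fun _ => M) (integrable_const _)
    H.measurable_energy.aestronglyMeasurable ?_
  rw [ae_restrict_iff' measurableSet_Ioo]
  filter_upwards [H.bound] with r hr hr'
  rw [Real.norm_eq_abs, abs_of_nonneg
    (intervalIntegral.integral_nonneg zero_le_one fun x _ => sq_nonneg _)]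
  exact hr hr'

lemma ae_continuousOn_prim (H : EnergyData a b B M p s g) :
    ∀ᵐ τ, ContinuousOn (fun x => prim p x τ) (uIcc 0 1) := by
  filter_upwards [H.ae_integrable_left] with τ hτ
  exact intervalIntegral.continuousOn_primitive_interval'
    (hτ.intervalIntegrable (a := 0) (b := 1)) (by simp)

lemma integrable_prim_sq (H : EnergyData a b B M p s g) :
    Integrable (Function.uncurry fun x r => prim p x r ^ 2)
      ((volume.restrict (Ioc 0 1)).prod (volume.restrict (Ioo a b))) := by
  have hm : Measurable (Function.uncurry fun x r => prim p x r ^ 2) :=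
    H.measurable_prim.pow_const 2
  rw [integrable_prod_iff' hm.aestronglyMeasurable]
  constructor
  · refine ae_restrict_of_ae ?_
    filter_upwards [H.ae_continuousOn_prim] with τ hτ
    exact (intervalIntegrable_iff_integrableOn_Ioc_of_le zero_le_one).1
      (hτ.pow 2).intervalIntegrable
  · have := (integrable_indicator_iff measurableSet_Ioo).1 H.integrable_energy
    simp only [intervalIntegral.integral_of_le zero_le_one] at this
    simpa [IntegrableOn] using this

/-- Jensen's inequality for the energy of a Steklov average. -/
lemma stek_energy_le_stek (H : EnergyData a b B M p s g) {h σ : ℝ} (hh : 0 < h) (ha : a < σ)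
    (hb : σ + h < b) :
    ∫ x in (0 : ℝ)..1, stek h (prim p x) σ ^ 2 ≤
      stek h ((Ioo a b).indicator fun r => ∫ x in (0 : ℝ)..1, prim p x r ^ 2) σ := by
  have hsub : Ioc σ (σ + h) ⊆ Ioo a b := fun r hr => ⟨ha.trans hr.1, hr.2.trans_lt hb⟩
  have hle : σ ≤ σ + h := by linarith
  have i1 : Integrable (Function.uncurry fun x r => prim p x r ^ 2)
      ((volume.restrict (Ioc 0 1)).prod (volume.restrict (Ioc σ (σ + h)))) :=
    H.integrable_prim_sq.mono_measure
      (Measure.prod_mono le_rfl (Measure.restrict_mono hsub le_rfl))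
  have e1 : stek h ((Ioo a b).indicator fun r => ∫ x in (0 : ℝ)..1, prim p x r ^ 2) σ =
      ∫ x in (0 : ℝ)..1, stek h (fun r => prim p x r ^ 2) σ := by
    simp only [stek]
    rw [intervalIntegral.integral_const_mul, intervalIntegral_swap]
    · congr 1
      refine intervalIntegral.integral_congr_ae (Eventually.of_forall fun r hr => ?_)
      rw [uIoc_of_le hle] at hr
      simp [hsub hr]
    · rw [uIoc_of_le zero_le_one, uIoc_of_le hle]
      exact i1
  rw [e1]
  have i2 : IntervalIntegrable (fun x => stek h (fun r => prim p x r ^ 2) σ) volume 0 1 := by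
    rw [intervalIntegrable_iff_integrableOn_Ioc_of_le zero_le_one]
    refine Integrable.const_mul ?_ _
    simp only [intervalIntegral.integral_of_le hle]
    exact i1.integral_prod_left
  have hae : ∀ᵐ x ∂volume.restrict (Ioc (0 : ℝ) 1),
      stek h (prim p x) σ ^ 2 ≤ stek h (fun r => prim p x r ^ 2) σ := by
    filter_upwards [i1.prod_right_ae, ae_restrict_mem measurableSet_Ioc] with x hx hx'
    exact stek_sq_le hh (H.intervalIntegrable_prim (Ioc_subset_Icc_self hx') _ _)
      ((intervalIntegrable_iff_integrableOn_Ioc_of_le hle).2 hx)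
  rw [intervalIntegral.integral_of_le zero_le_one, intervalIntegral.integral_of_le zero_le_one]
  rw [intervalIntegrable_iff_integrableOn_Ioc_of_le zero_le_one] at i2
  exact integral_mono_of_nonneg (Eventually.of_forall fun _ => sq_nonneg _) i2 hae

lemma locallyIntegrable_s (H : EnergyData a b B M p s g) (x : ℝ) :
    LocallyIntegrable (s x) volume := by
  refine (locallyIntegrable_const (2 : ℝ)).mono
    (H.meas_s.comp (measurable_const.prodMk measurable_id)).aestronglyMeasurable
    (Eventually.of_forall fun t => ?_)
  simpa using H.abs_s x t

lemma measurable_stek_dissipation (H : EnergyData a b B M p s g) (h : ℝ) :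
    Measurable (Function.uncurry fun τ x => ENNReal.ofReal
      (stek h (p x) τ ^ 2 / 2 + stek h (p x) τ * stek h (s x) τ + 2)) := by
  have h1 := (measurable_stek H.meas_p h).comp measurable_swap
  have h2 := (measurable_stek H.meas_s h).comp measurable_swap
  exact ((((h1.pow_const 2).div_const 2).add (h1.mul h2)).add_const 2).ennreal_ofReal

lemma lintegral_lintegral_liminf_le {μ ν : Measure ℝ} [SFinite μ] {F : ℕ → ℝ → ℝ → ℝ≥0∞}
    (hF : ∀ n, Measurable (Function.uncurry (F n))) :
    ∫⁻ τ, ∫⁻ x, liminf (fun n => F n τ x) atTop ∂μ ∂ν ≤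
      liminf (fun n => ∫⁻ τ, ∫⁻ x, F n τ x ∂μ ∂ν) atTop :=
  (lintegral_mono fun _ => lintegral_liminf_le fun n =>
    (hF n).comp (measurable_const.prodMk measurable_id)).trans
    (lintegral_liminf_le fun n => (hF n).lintegral_prod_right')

/-- Fatou's lemma for the dissipation. -/
lemma lintegral_dissipation_le_liminf (H : EnergyData a b B M p s g) (σ t : ℝ) :
    (∫⁻ τ in Ioc σ t, ∫⁻ x in Ioc (0 : ℝ) 1, ENNReal.ofReal (p x τ ^ 2 / 2 + 2)) ≤
      liminf (fun n : ℕ => ∫⁻ τ in Ioc σ t, ∫⁻ x in Ioc (0 : ℝ) 1, ENNReal.ofReal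
        (stek (1 / ((n : ℝ) + 1)) (p x) τ ^ 2 / 2 +
          stek (1 / ((n : ℝ) + 1)) (p x) τ * stek (1 / ((n : ℝ) + 1)) (s x) τ + 2)) atTop := by
  have hp := ae_ae_tendsto_stek (μ := volume.restrict (Ioc (0 : ℝ) 1)) H.meas_p
    (ae_restrict_of_ae (H.ae_integrable_right.mono fun x hx => hx.locallyIntegrable))
  have hs := ae_ae_tendsto_stek (μ := volume.restrict (Ioc (0 : ℝ) 1)) H.meas_s
    (Eventually.of_forall H.locallyIntegrable_s)
  refine le_trans ?_ (lintegral_lintegral_liminf_le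
    fun n : ℕ => H.measurable_stek_dissipation (1 / ((n : ℝ) + 1)))
  refine lintegral_mono_ae (ae_restrict_of_ae ?_)
  filter_upwards [hp, hs] with τ h1 h2
  refine lintegral_mono_ae ?_
  filter_upwards [h1, h2] with x h3 h4
  have h5 := ENNReal.tendsto_ofReal ((((h3.pow 2).div_const 2).add (h3.mul h4)).add_const 2)
  rw [h5.liminf_eq]
  exact ENNReal.ofReal_le_ofReal (by linarith [H.sign x τ, mul_comm (s x τ) (p x τ)])

lemma ofReal_half_integral_sq {f : ℝ → ℝ} (hf : ContinuousOn f (uIcc 0 1)) :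
    ENNReal.ofReal ((∫ x in (0 : ℝ)..1, f x ^ 2) / 2) =
      ∫⁻ x in Ioc (0 : ℝ) 1, ENNReal.ofReal (f x ^ 2 / 2) := by
  have h : Integrable (fun x => f x ^ 2) (volume.restrict (Ioc 0 1)) :=
    (intervalIntegrable_iff_integrableOn_Ioc_of_le zero_le_one).1 (hf.pow 2).intervalIntegrable
  rw [intervalIntegral.integral_of_le zero_le_one, ← integral_div,
    ofReal_integral_eq_lintegral_ofReal (h.div_const 2)
      (Eventually.of_forall fun x => by positivity)]

/-- Fatou's lemma for the energy at a fixed time. -/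
lemma energy_le_liminf (H : EnergyData a b B M p s g) {t : ℝ}
    (ht1 : ∀ᵐ x ∂volume.restrict (Ioc (0 : ℝ) 1), Tendsto
      (fun n : ℕ => stek (1 / ((n : ℝ) + 1)) (prim p x) t) atTop (𝓝 (prim p x t)))
    (ht2 : ContinuousOn (fun x => prim p x t) (uIcc 0 1)) :
    ENNReal.ofReal ((∫ x in (0 : ℝ)..1, prim p x t ^ 2) / 2) ≤ liminf (fun n : ℕ =>
      ENNReal.ofReal ((∫ x in (0 : ℝ)..1, stek (1 / ((n : ℝ) + 1)) (prim p x) t ^ 2) / 2))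
      atTop := by
  have hc : ∀ n : ℕ, ContinuousOn (fun x => stek (1 / ((n : ℝ) + 1)) (prim p x) t) (uIcc 0 1) :=
    fun n => by
      simp only [H.stek_prim]
      exact intervalIntegral.continuousOn_primitive_interval'
        (H.intervalIntegrable_stek_p _ t 0 1) (by simp)
  rw [ofReal_half_integral_sq ht2]
  simp_rw [fun n => ofReal_half_integral_sq (hc n)]
  calc (∫⁻ x in Ioc (0 : ℝ) 1, ENNReal.ofReal (prim p x t ^ 2 / 2)) ≤
      ∫⁻ x in Ioc (0 : ℝ) 1, liminf (fun n : ℕ =>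
        ENNReal.ofReal (stek (1 / ((n : ℝ) + 1)) (prim p x) t ^ 2 / 2)) atTop := by
        refine lintegral_mono_ae ?_
        filter_upwards [ht1] with x hx
        rw [(ENNReal.tendsto_ofReal ((hx.pow 2).div_const 2)).liminf_eq]
    _ ≤ _ := by
        refine lintegral_liminf_le fun n => ?_
        have h1 : Measurable fun x => stek (1 / ((n : ℝ) + 1)) (prim p x) t :=
          (measurable_stek H.measurable_prim _).comp (measurable_id.prodMk measurable_const)
        exact ((h1.pow_const 2).div_const 2).ennreal_ofReal

/-- Superadditivity of the lower limit for extended nonnegative reals. -/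
lemma ennreal_liminf_add_le (u v : ℕ → ℝ≥0∞) :
    liminf u atTop + liminf v atTop ≤ liminf (fun n => u n + v n) atTop := by
  have mono : ∀ u : ℕ → ℝ≥0∞, Monotone fun n => ⨅ i ≥ n, u i := fun u m n hmn =>
    le_iInf₂ fun i hi => iInf₂_le i (hmn.trans hi)
  rw [liminf_eq_iSup_iInf_of_nat, liminf_eq_iSup_iInf_of_nat, liminf_eq_iSup_iInf_of_nat,
    ENNReal.iSup_add_iSup_of_monotone (mono u) (mono v)]
  exact iSup_mono fun n => le_iInf₂ fun i hi => add_le_add (iInf₂_le i hi) (iInf₂_le i hi)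

lemma lintegral_energy_le (H : EnergyData a b B M p s g) : ∃ A : Set ℝ, (∀ᵐ t, t ∈ A) ∧
    ∀ σ ∈ A, ∀ t ∈ A, a < σ → σ < t → t < b →
      (∫⁻ τ in Ioc σ t, ∫⁻ x in Ioc (0 : ℝ) 1, ENNReal.ofReal (p x τ ^ 2 / 2 + 2)) +
      ENNReal.ofReal ((∫ x in (0 : ℝ)..1, prim p x t ^ 2) / 2) ≤
      ENNReal.ofReal ((B ^ 2 / 2 + 2) * (t - σ) + (∫ x in (0 : ℝ)..1, prim p x σ ^ 2) / 2) := by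
  set D : ℝ → ℝ := (Ioo a b).indicator fun r => ∫ x in (0 : ℝ)..1, prim p x r ^ 2 with hD
  have hA1 : ∀ᵐ τ, ∀ᵐ x ∂volume.restrict (Ioc (0 : ℝ) 1), Tendsto
      (fun n : ℕ => stek (1 / ((n : ℝ) + 1)) (prim p x) τ) atTop (𝓝 (prim p x τ)) := by
    refine ae_ae_tendsto_stek H.measurable_prim ?_
    filter_upwards [ae_restrict_mem measurableSet_Ioc] with x hx
    exact (H.integrable_prim (Ioc_subset_Icc_self hx)).locallyIntegrable
  have hA2 := ae_tendsto_stek H.integrable_energy.locallyIntegrable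
  refine ⟨_, (hA1.and (hA2.and H.ae_continuousOn_prim)), ?_⟩
  rintro σ ⟨-, hσ2, -⟩ t ⟨ht1, -, ht3⟩ ha hst hb
  have hlim : Tendsto (fun n : ℕ => ENNReal.ofReal ((B ^ 2 / 2 + 2) * (t - σ) +
      stek (1 / ((n : ℝ) + 1)) D σ / 2)) atTop
      (𝓝 (ENNReal.ofReal ((B ^ 2 / 2 + 2) * (t - σ) + D σ / 2))) :=
    ENNReal.tendsto_ofReal ((hσ2.div_const 2).const_add _)
  have hDσ : D σ = ∫ x in (0 : ℝ)..1, prim p x σ ^ 2 :=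
    indicator_of_mem (show σ ∈ Ioo a b from ⟨ha, hst.trans hb⟩) _
  rw [← hDσ, ← hlim.liminf_eq]
  refine (add_le_add (H.lintegral_dissipation_le_liminf σ t)
    (H.energy_le_liminf ht1 ht3)).trans (le_trans (ennreal_liminf_add_le _ _) (liminf_le_liminf ?_))
  filter_upwards [(tendsto_one_div_add_atTop_nhds_zero_nat (𝕜 := ℝ)).eventually_lt_const
    (sub_pos.2 hb)] with n hn
  have hn0 : 0 < 1 / ((n : ℝ) + 1) := by positivity
  refine (H.stek_energy_le hn0 ha.le hst.le (by linarith)).trans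
    (ENNReal.ofReal_le_ofReal ?_)
  have := H.stek_energy_le_stek hn0 ha (by linarith)
  linarith

/-- The energy inequality: after testing with `w` itself, the part `s` of the flux only dissipates,
and half of the dissipation `∫ p²` absorbs the source `g`. -/
theorem energy_le (H : EnergyData a b B M p s g) : ∃ A : Set ℝ, (∀ᵐ t, t ∈ A) ∧
    ∀ σ ∈ A, ∀ t ∈ A, a < σ → σ < t → t < b →
      Integrable (Function.uncurry fun x τ => p x τ ^ 2)
        ((volume.restrict (Ioc 0 1)).prod (volume.restrict (Ioc σ t))) ∧
      (∫ x in (0 : ℝ)..1, prim p x t ^ 2) + (∫ τ in σ..t, ∫ x in (0 : ℝ)..1, p x τ ^ 2) ≤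
        (∫ x in (0 : ℝ)..1, prim p x σ ^ 2) + B ^ 2 * (t - σ) := by
  obtain ⟨A, hA, hle⟩ := H.lintegral_energy_le
  refine ⟨A, hA, fun σ hσ t ht ha hst hb => ?_⟩
  have hmain := hle σ hσ t ht ha hst hb
  have hm : Measurable (Function.uncurry fun x τ => p x τ ^ 2) := H.meas_p.pow_const 2
  set μ := (volume.restrict (Ioc (0 : ℝ) 1)).prod (volume.restrict (Ioc σ t)) with hμ
  have e1 : (∫⁻ τ in Ioc σ t, ∫⁻ x in Ioc (0 : ℝ) 1, ENNReal.ofReal (p x τ ^ 2 / 2 + 2)) =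
      ∫⁻ z, ENNReal.ofReal (p z.1 z.2 ^ 2 / 2 + 2) ∂μ := by
    rw [hμ, lintegral_prod_symm']
    exact ((hm.div_const 2).add_const 2).ennreal_ofReal
  rw [e1] at hmain
  have hfin : ∫⁻ z, ENNReal.ofReal (p z.1 z.2 ^ 2 / 2 + 2) ∂μ ≠ ⊤ :=
    ((le_self_add.trans hmain).trans_lt ENNReal.ofReal_lt_top).ne
  have i1 : Integrable (fun z : ℝ × ℝ => p z.1 z.2 ^ 2 / 2 + 2) μ := by
    refine ⟨((hm.div_const 2).add_const 2).aestronglyMeasurable, ?_⟩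
    rw [hasFiniteIntegral_iff_ofReal (Eventually.of_forall fun z => by positivity)]
    exact hfin.lt_top
  have i2 : Integrable (Function.uncurry fun x τ => p x τ ^ 2) μ := by
    have := (i1.sub (integrable_const (2 : ℝ))).const_mul 2
    refine this.congr (Eventually.of_forall fun z => ?_)
    simp only [Pi.sub_apply, Function.uncurry]
    ring
  refine ⟨i2, ?_⟩
  have e2 : ∫ τ in σ..t, ∫ x in (0 : ℝ)..1, p x τ ^ 2 =
      ∫ z, p z.1 z.2 ^ 2 ∂μ := by
    simp only [intervalIntegral.integral_of_le zero_le_one, intervalIntegral.integral_of_le hst.le]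
    exact (integral_prod_symm _ i2).symm
  have hX : 0 ≤ ∫ z, (p z.1 z.2 ^ 2 / 2 + 2) ∂μ := integral_nonneg fun z => by positivity
  have hY : 0 ≤ ∫ x in (0 : ℝ)..1, prim p x t ^ 2 :=
    intervalIntegral.integral_nonneg zero_le_one fun x _ => sq_nonneg _
  have hZ : 0 ≤ ∫ x in (0 : ℝ)..1, prim p x σ ^ 2 :=
    intervalIntegral.integral_nonneg zero_le_one fun x _ => sq_nonneg _
  rw [← ofReal_integral_eq_lintegral_ofReal i1 (Eventually.of_forall fun z => by positivity),
    ← ENNReal.ofReal_add hX (by positivity), ENNReal.ofReal_le_ofReal_iff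
      (by have := sub_pos.2 hst; positivity)] at hmain
  have e3 : ∫ z, (p z.1 z.2 ^ 2 / 2 + 2) ∂μ = (∫ z, p z.1 z.2 ^ 2 ∂μ) / 2 + 2 * (t - σ) := by
    have i3 : Integrable (fun z : ℝ × ℝ => p z.1 z.2 ^ 2 / 2) μ := i2.div_const 2
    have i4 : μ.real univ = t - σ := by
      rw [hμ, measureReal_def, ← univ_prod_univ, Measure.prod_prod]
      simp [hst.le]
    rw [integral_add i3 (integrable_const _), integral_div, integral_const, i4]
    simp only [smul_eq_mul]
    ring
  rw [e3] at hmain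
  rw [e2]
  linarith

end EnergyData

/-! ### The inverse of the operator `L` -/

/-- Truncation to `[-1, 1]`: the part of `q ∈ L(p)` in the graph of the sign. -/
noncomputable def clamp (q : ℝ) : ℝ := max (-1) (min 1 q)

/-- Soft thresholding, the single-valued inverse of `L`. -/
noncomputable def soft (q : ℝ) : ℝ := q - clamp q

lemma abs_clamp_le (q : ℝ) : |clamp q| ≤ 1 :=
  abs_le.2 ⟨le_max_left _ _, max_le (by norm_num) (min_le_left _ _)⟩

lemma continuous_clamp : Continuous clamp := by unfold clamp; fun_prop

lemma continuous_soft : Continuous soft := continuous_id.sub continuous_clamp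

lemma clamp_mono : Monotone clamp := fun _ _ h => max_le_max le_rfl (min_le_min le_rfl h)

lemma soft_of_one_le {q : ℝ} (h : 1 ≤ q) : soft q = q - 1 := by
  simp [soft, clamp, min_eq_left h]

lemma soft_of_le_neg_one {q : ℝ} (h : q ≤ -1) : soft q = q + 1 := by
  rw [soft, clamp, min_eq_right (by linarith), max_eq_left h, sub_neg_eq_add]

lemma soft_of_abs_le {q : ℝ} (h1 : -1 ≤ q) (h2 : q ≤ 1) : soft q = 0 := by
  rw [soft, clamp, min_eq_right h2, max_eq_right h1, sub_self]

lemma soft_neg (q : ℝ) : soft (-q) = -soft q := by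
  rcases le_total 1 q with h | h
  · rw [soft_of_one_le h, soft_of_le_neg_one (by linarith)]; ring
  rcases le_total q (-1) with h' | h'
  · rw [soft_of_le_neg_one h', soft_of_one_le (by linarith)]; ring
  · rw [soft_of_abs_le h' h, soft_of_abs_le (by linarith) (by linarith), neg_zero]

lemma soft_mono : Monotone soft := by
  intro x y h
  rcases le_total 1 x with h1 | h1
  · rw [soft_of_one_le h1, soft_of_one_le (h1.trans h)]; linarith
  rcases le_total x (-1) with h2 | h2
  · rcases le_total y (-1) with h3 | h3
    · rw [soft_of_le_neg_one h2, soft_of_le_neg_one h3]; linarith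
    · rcases le_total 1 y with h4 | h4
      · rw [soft_of_le_neg_one h2, soft_of_one_le h4]; linarith
      · rw [soft_of_le_neg_one h2, soft_of_abs_le h3 h4]; linarith
  · rcases le_total 1 y with h4 | h4
    · rw [soft_of_abs_le h2 h1, soft_of_one_le h4]; linarith
    · rw [soft_of_abs_le h2 h1, soft_of_abs_le (h2.trans h) h4]

lemma abs_soft_le (q : ℝ) : |soft q| ≤ |q| := by
  rcases le_total 1 q with h | h
  · rw [soft_of_one_le h, abs_of_nonneg (by linarith), abs_of_nonneg (by linarith)]; linarith
  rcases le_total q (-1) with h' | h'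
  · rw [soft_of_le_neg_one h', abs_of_nonpos (by linarith), abs_of_nonpos (by linarith)]; linarith
  · rw [soft_of_abs_le h' h, abs_zero]; exact abs_nonneg _

/-- The truncation and the soft thresholding are monotone functions of the same variable. -/
lemma clamp_sub_mul_soft_sub_nonneg (q r : ℝ) :
    0 ≤ (clamp q - clamp r) * (soft q - soft r) := by
  rcases le_total q r with h | h
  · nlinarith [clamp_mono h, soft_mono h]
  · nlinarith [clamp_mono h, soft_mono h]

/-- `soft` inverts `L`: with `mem_soft`, `q ∈ L(p)` if and only if `p = soft q`. -/
lemma eq_soft_of_mem {p q : ℝ} (h : q ∈ L₁ p) : p = soft q := by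
  obtain ⟨s, ⟨h1, h2, h3⟩, rfl⟩ := h
  rcases lt_trichotomy p 0 with hp | hp | hp
  · rw [h1 hp, soft_of_le_neg_one (by linarith)]; ring
  · have := h2 hp
    rw [hp, zero_add, soft_of_abs_le this.1 this.2]
  · rw [h3 hp, soft_of_one_le (by linarith)]; ring

lemma mem_soft (q : ℝ) : q ∈ L₁ (soft q) := by
  refine ⟨clamp q, ⟨fun h => ?_, fun _ => abs_le.1 (abs_clamp_le q), fun h => ?_⟩, by simp [soft]⟩
  · have : q ≤ -1 := by
      by_contra! hq
      rcases le_total 1 q with h1 | h1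
      · rw [soft_of_one_le h1] at h; linarith
      · rw [soft_of_abs_le hq.le h1] at h; exact lt_irrefl _ h
    rw [clamp, min_eq_right (by linarith), max_eq_left this]
  · have : 1 ≤ q := by
      by_contra! hq
      rcases le_total q (-1) with h1 | h1
      · rw [soft_of_le_neg_one h1] at h; linarith
      · rw [soft_of_abs_le h1 hq.le] at h; exact lt_irrefl _ h
    rw [clamp, min_eq_left this, max_eq_right (by norm_num)]

/-! ### Solutions in integrated form -/

/-- The flux of a solution paired with the gradient of a test function, plus the source. -/
noncomputable def flux (F σ : ℝ → ℝ → ℝ) (ψ : ℝ → ℝ) (τ : ℝ) : ℝ :=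
  ∫ x in (0 : ℝ)..1, (-σ x τ * deriv ψ x + F x τ * ψ x)

lemma integrable_fluxIntegrand {a b : ℝ} {F σ : ℝ → ℝ → ℝ} (hσ : Integrable (Function.uncurry σ)
    ((volume.restrict (Ioc 0 1)).prod (volume.restrict (Ioc a b))))
    (hF : Measurable (Function.uncurry F)) (hB : ∃ C, ∀ x t, |F x t| ≤ C) {ψ : ℝ → ℝ}
    (hψ : IsTest 0 1 ψ) :
    Integrable (Function.uncurry fun x τ => -σ x τ * deriv ψ x + F x τ * ψ x)
      ((volume.restrict (Ioc 0 1)).prod (volume.restrict (Ioc a b))) := by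
  obtain ⟨C, hC0, hC⟩ := hψ.exists_bound
  obtain ⟨C', hC0', hC'⟩ := hψ.deriv.exists_bound
  obtain ⟨B, hB⟩ := hB
  have iF : Integrable (Function.uncurry F)
      ((volume.restrict (Ioc 0 1)).prod (volume.restrict (Ioc a b))) :=
    (integrable_const B).mono' hF.aestronglyMeasurable
      (Eventually.of_forall fun z => hB z.1 z.2)
  have m1 : Measurable fun z : ℝ × ℝ => deriv ψ z.1 :=
    hψ.continuous_deriv.measurable.comp measurable_fst
  have m2 : Measurable fun z : ℝ × ℝ => ψ z.1 := hψ.continuous.measurable.comp measurable_fst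
  exact (hσ.neg.mul_bdd (c := C') m1.aestronglyMeasurable
    (Eventually.of_forall fun z => hC' z.1)).add (iF.mul_bdd (c := C) m2.aestronglyMeasurable
    (Eventually.of_forall fun z => hC z.1))

lemma integrableOn_flux_of_integrable {a b : ℝ} {F σ : ℝ → ℝ → ℝ}
    (hσ : Integrable (Function.uncurry σ)
      ((volume.restrict (Ioc 0 1)).prod (volume.restrict (Ioc a b))))
    (hF : Measurable (Function.uncurry F)) (hB : ∃ C, ∀ x t, |F x t| ≤ C) {ψ : ℝ → ℝ}
    (hψ : IsTest 0 1 ψ) : IntegrableOn (flux F σ ψ) (Ioc a b) := by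
  have := (integrable_fluxIntegrand hσ hF hB hψ).integral_prod_right
  unfold flux
  simp only [intervalIntegral.integral_of_le zero_le_one]
  exact this

/-- `u` solves `u_t = σ_x + F` on `(0, 1) × (a, b)` with a measurable integrable selection
`σ ∈ L(u_x)`, that is `u_x = soft σ`, and vanishes at both ends. The equation is tested in space
only and integrated in time, `k ψ` being the value at time `a` of `u` paired with `ψ`; no initial
value is prescribed. The field `bound` says that `u` is bounded in time with values in `L²`. -/
structure Sol (a b : ℝ) (F u σ : ℝ → ℝ → ℝ) : Prop where
  meas : Measurable (Function.uncurry σ)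
  int : Integrable (Function.uncurry σ) ((volume.restrict (Ioc 0 1)).prod (volume.restrict (Ioc a b)))
  eq_prim : ∀ᵐ t, t ∈ Ioo a b → ∀ x ∈ Icc (0 : ℝ) 1, u x t = ∫ y in (0 : ℝ)..x, soft (σ y t)
  right : ∀ᵐ t, t ∈ Ioo a b → u 1 t = 0
  bound : ∃ M, ∀ᵐ t, t ∈ Ioo a b → ∫ x in (0 : ℝ)..1, u x t ^ 2 ≤ M
  weak : ∃ k : (ℝ → ℝ) → ℝ, ∀ ψ, IsTest 0 1 ψ → ∀ᵐ t, t ∈ Ioo a b →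
    ∫ x in (0 : ℝ)..1, u x t * ψ x = k ψ + ∫ τ in a..t, flux F σ ψ τ
  measF : Measurable (Function.uncurry F)
  boundF : ∃ C, ∀ x t, |F x t| ≤ C

namespace Sol

variable {a b : ℝ} {F u σ : ℝ → ℝ → ℝ}

lemma integrable_flux_integrand (H : Sol a b F u σ) {ψ : ℝ → ℝ} (hψ : IsTest 0 1 ψ) :
    Integrable (Function.uncurry fun x τ => -σ x τ * deriv ψ x + F x τ * ψ x)
      ((volume.restrict (Ioc 0 1)).prod (volume.restrict (Ioc a b))) :=
  integrable_fluxIntegrand H.int H.measF H.boundF hψ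

lemma integrableOn_flux (H : Sol a b F u σ) {ψ : ℝ → ℝ} (hψ : IsTest 0 1 ψ) :
    IntegrableOn (flux F σ ψ) (Ioc a b) :=
  integrableOn_flux_of_integrable H.int H.measF H.boundF hψ

lemma intervalIntegrable_flux (H : Sol a b F u σ) {ψ : ℝ → ℝ} (hψ : IsTest 0 1 ψ) {c d : ℝ}
    (hc : c ∈ Icc a b) (hd : d ∈ Icc a b) : IntervalIntegrable (flux F σ ψ) volume c d := by
  rw [intervalIntegrable_iff]
  refine (H.integrableOn_flux hψ).mono_set fun x hx => ?_
  exact ⟨(le_min hc.1 hd.1).trans_lt hx.1, hx.2.trans (max_le hc.2 hd.2)⟩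

lemma restrict (H : Sol a b F u σ) {a' b' : ℝ} (ha : a ≤ a') (hab : a' ≤ b') (hb : b' ≤ b) :
    Sol a' b' F u σ where
  meas := H.meas
  int := H.int.mono_measure (Measure.prod_mono le_rfl
    (Measure.restrict_mono (Ioc_subset_Ioc ha hb) le_rfl))
  eq_prim := H.eq_prim.mono fun t h ht => h (Ioo_subset_Ioo ha hb ht)
  right := H.right.mono fun t h ht => h (Ioo_subset_Ioo ha hb ht)
  bound := H.bound.imp fun M h => h.mono fun t h ht => h (Ioo_subset_Ioo ha hb ht)
  weak := by
    obtain ⟨k, hk⟩ := H.weak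
    refine ⟨fun ψ => k ψ + ∫ τ in a..a', flux F σ ψ τ, fun ψ hψ => ?_⟩
    filter_upwards [hk ψ hψ] with t h ht
    have ha' : a' ∈ Icc a b := ⟨ha, hab.trans hb⟩
    have ht' : t ∈ Icc a b := Ioo_subset_Icc_self (Ioo_subset_Ioo ha hb ht)
    rw [h (Ioo_subset_Ioo ha hb ht), add_assoc, intervalIntegral.integral_add_adjacent_intervals
      (H.intervalIntegrable_flux hψ ⟨le_rfl, ha'.1.trans ha'.2⟩ ha')
      (H.intervalIntegrable_flux hψ ha' ht')]
  measF := H.measF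
  boundF := H.boundF

/-- Time translation of a solution. -/
lemma shift (H : Sol a b F u σ) (δ : ℝ) :
    Sol (a - δ) (b - δ) (fun x t => F x (t + δ)) (fun x t => u x (t + δ))
      (fun x t => σ x (t + δ)) where
  meas := H.meas.comp (measurable_fst.prodMk (measurable_snd.add_const δ))
  int := by
    have h1 : MeasurePreserving (fun t : ℝ => t + δ) (volume.restrict (Ioc (a - δ) (b - δ)))
        (volume.restrict (Ioc a b)) := by
      have := (measurePreserving_add_right (volume : Measure ℝ) δ).restrict_preimage
        (measurableSet_Ioc (a := a) (b := b))
      simpa using this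
    have h2 := (MeasurePreserving.id (volume.restrict (Ioc (0 : ℝ) 1))).prod h1
    exact (h2.integrable_comp H.meas.aestronglyMeasurable).2 H.int
  eq_prim := by
    filter_upwards [EnergyData.ae_shift δ H.eq_prim] with t h ht
    exact h ⟨by linarith [ht.1], by linarith [ht.2]⟩
  right := by
    filter_upwards [EnergyData.ae_shift δ H.right] with t h ht
    exact h ⟨by linarith [ht.1], by linarith [ht.2]⟩
  bound := by
    obtain ⟨M, hM⟩ := H.bound
    refine ⟨M, ?_⟩
    filter_upwards [EnergyData.ae_shift δ hM] with t h ht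
    exact h ⟨by linarith [ht.1], by linarith [ht.2]⟩
  weak := by
    obtain ⟨k, hk⟩ := H.weak
    refine ⟨k, fun ψ hψ => ?_⟩
    filter_upwards [EnergyData.ae_shift δ (hk ψ hψ)] with t h ht
    rw [h ⟨by linarith [ht.1], by linarith [ht.2]⟩]
    congr 1
    have := intervalIntegral.integral_comp_add_right (a := a - δ) (b := t) (flux F σ ψ) δ
    rw [sub_add_cancel] at this
    exact this.symm
  measF := H.measF.comp (measurable_fst.prodMk (measurable_snd.add_const δ))
  boundF := H.boundF.imp fun C h x t => h x (t + δ)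

/-- A time-independent function whose flux balances the force at every time is a solution. -/
lemma stationary {v : ℝ → ℝ} (hσ : Measurable (Function.uncurry σ)) {K : ℝ}
    (hK : ∀ x ∈ Icc (0 : ℝ) 1, ∀ t, |σ x t| ≤ K)
    (hv : ∀ t ∈ Ioo a b, ∀ x ∈ Icc (0 : ℝ) 1, v x = ∫ y in (0 : ℝ)..x, soft (σ y t))
    (h1 : v 1 = 0) (hF : Measurable (Function.uncurry F)) (hC : ∃ C, ∀ x t, |F x t| ≤ C)
    (hflux : ∀ t ∈ Ioo a b, ∀ ψ, IsTest 0 1 ψ → flux F σ ψ t = 0) :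
    Sol a b F (fun x _ => v x) σ where
  meas := hσ
  int := by
    refine (integrable_const K).mono' hσ.aestronglyMeasurable ?_
    have h1 : ∀ᵐ z ∂((volume.restrict (Ioc (0 : ℝ) 1)).prod (volume.restrict (Ioc a b))),
        z.1 ∈ Ioc (0 : ℝ) 1 :=
      Measure.quasiMeasurePreserving_fst.ae (ae_restrict_mem measurableSet_Ioc)
    filter_upwards [h1] with z hz
    exact hK z.1 (Ioc_subset_Icc_self hz) z.2
  eq_prim := Eventually.of_forall hv
  right := Eventually.of_forall fun _ _ => h1
  bound := ⟨_, Eventually.of_forall fun _ _ => le_rfl⟩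
  weak := by
    refine ⟨fun ψ => ∫ x in (0 : ℝ)..1, v x * ψ x, fun ψ hψ => Eventually.of_forall fun t ht => ?_⟩
    have h0 : ∫ τ in a..t, flux F σ ψ τ = 0 := by
      refine intervalIntegral.integral_zero_ae (Eventually.of_forall fun τ hτ => hflux τ ?_ ψ hψ)
      rw [uIoc_of_le ht.1.le] at hτ
      exact ⟨hτ.1, hτ.2.trans_lt ht.2⟩
    rw [h0, add_zero]
  measF := hF
  boundF := hC

lemma ae_integrable_soft (H : Sol a b F u σ) :
    ∀ᵐ t, t ∈ Ioo a b → IntervalIntegrable (fun x => soft (σ x t)) volume 0 1 := by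
  have h1 := H.int.prod_left_ae
  rw [ae_restrict_iff' measurableSet_Ioc] at h1
  filter_upwards [h1] with t ht ht'
  rw [intervalIntegrable_iff_integrableOn_Ioc_of_le zero_le_one]
  refine (ht (Ioo_subset_Ioc_self ht')).mono ((continuous_soft.measurable.comp
    (H.meas.comp (measurable_id.prodMk measurable_const))).aestronglyMeasurable)
    (Eventually.of_forall fun x => abs_soft_le _)

lemma ae_continuousOn (H : Sol a b F u σ) :
    ∀ᵐ t, t ∈ Ioo a b → ContinuousOn (fun x => u x t) (Icc 0 1) := by
  filter_upwards [H.ae_integrable_soft, H.eq_prim] with t h1 h2 ht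
  have := intervalIntegral.continuousOn_primitive_interval' (h1 ht) (a := 0) (by simp)
  rw [uIcc_of_le zero_le_one] at this
  exact this.congr fun x hx => h2 ht x hx

end Sol

/-! ### Comparison of two solutions -/

/-- Truncation of a function of space and time to the cylinder `(0, 1] × (a, b)`. -/
noncomputable def cut (a b : ℝ) (f : ℝ → ℝ → ℝ) (x t : ℝ) : ℝ :=
  (Ioc (0 : ℝ) 1 ×ˢ Ioo a b).indicator (Function.uncurry f) (x, t)

section cut

variable {a b : ℝ} {f : ℝ → ℝ → ℝ}

lemma cut_of_mem {x t : ℝ} (hx : x ∈ Ioc (0 : ℝ) 1) (ht : t ∈ Ioo a b) : cut a b f x t = f x t :=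
  indicator_of_mem (s := Ioc (0 : ℝ) 1 ×ˢ Ioo a b) ⟨hx, ht⟩ _

lemma cut_of_notMem {x t : ℝ} (h : ¬(x ∈ Ioc (0 : ℝ) 1 ∧ t ∈ Ioo a b)) : cut a b f x t = 0 :=
  indicator_of_notMem (s := Ioc (0 : ℝ) 1 ×ˢ Ioo a b) h _

lemma measurable_cut (hf : Measurable (Function.uncurry f)) :
    Measurable (Function.uncurry (cut a b f)) :=
  hf.indicator (measurableSet_Ioc.prod measurableSet_Ioo)

lemma abs_cut_le {C : ℝ} (hC : 0 ≤ C) (h : ∀ x ∈ Ioc (0 : ℝ) 1, ∀ t ∈ Ioo a b, |f x t| ≤ C)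
    (x t : ℝ) : |cut a b f x t| ≤ C := by
  by_cases hx : x ∈ Ioc (0 : ℝ) 1 ∧ t ∈ Ioo a b
  · rw [cut_of_mem hx.1 hx.2]; exact h x hx.1 t hx.2
  · rw [cut_of_notMem hx, abs_zero]; exact hC

lemma integrable_cut (hf : Integrable (Function.uncurry f)
    ((volume.restrict (Ioc 0 1)).prod (volume.restrict (Ioc a b)))) :
    Integrable (Function.uncurry (cut a b f)) (volume.prod volume) := by
  have : Function.uncurry (cut a b f) =
      (Ioc (0 : ℝ) 1 ×ˢ Ioo a b).indicator (Function.uncurry f) := rfl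
  rw [this, integrable_indicator_iff (measurableSet_Ioc.prod measurableSet_Ioo), IntegrableOn,
    ← Measure.prod_restrict]
  exact hf.mono_measure (Measure.prod_mono le_rfl (Measure.restrict_mono Ioo_subset_Ioc_self le_rfl))

lemma prim_cut {t : ℝ} (ht : t ∈ Ioo a b) {x : ℝ} (hx : x ∈ Icc (0 : ℝ) 1) :
    prim (cut a b f) x t = ∫ y in (0 : ℝ)..x, f y t := by
  refine intervalIntegral.integral_congr_ae (Eventually.of_forall fun y hy => ?_)
  rw [uIoc_of_le hx.1] at hy
  exact cut_of_mem ⟨hy.1, hy.2.trans hx.2⟩ ht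

end cut

namespace Sol

variable {a b B : ℝ} {F₁ F₂ u₁ u₂ σ₁ σ₂ : ℝ → ℝ → ℝ}

lemma ae_prim_cut_sub (H₁ : Sol a b F₁ u₁ σ₁) (H₂ : Sol a b F₂ u₂ σ₂) :
    ∀ᵐ t, t ∈ Ioo a b → ∀ x ∈ Icc (0 : ℝ) 1,
      prim (cut a b fun x t => soft (σ₁ x t) - soft (σ₂ x t)) x t = u₁ x t - u₂ x t := by
  filter_upwards [H₁.ae_integrable_soft, H₂.ae_integrable_soft, H₁.eq_prim, H₂.eq_prim]
    with t i1 i2 h1 h2 ht x hx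
  have hsub : uIcc (0 : ℝ) x ⊆ uIcc 0 1 := by
    rw [uIcc_of_le hx.1, uIcc_of_le zero_le_one]; exact Icc_subset_Icc_right hx.2
  rw [prim_cut ht hx, intervalIntegral.integral_sub ((i1 ht).mono_set hsub)
    ((i2 ht).mono_set hsub), h1 ht x hx, h2 ht x hx]

/-- The difference of two solutions provides data for the energy inequality. -/
lemma energyData_sub (H₁ : Sol a b F₁ u₁ σ₁) (H₂ : Sol a b F₂ u₂ σ₂) (hB : 0 ≤ B)
    (hF : ∀ x ∈ Ioc (0 : ℝ) 1, ∀ t ∈ Ioo a b, |F₁ x t - F₂ x t| ≤ B) :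
    ∃ M, EnergyData a b B M (cut a b fun x t => soft (σ₁ x t) - soft (σ₂ x t))
      (cut a b fun x t => clamp (σ₁ x t) - clamp (σ₂ x t))
      (cut a b fun x t => F₁ x t - F₂ x t) := by
  obtain ⟨M₁, hM₁⟩ := H₁.bound
  obtain ⟨M₂, hM₂⟩ := H₂.bound
  obtain ⟨k₁, hk₁⟩ := H₁.weak
  obtain ⟨k₂, hk₂⟩ := H₂.weak
  have hsoft : ∀ {σ u F : ℝ → ℝ → ℝ}, Sol a b F u σ →
      Integrable (Function.uncurry fun x t => soft (σ x t))
        ((volume.restrict (Ioc 0 1)).prod (volume.restrict (Ioc a b))) := fun H =>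
    H.int.mono (continuous_soft.measurable.comp H.meas).aestronglyMeasurable
      (Eventually.of_forall fun x => abs_soft_le _)
  refine ⟨2 * M₁ + 2 * M₂, ?_⟩
  constructor
  · exact measurable_cut ((continuous_soft.measurable.comp H₁.meas).sub
      (continuous_soft.measurable.comp H₂.meas))
  · exact integrable_cut ((hsoft H₁).sub (hsoft H₂))
  · exact measurable_cut ((continuous_clamp.measurable.comp H₁.meas).sub
      (continuous_clamp.measurable.comp H₂.meas))
  · refine abs_cut_le zero_le_two fun x _ t _ => ?_
    have h1 := abs_le.1 (abs_clamp_le (σ₁ x t))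
    have h2 := abs_le.1 (abs_clamp_le (σ₂ x t))
    exact abs_le.2 ⟨by linarith, by linarith⟩
  · intro x t
    by_cases hx : x ∈ Ioc (0 : ℝ) 1 ∧ t ∈ Ioo a b
    · rw [cut_of_mem hx.1 hx.2, cut_of_mem hx.1 hx.2]
      exact clamp_sub_mul_soft_sub_nonneg _ _
    · rw [cut_of_notMem hx, zero_mul]
  · exact measurable_cut (H₁.measF.sub H₂.measF)
  · exact abs_cut_le hB hF
  · filter_upwards [H₁.ae_prim_cut_sub H₂, H₁.right, H₂.right] with t h h1 h2 ht
    rw [h ht 1 (by simp), h1 ht, h2 ht, sub_zero]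
  · filter_upwards [H₁.ae_prim_cut_sub H₂, hM₁, hM₂, H₁.ae_continuousOn, H₂.ae_continuousOn]
      with t h h1 h2 c1 c2 ht
    have c1' := c1 ht
    have c2' := c2 ht
    rw [← uIcc_of_le zero_le_one] at c1' c2'
    have i1 : IntervalIntegrable (fun x => u₁ x t ^ 2) volume 0 1 := (c1'.pow 2).intervalIntegrable
    have i2 : IntervalIntegrable (fun x => u₂ x t ^ 2) volume 0 1 := (c2'.pow 2).intervalIntegrable
    have e1 : ∫ x in (0 : ℝ)..1,
        prim (cut a b fun x t => soft (σ₁ x t) - soft (σ₂ x t)) x t ^ 2 =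
        ∫ x in (0 : ℝ)..1, (u₁ x t - u₂ x t) ^ 2 := by
      refine intervalIntegral.integral_congr fun x hx => ?_
      rw [uIcc_of_le zero_le_one] at hx
      simp only [h ht x hx]
    have e2 : ∫ x in (0 : ℝ)..1, (u₁ x t - u₂ x t) ^ 2 ≤
        ∫ x in (0 : ℝ)..1, (2 * u₁ x t ^ 2 + 2 * u₂ x t ^ 2) :=
      intervalIntegral.integral_mono_on zero_le_one ((c1'.sub c2').pow 2).intervalIntegrable
        ((i1.const_mul 2).add (i2.const_mul 2)) fun x _ => by
          nlinarith [sq_nonneg (u₁ x t + u₂ x t)]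
    rw [intervalIntegral.integral_add (i1.const_mul 2) (i2.const_mul 2),
      intervalIntegral.integral_const_mul, intervalIntegral.integral_const_mul] at e2
    rw [e1]
    linarith [h1 ht, h2 ht]
  · refine ⟨fun ψ => k₁ ψ - k₂ ψ, fun ψ hψ => ?_⟩
    have hj1 := (H₁.integrable_flux_integrand hψ).prod_left_ae
    have hj2 := (H₂.integrable_flux_integrand hψ).prod_left_ae
    rw [ae_restrict_iff' measurableSet_Ioc] at hj1 hj2
    simp only [Function.uncurry] at hj1 hj2
    filter_upwards [H₁.ae_prim_cut_sub H₂, hk₁ ψ hψ, hk₂ ψ hψ, H₁.ae_continuousOn,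
      H₂.ae_continuousOn] with t h h1 h2 c1 c2 ht
    have c1' := c1 ht
    have c2' := c2 ht
    rw [← uIcc_of_le zero_le_one] at c1' c2'
    have e1 : ∫ x in (0 : ℝ)..1,
        prim (cut a b fun x t => soft (σ₁ x t) - soft (σ₂ x t)) x t * ψ x =
        (∫ x in (0 : ℝ)..1, u₁ x t * ψ x) - ∫ x in (0 : ℝ)..1, u₂ x t * ψ x := by
      rw [← intervalIntegral.integral_sub (intervalIntegrable_mul_test c1'.intervalIntegrable hψ)
        (intervalIntegrable_mul_test c2'.intervalIntegrable hψ)]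
      refine intervalIntegral.integral_congr fun x hx => ?_
      rw [uIcc_of_le zero_le_one] at hx
      simp only [h ht x hx, sub_mul]
    have ha : a ∈ Icc a b := ⟨le_rfl, (ht.1.trans ht.2).le⟩
    have ht' := Ioo_subset_Icc_self ht
    have e2 : ∫ τ in a..t, ∫ x in (0 : ℝ)..1,
        (-(cut a b (fun x t => soft (σ₁ x t) - soft (σ₂ x t)) x τ +
          cut a b (fun x t => clamp (σ₁ x t) - clamp (σ₂ x t)) x τ) * deriv ψ x +
          cut a b (fun x t => F₁ x t - F₂ x t) x τ * ψ x) =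
        (∫ τ in a..t, flux F₁ σ₁ ψ τ) - ∫ τ in a..t, flux F₂ σ₂ ψ τ := by
      rw [← intervalIntegral.integral_sub (H₁.intervalIntegrable_flux hψ ha ht')
        (H₂.intervalIntegrable_flux hψ ha ht')]
      refine intervalIntegral.integral_congr_ae ?_
      filter_upwards [hj1, hj2] with τ j1 j2 hτ
      rw [uIoc_of_le ht.1.le] at hτ
      have hτ' : τ ∈ Ioo a b := ⟨hτ.1, hτ.2.trans_lt ht.2⟩
      rw [flux, flux, ← intervalIntegral.integral_sub
        ((intervalIntegrable_iff_integrableOn_Ioc_of_le zero_le_one).2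
          (j1 (Ioo_subset_Ioc_self hτ')))
        ((intervalIntegrable_iff_integrableOn_Ioc_of_le zero_le_one).2
          (j2 (Ioo_subset_Ioc_self hτ')))]
      refine intervalIntegral.integral_congr_ae (Eventually.of_forall fun x hx => ?_)
      rw [uIoc_of_le zero_le_one] at hx
      simp only [cut_of_mem hx hτ', soft]
      ring
    rw [e1, e2, h1 ht, h2 ht]
    ring

/-- The energy inequality for the difference of two solutions: the fluxes differ by the difference
of the gradients plus a term of the same sign, the difference of the `clamp`s. -/
theorem energy_sub_le (H₁ : Sol a b F₁ u₁ σ₁) (H₂ : Sol a b F₂ u₂ σ₂) (hB : 0 ≤ B)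
    (hF : ∀ x ∈ Ioc (0 : ℝ) 1, ∀ t ∈ Ioo a b, |F₁ x t - F₂ x t| ≤ B) :
    ∃ A : Set ℝ, (∀ᵐ t, t ∈ A) ∧ ∀ s ∈ A, ∀ t ∈ A, a < s → s < t → t < b →
      Integrable (Function.uncurry fun x τ => (soft (σ₁ x τ) - soft (σ₂ x τ)) ^ 2)
        ((volume.restrict (Ioc 0 1)).prod (volume.restrict (Ioc s t))) ∧
      (∫ x in (0 : ℝ)..1, (u₁ x t - u₂ x t) ^ 2) +
        (∫ τ in s..t, ∫ x in (0 : ℝ)..1, (soft (σ₁ x τ) - soft (σ₂ x τ)) ^ 2) ≤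
        (∫ x in (0 : ℝ)..1, (u₁ x s - u₂ x s) ^ 2) + B ^ 2 * (t - s) := by
  obtain ⟨M, H⟩ := H₁.energyData_sub H₂ hB hF
  obtain ⟨A, hA, hle⟩ := H.energy_le
  refine ⟨_, hA.and (H₁.ae_prim_cut_sub H₂), ?_⟩
  rintro s ⟨hs, hs'⟩ t ⟨ht, ht'⟩ has hst htb
  obtain ⟨h1, h2⟩ := hle s hs t ht has hst htb
  have hmem : ∀ τ ∈ Ioc s t, τ ∈ Ioo a b := fun τ hτ => ⟨has.trans hτ.1, hτ.2.trans_lt htb⟩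
  constructor
  · refine h1.congr ?_
    have k1 : ∀ᵐ z ∂((volume.restrict (Ioc (0 : ℝ) 1)).prod (volume.restrict (Ioc s t))),
        z.1 ∈ Ioc (0 : ℝ) 1 :=
      Measure.quasiMeasurePreserving_fst.ae (ae_restrict_mem measurableSet_Ioc)
    have k2 : ∀ᵐ z ∂((volume.restrict (Ioc (0 : ℝ) 1)).prod (volume.restrict (Ioc s t))),
        z.2 ∈ Ioc s t :=
      Measure.quasiMeasurePreserving_snd.ae (ae_restrict_mem measurableSet_Ioc)
    filter_upwards [k1, k2] with z hz1 hz2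
    simp only [Function.uncurry, cut_of_mem hz1 (hmem _ hz2)]
  · have e1 : ∀ {τ}, τ ∈ Ioo a b → (∀ x ∈ Icc (0 : ℝ) 1,
        prim (cut a b fun x t => soft (σ₁ x t) - soft (σ₂ x t)) x τ = u₁ x τ - u₂ x τ) →
        ∫ x in (0 : ℝ)..1, prim (cut a b fun x t => soft (σ₁ x t) - soft (σ₂ x t)) x τ ^ 2 =
        ∫ x in (0 : ℝ)..1, (u₁ x τ - u₂ x τ) ^ 2 := fun {τ} hτ h => by
      refine intervalIntegral.integral_congr fun x hx => ?_
      rw [uIcc_of_le zero_le_one] at hx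
      simp only [h x hx]
    have hs'' : s ∈ Ioo a b := ⟨has, hst.trans htb⟩
    have ht'' : t ∈ Ioo a b := ⟨has.trans hst, htb⟩
    rw [e1 hs'' (hs' hs''), e1 ht'' (ht' ht'')] at h2
    convert! h2 using 2
    refine intervalIntegral.integral_congr_ae (Eventually.of_forall fun τ hτ => ?_)
    rw [uIoc_of_le hst.le] at hτ
    refine intervalIntegral.integral_congr_ae (Eventually.of_forall fun x hx => ?_)
    rw [uIoc_of_le zero_le_one] at hx
    simp only [cut_of_mem hx (hmem τ hτ)]

end Sol

/-! ### The steady states -/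

/-- The profile `-2 χ_[3/8,5/8] + χ_[1/4,3/4]` of the perturbation of the force. -/
noncomputable def bump (x : ℝ) : ℝ :=
  -2 * (Icc (3 / 8 : ℝ) (5 / 8)).indicator 1 x + (Icc (1 / 4 : ℝ) (3 / 4)).indicator 1 x

lemma steadyForce_eq (β x : ℝ) : steadyForce β x = 4 + β * bump x := rfl

lemma measurable_bump : Measurable bump :=
  (((measurable_const (a := (1 : ℝ))).indicator measurableSet_Icc).const_mul _).add
    ((measurable_const (a := (1 : ℝ))).indicator measurableSet_Icc)

lemma bump_eq_neg_one {x : ℝ} (h : x ∈ Icc (3 / 8 : ℝ) (5 / 8)) : bump x = -1 := by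
  have : x ∈ Icc (1 / 4 : ℝ) (3 / 4) := ⟨by linarith [h.1], by linarith [h.2]⟩
  rw [bump, indicator_of_mem h, indicator_of_mem this]
  norm_num

lemma bump_eq_one {x : ℝ} (h : x ∉ Icc (3 / 8 : ℝ) (5 / 8)) (h' : x ∈ Icc (1 / 4 : ℝ) (3 / 4)) :
    bump x = 1 := by
  rw [bump, indicator_of_notMem h, indicator_of_mem h']
  norm_num

lemma bump_eq_zero {x : ℝ} (h : x ∉ Icc (1 / 4 : ℝ) (3 / 4)) : bump x = 0 := by
  have : x ∉ Icc (3 / 8 : ℝ) (5 / 8) := fun h' =>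
    h ⟨by linarith [h'.1], by linarith [h'.2]⟩
  rw [bump, indicator_of_notMem h, indicator_of_notMem this]
  norm_num

lemma abs_bump_le (x : ℝ) : |bump x| ≤ 1 := by
  by_cases h : x ∈ Icc (3 / 8 : ℝ) (5 / 8)
  · rw [bump_eq_neg_one h]; norm_num
  by_cases h' : x ∈ Icc (1 / 4 : ℝ) (3 / 4)
  · rw [bump_eq_one h h']; norm_num
  · rw [bump_eq_zero h']; norm_num

lemma bump_symm (x : ℝ) : bump (1 - x) = bump x := by
  have e1 : 1 - x ∈ Icc (3 / 8 : ℝ) (5 / 8) ↔ x ∈ Icc (3 / 8 : ℝ) (5 / 8) :=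
    ⟨fun h => ⟨by linarith [h.2], by linarith [h.1]⟩,
      fun h => ⟨by linarith [h.2], by linarith [h.1]⟩⟩
  have e2 : 1 - x ∈ Icc (1 / 4 : ℝ) (3 / 4) ↔ x ∈ Icc (1 / 4 : ℝ) (3 / 4) :=
    ⟨fun h => ⟨by linarith [h.2], by linarith [h.1]⟩,
      fun h => ⟨by linarith [h.2], by linarith [h.1]⟩⟩
  simp only [bump, indicator_apply, e1, e2, Pi.one_apply]

lemma locallyIntegrable_bump : LocallyIntegrable bump volume :=
  (locallyIntegrable_const (1 : ℝ)).mono measurable_bump.aestronglyMeasurable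
    (Eventually.of_forall fun x => by simpa using abs_bump_le x)

lemma intervalIntegrable_bump (a b : ℝ) : IntervalIntegrable bump volume a b :=
  intervalIntegrable_of_locallyIntegrable locallyIntegrable_bump a b

/-- The primitive of `bump` that vanishes at the centre. -/
noncomputable def bumpPrim (x : ℝ) : ℝ := ∫ y in (1 / 2 : ℝ)..x, bump y

lemma bumpPrim_sub (x y : ℝ) : bumpPrim y - bumpPrim x = ∫ z in x..y, bump z :=
  intervalIntegral.integral_interval_sub_left (intervalIntegrable_bump _ _)
    (intervalIntegrable_bump _ _)

lemma bumpPrim_half : bumpPrim (1 / 2) = 0 := intervalIntegral.integral_same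

lemma continuous_bumpPrim : Continuous bumpPrim :=
  intervalIntegral.continuous_primitive intervalIntegrable_bump _

lemma bumpPrim_symm (x : ℝ) : bumpPrim (1 - x) = -bumpPrim x := by
  have h := intervalIntegral.integral_comp_sub_left (a := 1 / 2) (b := x) bump 1
  simp only [bump_symm] at h
  rw [bumpPrim, bumpPrim, h, intervalIntegral.integral_symm]
  norm_num

lemma bumpPrim_sub_of_const {x y k : ℝ} (hxy : x ≤ y) (h : ∀ z ∈ Ioo x y, bump z = k) :
    bumpPrim y - bumpPrim x = k * (y - x) := by
  have hne : ∀ᵐ t : ℝ, t ≠ y := by simp [ae_iff, measure_singleton]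
  have : ∫ z in x..y, bump z = ∫ z in x..y, k := by
    refine intervalIntegral.integral_congr_ae ?_
    filter_upwards [hne] with z hz hz'
    rw [uIoc_of_le hxy] at hz'
    exact h z ⟨hz'.1, lt_of_le_of_ne hz'.2 hz⟩
  rw [bumpPrim_sub, this, intervalIntegral.integral_const, smul_eq_mul, mul_comm]

lemma bumpPrim_of_mem₁ {x : ℝ} (h1 : 1 / 2 ≤ x) (h2 : x ≤ 5 / 8) : bumpPrim x = -(x - 1 / 2) := by
  have := bumpPrim_sub_of_const (k := -1) h1 fun z hz =>
    bump_eq_neg_one ⟨by linarith [hz.1], by linarith [hz.2]⟩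
  rw [bumpPrim_half] at this
  linarith

lemma bumpPrim_of_mem₂ {x : ℝ} (h1 : 5 / 8 ≤ x) (h2 : x ≤ 3 / 4) : bumpPrim x = x - 3 / 4 := by
  have h3 := bumpPrim_sub_of_const (k := 1) h1 fun z hz =>
    bump_eq_one (fun h => by linarith [h.2, hz.1]) ⟨by linarith [hz.1], by linarith [hz.2]⟩
  have h4 := bumpPrim_of_mem₁ (x := 5 / 8) (by norm_num) le_rfl
  linarith

lemma bumpPrim_of_mem₃ {x : ℝ} (h1 : 3 / 4 ≤ x) : bumpPrim x = 0 := by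
  have h3 := bumpPrim_sub_of_const (k := 0) h1 fun z hz =>
    bump_eq_zero (fun h => by linarith [h.2, hz.1])
  have h4 := bumpPrim_of_mem₂ (x := 3 / 4) (by norm_num) le_rfl
  linarith

lemma abs_bumpPrim_le {x : ℝ} (hx : x ∈ Icc (0 : ℝ) 1) : |bumpPrim x| ≤ 1 := by
  have := intervalIntegral.norm_integral_le_of_norm_le_const (a := 1 / 2) (b := x) (f := bump)
    (C := 1) fun y _ => abs_bump_le y
  refine (show |bumpPrim x| ≤ 1 * |x - 1 / 2| from this).trans ?_
  rw [one_mul]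
  exact abs_le.2 ⟨by linarith [hx.1], by linarith [hx.2]⟩

/-- The odd primitive of the force `steadyForce β` about the centre: the flux of the steady
solution. -/
noncomputable def steadyFlux (β x : ℝ) : ℝ := 4 * x - 2 + β * bumpPrim x

lemma continuous_steadyFlux₂ : Continuous fun z : ℝ × ℝ => steadyFlux z.1 z.2 :=
  ((continuous_const.mul continuous_snd).sub continuous_const).add
    (continuous_fst.mul (continuous_bumpPrim.comp continuous_snd))

lemma continuous_steadyFlux (β : ℝ) : Continuous (steadyFlux β) :=
  continuous_steadyFlux₂.comp (continuous_const.prodMk continuous_id)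

lemma steadyFlux_symm (β x : ℝ) : steadyFlux β (1 - x) = -steadyFlux β x := by
  rw [steadyFlux, steadyFlux, bumpPrim_symm]; ring

lemma intervalIntegrable_steadyForce (β a b : ℝ) :
    IntervalIntegrable (steadyForce β) volume a b :=
  intervalIntegrable_const.add ((intervalIntegrable_bump a b).const_mul β)

lemma steadyFlux_eq_primitive (β x : ℝ) :
    steadyFlux β x = steadyFlux β 0 + ∫ y in (0 : ℝ)..x, steadyForce β y := by
  have h : ∫ y in (0 : ℝ)..x, steadyForce β y = 4 * x + β * (bumpPrim x - bumpPrim 0) := by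
    simp only [steadyForce_eq]
    rw [intervalIntegral.integral_add intervalIntegrable_const
      ((intervalIntegrable_bump _ _).const_mul _), intervalIntegral.integral_const_mul,
      bumpPrim_sub]
    simp [mul_comm]
  rw [h, steadyFlux, steadyFlux]
  ring

lemma integral_steadyFlux_mul_deriv (β : ℝ) {φ : ℝ → ℝ} (hφ : IsTest 0 1 φ) :
    ∫ x in (0 : ℝ)..1, steadyFlux β x * deriv φ x = -∫ x in (0 : ℝ)..1, steadyForce β x * φ x := by
  rw [← integral_primitive_mul_deriv_test (intervalIntegrable_steadyForce β 0 1) hφ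
    (steadyFlux β 0)]
  simp only [← steadyFlux_eq_primitive]

/-- The slope of the steady solution: as the flux is odd about the centre, so is the slope, and its
primitive vanishes at both ends. -/
noncomputable def steadySlope (β x : ℝ) : ℝ := soft (steadyFlux β x)

lemma continuous_steadySlope (β : ℝ) : Continuous (steadySlope β) :=
  continuous_soft.comp (continuous_steadyFlux β)

lemma steadySlope_symm (β x : ℝ) : steadySlope β (1 - x) = -steadySlope β x := by
  rw [steadySlope, steadyFlux_symm, soft_neg]; rfl

/-- The steady solution for the force `steadyForce β`. -/
noncomputable def steady (β x : ℝ) : ℝ := ∫ y in (0 : ℝ)..x, steadySlope β y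

lemma hasDerivAt_steady (β x : ℝ) : HasDerivAt (steady β) (steadySlope β x) x :=
  intervalIntegral.integral_hasDerivAt_right ((continuous_steadySlope β).intervalIntegrable _ _)
    ((continuous_steadySlope β).stronglyMeasurableAtFilter _ _)
    (continuous_steadySlope β).continuousAt

lemma continuous_steady (β : ℝ) : Continuous (steady β) :=
  continuous_iff_continuousAt.2 fun x => (hasDerivAt_steady β x).continuousAt

lemma steady_sub (β x y : ℝ) : steady β y - steady β x = ∫ z in x..y, steadySlope β z :=
  intervalIntegral.integral_interval_sub_left ((continuous_steadySlope β).intervalIntegrable _ _)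
    ((continuous_steadySlope β).intervalIntegrable _ _)

lemma steady_zero (β : ℝ) : steady β 0 = 0 := intervalIntegral.integral_same

lemma integral_steadySlope_symm (β x y : ℝ) :
    ∫ z in 1 - y..1 - x, steadySlope β z = -∫ z in x..y, steadySlope β z := by
  have h := intervalIntegral.integral_comp_sub_left (a := x) (b := y) (steadySlope β) 1
  simp only [steadySlope_symm] at h
  rw [← h, intervalIntegral.integral_neg]

lemma steady_one (β : ℝ) : steady β 1 = 0 := by
  have h := integral_steadySlope_symm β 0 1
  norm_num at h
  rw [steady]
  linarith

lemma steady_symm (β x : ℝ) : steady β (1 - x) = steady β x := by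
  have h1 := integral_steadySlope_symm β 0 x
  rw [sub_zero, ← steady_sub, steady_one] at h1
  have h2 : steady β x = ∫ y in (0 : ℝ)..x, steadySlope β y := rfl
  linarith

lemma zeroDirichlet_steady (β : ℝ) : ZeroDirichlet (steady β) := by
  refine ⟨?_, steady_zero β, steady_one β⟩
  have := absolutelyContinuous_primitive
    ((continuous_steadySlope β).intervalIntegrable (μ := volume) 0 1) 0
  simp only [zero_add] at this
  exact this

lemma integral_Ioo_zero_one (f : ℝ → ℝ) :
    ∫ x in Ioo (0 : ℝ) 1, f x = ∫ x in (0 : ℝ)..1, f x := by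
  rw [intervalIntegral.integral_of_le zero_le_one, integral_Ioc_eq_integral_Ioo]

theorem isSteadySolution_steady (β : ℝ) : IsSteadySolution (steadyForce β) (steady β) := by
  refine ⟨zeroDirichlet_steady β, steadyFlux β, ?_, ?_, ?_⟩
  · rw [← intervalIntegrable_iff_integrableOn_Ioo_of_le zero_le_one]
    exact (continuous_steadyFlux β).intervalIntegrable _ _
  · refine Eventually.of_forall fun x => ?_
    rw [(hasDerivAt_steady β x).deriv]
    exact mem_soft _
  · intro φ h1 h2 h3
    rw [integral_Ioo_zero_one, integral_Ioo_zero_one]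
    exact integral_steadyFlux_mul_deriv β ⟨h1, h2, h3⟩

/-- Uniqueness: another steady solution has the same flux up to an additive constant, and by
monotonicity the boundary conditions fix the slope. -/
theorem eqOn_steady {β : ℝ} {v : ℝ → ℝ} (hv : IsSteadySolution (steadyForce β) v) :
    EqOn v (steady β) (Icc 0 1) := by
  obtain ⟨⟨hac, hv0, hv1⟩, σ, hσi, hσL, hσw⟩ := hv
  obtain ⟨c, hc⟩ := ae_eq_primitive_of_weak_deriv zero_lt_one
    ((intervalIntegrable_iff_integrableOn_Ioo_of_le zero_le_one).2 hσi)
    (intervalIntegrable_steadyForce β 0 1) fun φ hφ => by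
      rw [← integral_Ioo_zero_one, ← integral_Ioo_zero_one]
      exact hσw φ hφ.smooth hφ.compact hφ.supp
  obtain ⟨k, hk⟩ : ∃ k, k = c - steadyFlux β 0 := ⟨_, rfl⟩
  have hne : ∀ᵐ t : ℝ, t ≠ 1 := by simp [ae_iff, measure_singleton]
  rw [ae_restrict_iff' measurableSet_Ioo] at hσL
  have hd : ∀ᵐ x, x ∈ Ioc (0 : ℝ) 1 → deriv v x = soft (steadyFlux β x + k) := by
    filter_upwards [hc, hσL, hne] with x h1 h2 h3 hx
    have hx' : x ∈ Ioo (0 : ℝ) 1 := ⟨hx.1, lt_of_le_of_ne hx.2 h3⟩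
    rw [eq_soft_of_mem (h2 hx'), h1 hx', steadyFlux_eq_primitive, hk]
    congr 1
    ring
  have hvx : ∀ x ∈ Icc (0 : ℝ) 1, v x = ∫ y in (0 : ℝ)..x, soft (steadyFlux β y + k) := by
    intro x hx
    have hsub : uIcc (0 : ℝ) x ⊆ uIcc 0 1 := by
      rw [uIcc_of_le hx.1, uIcc_of_le zero_le_one]; exact Icc_subset_Icc_right hx.2
    have h1 := (hac.mono hsub).integral_deriv_eq_sub
    rw [hv0, sub_zero] at h1
    rw [← h1]
    refine intervalIntegral.integral_congr_ae ?_
    filter_upwards [hd] with y hy hy'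
    rw [uIoc_of_le hx.1] at hy'
    exact hy ⟨hy'.1, hy'.2.trans hx.2⟩
  have hci : Continuous fun y => soft (steadyFlux β y + k) :=
    continuous_soft.comp ((continuous_steadyFlux β).add continuous_const)
  have hcs := continuous_steadySlope β
  have hdiff : ∀ x ∈ Icc (0 : ℝ) 1, v x - steady β x =
      ∫ y in (0 : ℝ)..x, (soft (steadyFlux β y + k) - steadySlope β y) := fun x hx => by
    rw [hvx x hx, steady, intervalIntegral.integral_sub (hci.intervalIntegrable _ _)
      (hcs.intervalIntegrable _ _)]
  have h1 := hdiff 1 (by simp)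
  rw [hv1, steady_one, sub_self] at h1
  intro x hx
  have hx' := hdiff x hx
  have hii : ∀ a b, IntervalIntegrable
      (fun y => soft (steadyFlux β y + k) - steadySlope β y) volume a b :=
    fun a b => (hci.sub hcs).intervalIntegrable _ _
  have hadd := intervalIntegral.integral_add_adjacent_intervals (hii 0 x) (hii x 1)
  rcases le_total 0 k with hk0 | hk0
  · have hn : ∀ y, 0 ≤ soft (steadyFlux β y + k) - steadySlope β y := fun y =>
      sub_nonneg.2 (soft_mono (by linarith))
    have h2 := intervalIntegral.integral_nonneg (μ := volume) hx.1 fun y (_ : y ∈ Icc 0 x) => hn y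
    have h3 := intervalIntegral.integral_nonneg (μ := volume) hx.2 fun y (_ : y ∈ Icc x 1) => hn y
    linarith
  · have hn : ∀ y, 0 ≤ -(soft (steadyFlux β y + k) - steadySlope β y) := fun y =>
      neg_nonneg.2 (sub_nonpos.2 (soft_mono (by linarith)))
    have h2 := intervalIntegral.integral_nonneg (μ := volume) hx.1 fun y (_ : y ∈ Icc 0 x) => hn y
    have h3 := intervalIntegral.integral_nonneg (μ := volume) hx.2 fun y (_ : y ∈ Icc x 1) => hn y
    rw [intervalIntegral.integral_neg] at h2 h3
    linarith

/-! ### Facets of the steady states -/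

lemma steadySlope_eq_zero_of_flatOn {β a b : ℝ} (h : FlatOn (steady β) a b) {x : ℝ}
    (hx : x ∈ Ioo a b) : steadySlope β x = 0 := by
  have h1 : steady β =ᶠ[𝓝 x] fun _ => steady β a := by
    filter_upwards [Ioo_mem_nhds hx.1 hx.2] with y hy
    exact h y (Ioo_subset_Icc_self hy)
  exact (hasDerivAt_steady β x).unique ((hasDerivAt_const x _).congr_of_eventuallyEq h1)

lemma flatOn_steady {β a b : ℝ} (h : ∀ x ∈ Icc a b, steadySlope β x = 0) :
    FlatOn (steady β) a b := by
  intro x hx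
  have : steady β x - steady β a = 0 := by
    rw [steady_sub]
    refine intervalIntegral.integral_zero_ae (Eventually.of_forall fun y hy => ?_)
    rw [uIoc_of_le hx.1] at hy
    exact h y ⟨hy.1.le, hy.2.trans hx.2⟩
  linarith

/-- An interval on which the slope vanishes and outside of which, on both sides, it does not vanish
nearby, contains every flat interval that meets it. -/
lemma le_and_le_of_flatOn {β p q p' q' a b x : ℝ} (hp : p' < p) (hq : q < q')
    (hp' : ∀ x ∈ Ioo p' p, steadySlope β x ≠ 0) (hq' : ∀ x ∈ Ioo q q', steadySlope β x ≠ 0)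
    (h : FlatOn (steady β) a b) (hx : x ∈ Ioo a b) (hxp : p ≤ x) (hxq : x ≤ q) :
    p ≤ a ∧ b ≤ q := by
  constructor
  · by_contra! hap
    obtain ⟨y, hy1, hy2⟩ := exists_between (max_lt hp hap)
    have hy1' := max_lt_iff.1 hy1
    exact hp' y ⟨hy1'.1, hy2⟩
      (steadySlope_eq_zero_of_flatOn h ⟨hy1'.2, hy2.trans (hxp.trans_lt hx.2)⟩)
  · by_contra! hap
    obtain ⟨y, hy1, hy2⟩ := exists_between (lt_min hq hap)
    have hy2' := lt_min_iff.1 hy2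
    exact hq' y ⟨hy1, hy2'.1⟩
      (steadySlope_eq_zero_of_flatOn h ⟨(hx.1.trans_le hxq).trans hy1, hy2'.2⟩)

lemma isFacet_steady {β p q p' q' : ℝ} (h0 : 0 ≤ p) (hpq : p < q) (h1 : q ≤ 1) (hp : p' < p)
    (hq : q < q') (hz : ∀ x ∈ Icc p q, steadySlope β x = 0)
    (hp' : ∀ x ∈ Ioo p' p, steadySlope β x ≠ 0) (hq' : ∀ x ∈ Ioo q q', steadySlope β x ≠ 0) :
    IsFacet (steady β) p q := by
  refine ⟨h0, hpq, h1, flatOn_steady hz, fun a b _ hap hqb _ hf => ?_⟩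
  obtain ⟨x, hx1, hx2⟩ := exists_between hpq
  have := le_and_le_of_flatOn hp hq hp' hq' hf
    (x := x) ⟨hap.trans_lt hx1, hx2.trans_le hqb⟩ hx1.le hx2.le
  exact ⟨le_antisymm hap this.1, le_antisymm this.2 hqb⟩

lemma IsFacet.eq_of_mem {β p q p' q' a b x : ℝ} (h0 : 0 ≤ p) (h1 : q ≤ 1) (hp : p' < p)
    (hq : q < q') (hz : ∀ x ∈ Icc p q, steadySlope β x = 0)
    (hp' : ∀ x ∈ Ioo p' p, steadySlope β x ≠ 0) (hq' : ∀ x ∈ Ioo q q', steadySlope β x ≠ 0)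
    (h : IsFacet (steady β) a b) (hx : x ∈ Ioo a b) (hxp : p ≤ x) (hxq : x ≤ q) :
    a = p ∧ b = q := by
  obtain ⟨_, _, _, hf, hmax⟩ := h
  have := le_and_le_of_flatOn hp hq hp' hq' hf hx hxp hxq
  have h3 := hmax p q h0 this.1 this.2 h1 (flatOn_steady hz)
  exact ⟨h3.1.symm, h3.2.symm⟩

lemma strictMonoOn_steady {β a b : ℝ} (h : ∀ x ∈ Ioo a b, 0 < steadySlope β x) :
    StrictMonoOn (steady β) (Icc a b) := by
  refine strictMonoOn_of_deriv_pos (convex_Icc a b) (continuous_steady β).continuousOn ?_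
  intro x hx
  rw [interior_Icc] at hx
  rw [(hasDerivAt_steady β x).deriv]
  exact h x hx

lemma strictAntiOn_steady {β a b : ℝ} (h : ∀ x ∈ Ioo a b, steadySlope β x < 0) :
    StrictAntiOn (steady β) (Icc a b) := by
  refine strictAntiOn_of_deriv_neg (convex_Icc a b) (continuous_steady β).continuousOn ?_
  intro x hx
  rw [interior_Icc] at hx
  rw [(hasDerivAt_steady β x).deriv]
  exact h x hx

/-- The sign of the slope near the right end point, for every force. -/
lemma steadySlope_pos_right {β x : ℝ} (h : 3 / 4 < x) : 0 < steadySlope β x := by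
  have h1 : steadyFlux β x = 4 * x - 2 := by
    rw [steadyFlux, bumpPrim_of_mem₃ h.le]; ring
  rw [steadySlope, h1, soft_of_one_le (by linarith)]
  linarith

lemma steadySlope_neg_left {β x : ℝ} (h : x < 1 / 4) : steadySlope β x < 0 := by
  have := steadySlope_pos_right (β := β) (x := 1 - x) (by linarith)
  rw [steadySlope_symm] at this
  linarith

/-- For forces up to the threshold `12` the flux stays in `[-1, 1]` on the whole of
`[1/4, 3/4]`. -/
lemma steadySlope_eq_zero {β x : ℝ} (h0 : 0 ≤ β) (h12 : β ≤ 12) (hx : x ∈ Icc (1 / 4 : ℝ) (3 / 4)) :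
    steadySlope β x = 0 := by
  have key : ∀ x ∈ Icc (1 / 2 : ℝ) (3 / 4), steadySlope β x = 0 := by
    intro x hx
    rcases le_total x (5 / 8) with h | h
    · have h1 : steadyFlux β x = (4 - β) * (x - 1 / 2) := by
        rw [steadyFlux, bumpPrim_of_mem₁ hx.1 h]; ring
      rw [steadySlope, h1, soft_of_abs_le] <;> nlinarith [hx.1]
    · have h1 : steadyFlux β x = 1 - (4 + β) * (3 / 4 - x) := by
        rw [steadyFlux, bumpPrim_of_mem₂ h hx.2]; ring
      rw [steadySlope, h1, soft_of_abs_le] <;> nlinarith [hx.2]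
  rcases le_total (1 / 2) x with h | h
  · exact key x ⟨h, hx.2⟩
  · have := key (1 - x) ⟨by linarith, by linarith [hx.1]⟩
    rw [steadySlope_symm] at this
    linarith

lemma steadySlope_eq_of_le {β x : ℝ} (h0 : 0 ≤ β) (h12 : β ≤ 12) :
    steadySlope β x = steadySlope 0 x := by
  have right : ∀ x, 3 / 4 < x → steadySlope β x = steadySlope 0 x := fun x hx => by
    rw [steadySlope, steadySlope, steadyFlux, steadyFlux, bumpPrim_of_mem₃ hx.le, mul_zero, mul_zero]
  rcases lt_or_ge (3 / 4) x with h | h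
  · exact right x h
  rcases lt_or_ge x (1 / 4) with h' | h'
  · have := right (1 - x) (by linarith)
    rw [steadySlope_symm, steadySlope_symm] at this
    linarith
  · rw [steadySlope_eq_zero h0 h12 ⟨h', h⟩, steadySlope_eq_zero le_rfl (by norm_num) ⟨h', h⟩]

theorem isFacet_steady_zero_iff (a b : ℝ) :
    IsFacet (steady 0) a b ↔ a = 1 / 4 ∧ b = 3 / 4 := by
  have hz : ∀ x ∈ Icc (1 / 4 : ℝ) (3 / 4), steadySlope 0 x = 0 := fun x hx =>
    steadySlope_eq_zero le_rfl (by norm_num) hx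
  have hl : ∀ x ∈ Ioo (0 : ℝ) (1 / 4), steadySlope 0 x ≠ 0 := fun x hx =>
    (steadySlope_neg_left hx.2).ne
  have hr : ∀ x ∈ Ioo (3 / 4 : ℝ) 1, steadySlope 0 x ≠ 0 := fun x hx =>
    (steadySlope_pos_right hx.1).ne'
  constructor
  · intro h
    obtain ⟨x, hx⟩ := exists_between h.2.1
    have hs := steadySlope_eq_zero_of_flatOn h.2.2.2.1 hx
    have h1 : 1 / 4 ≤ x := by
      by_contra! hc
      exact (steadySlope_neg_left hc).ne hs
    have h2 : x ≤ 3 / 4 := by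
      by_contra! hc
      exact (steadySlope_pos_right hc).ne' hs
    exact IsFacet.eq_of_mem (by norm_num) (by norm_num) (by norm_num) (by norm_num) hz hl hr h hx
      h1 h2
  · rintro ⟨rfl, rfl⟩
    exact isFacet_steady (by norm_num) (by norm_num) (by norm_num) (by norm_num) (by norm_num)
      hz hl hr

section breaking

variable {α : ℝ}

/-- Around the centre the flux has slope `4 - α`, so it stays in `[-1, 1]` up to the distance
`1 / (α - 4)`. -/
lemma steadySlope_center (hα : 12 < α) {x : ℝ} (h1 : 1 / 2 ≤ x) (h2 : x ≤ 1 / 2 + 1 / (α - 4)) :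
    steadySlope α x = 0 := by
  have hα' : 0 < α - 4 := by linarith
  have h4 : 1 / (α - 4) < 1 / 8 := one_div_lt_one_div_of_lt (by norm_num) (by linarith)
  have h3 : steadyFlux α x = -((α - 4) * (x - 1 / 2)) := by
    rw [steadyFlux, bumpPrim_of_mem₁ h1 (by linarith)]; ring
  have h5 : (α - 4) * (x - 1 / 2) ≤ 1 := by
    have : (α - 4) * (x - 1 / 2) ≤ (α - 4) * (1 / (α - 4)) :=
      mul_le_mul_of_nonneg_left (by linarith) hα'.le
    rwa [mul_one_div_cancel hα'.ne'] at this
  have h6 : 0 ≤ (α - 4) * (x - 1 / 2) := mul_nonneg hα'.le (by linarith)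
  rw [steadySlope, h3, soft_of_abs_le] <;> linarith

lemma steadySlope_decreasing (hα : 12 < α) {x : ℝ} (h1 : 1 / 2 + 1 / (α - 4) < x)
    (h2 : x < 3 / 4 - 2 / (α + 4)) : steadySlope α x < 0 := by
  have hα' : 0 < α - 4 := by linarith
  have hα'' : 0 < α + 4 := by linarith
  have h0 : 0 < 1 / (α - 4) := by positivity
  have h0' : 0 < 2 / (α + 4) := by positivity
  have key : steadyFlux α x < -1 := by
    rcases le_total x (5 / 8) with h | h
    · have h3 : steadyFlux α x = -((α - 4) * (x - 1 / 2)) := by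
        rw [steadyFlux, bumpPrim_of_mem₁ (by linarith) h]; ring
      have : (α - 4) * (1 / (α - 4)) < (α - 4) * (x - 1 / 2) :=
        mul_lt_mul_of_pos_left (by linarith) hα'
      rw [mul_one_div_cancel hα'.ne'] at this
      linarith
    · have h3 : steadyFlux α x = 1 - (α + 4) * (3 / 4 - x) := by
        rw [steadyFlux, bumpPrim_of_mem₂ h (by linarith)]; ring
      have : (α + 4) * (2 / (α + 4)) < (α + 4) * (3 / 4 - x) :=
        mul_lt_mul_of_pos_left (by linarith) hα''
      rw [mul_div_cancel₀ _ hα''.ne'] at this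
      linarith
  rw [steadySlope, soft_of_le_neg_one key.le]
  linarith

/-- On `[5/8, 3/4]` the flux has slope `4 + α` and ends at `1`, so it stays in `[-1, 1]` over a
length `2 / (α + 4)`. -/
lemma steadySlope_outer (hα : 12 < α) {x : ℝ} (h1 : 3 / 4 - 2 / (α + 4) ≤ x) (h2 : x ≤ 3 / 4) :
    steadySlope α x = 0 := by
  have hα'' : 0 < α + 4 := by linarith
  have h4 : 2 / (α + 4) < 1 / 8 := by
    rw [div_lt_div_iff₀ hα'' (by norm_num)]; linarith
  have h3 : steadyFlux α x = 1 - (α + 4) * (3 / 4 - x) := by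
    rw [steadyFlux, bumpPrim_of_mem₂ (by linarith) h2]; ring
  have h5 : (α + 4) * (3 / 4 - x) ≤ 2 := by
    have : (α + 4) * (3 / 4 - x) ≤ (α + 4) * (2 / (α + 4)) :=
      mul_le_mul_of_nonneg_left (by linarith) hα''.le
    rwa [mul_div_cancel₀ _ hα''.ne'] at this
  have h6 : 0 ≤ (α + 4) * (3 / 4 - x) := mul_nonneg hα''.le (by linarith)
  rw [steadySlope, h3, soft_of_abs_le] <;> linarith

/-- Beyond the threshold the steady state has exactly three facets: the components of the set where
the flux lies in `[-1, 1]`. The bounds `1 / (α - 4), 2 / (α + 4) < 1 / 8` for `α > 12` keep them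
apart. -/
theorem exists_facets_steady (hα : 12 < α) :
    ∃ c e f d : ℝ, 1 / 4 < c ∧ c < 3 / 8 ∧ 3 / 8 < e ∧ e < 1 / 2 ∧ 1 / 2 < f ∧ f < 5 / 8 ∧
      5 / 8 < d ∧ d < 3 / 4 ∧
      (∀ a b, IsFacet (steady α) a b ↔
        (a = 1 / 4 ∧ b = c) ∨ (a = e ∧ b = f) ∨ (a = d ∧ b = 3 / 4)) ∧
      StrictAntiOn (steady α) (Icc 0 (1 / 4)) ∧ StrictMonoOn (steady α) (Icc c e) ∧
      StrictAntiOn (steady α) (Icc f d) ∧ StrictMonoOn (steady α) (Icc (3 / 4) 1) := by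
  have hα' : 0 < α - 4 := by linarith
  have hα'' : 0 < α + 4 := by linarith
  have f0 : 0 < 1 / (α - 4) := by positivity
  have d0 : 0 < 2 / (α + 4) := by positivity
  have f1 : 1 / (α - 4) < 1 / 8 := one_div_lt_one_div_of_lt (by norm_num) (by linarith)
  have d1 : 2 / (α + 4) < 1 / 8 := by
    rw [div_lt_div_iff₀ hα'' (by norm_num)]; linarith
  have zc : ∀ x, 1 / 2 ≤ x → x ≤ 1 / 2 + 1 / (α - 4) → steadySlope α x = 0 :=
    fun x h1 h2 => steadySlope_center hα h1 h2
  have nd : ∀ x, 1 / 2 + 1 / (α - 4) < x → x < 3 / 4 - 2 / (α + 4) → steadySlope α x < 0 :=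
    fun x h1 h2 => steadySlope_decreasing hα h1 h2
  have zo : ∀ x, 3 / 4 - 2 / (α + 4) ≤ x → x ≤ 3 / 4 → steadySlope α x = 0 :=
    fun x h1 h2 => steadySlope_outer hα h1 h2
  have sym := fun x => steadySlope_symm α x
  generalize hF : 1 / (α - 4) = F at *
  generalize hD : 2 / (α + 4) = D at *
  have pc : ∀ x, 1 / 4 + D < x → x < 1 / 2 - F → 0 < steadySlope α x := fun x h1 h2 => by
    have := nd (1 - x) (by linarith) (by linarith)
    rw [sym] at this
    linarith
  have z1 : ∀ x ∈ Icc (1 / 4) (1 / 4 + D), steadySlope α x = 0 := fun x hx => by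
    have := zo (1 - x) (by linarith [hx.2]) (by linarith [hx.1])
    rw [sym] at this
    linarith
  have z2 : ∀ x ∈ Icc (1 / 2 - F) (1 / 2 + F), steadySlope α x = 0 := fun x hx => by
    rcases le_total (1 / 2) x with h | h
    · exact zc x h hx.2
    · have := zc (1 - x) (by linarith) (by linarith [hx.1])
      rw [sym] at this
      linarith
  have z3 : ∀ x ∈ Icc (3 / 4 - D) (3 / 4), steadySlope α x = 0 := fun x hx => zo x hx.1 hx.2
  have l1 : ∀ x ∈ Ioo (0 : ℝ) (1 / 4), steadySlope α x ≠ 0 := fun x hx =>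
    (steadySlope_neg_left hx.2).ne
  have l2 : ∀ x ∈ Ioo (1 / 4 + D) (1 / 2 - F), steadySlope α x ≠ 0 := fun x hx =>
    (pc x hx.1 hx.2).ne'
  have l3 : ∀ x ∈ Ioo (1 / 2 + F) (3 / 4 - D), steadySlope α x ≠ 0 := fun x hx =>
    (nd x hx.1 hx.2).ne
  have l4 : ∀ x ∈ Ioo (3 / 4 : ℝ) 1, steadySlope α x ≠ 0 := fun x hx =>
    (steadySlope_pos_right hx.1).ne'
  refine ⟨1 / 4 + D, 1 / 2 - F, 1 / 2 + F, 3 / 4 - D, by linarith, by linarith, by linarith,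
    by linarith, by linarith, by linarith, by linarith, by linarith, fun a b => ⟨fun h => ?_, ?_⟩,
    strictAntiOn_steady fun x hx => steadySlope_neg_left hx.2,
    strictMonoOn_steady fun x hx => pc x hx.1 hx.2,
    strictAntiOn_steady fun x hx => nd x hx.1 hx.2,
    strictMonoOn_steady fun x hx => steadySlope_pos_right hx.1⟩
  · obtain ⟨x, hx⟩ := exists_between h.2.1
    have hs := steadySlope_eq_zero_of_flatOn h.2.2.2.1 hx
    have h1 : 1 / 4 ≤ x := by
      by_contra! hc
      exact (steadySlope_neg_left hc).ne hs
    have h2 : x ≤ 3 / 4 := by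
      by_contra! hc
      exact (steadySlope_pos_right hc).ne' hs
    rcases le_or_gt x (1 / 4 + D) with h3 | h3
    · exact Or.inl (IsFacet.eq_of_mem (by norm_num) (by linarith) (by norm_num) (by linarith)
        z1 l1 l2 h hx h1 h3)
    rcases lt_or_ge x (1 / 2 - F) with h4 | h4
    · exact absurd hs (pc x h3 h4).ne'
    rcases le_or_gt x (1 / 2 + F) with h5 | h5
    · exact Or.inr (Or.inl (IsFacet.eq_of_mem (by linarith) (by linarith) (by linarith)
        (by linarith) z2 l2 l3 h hx h4 h5))
    rcases lt_or_ge x (3 / 4 - D) with h6 | h6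
    · exact absurd hs (nd x h5 h6).ne
    · exact Or.inr (Or.inr (IsFacet.eq_of_mem (by linarith) (by linarith) (by linarith)
        (by norm_num) z3 l3 l4 h hx h6 h2))
  · rintro (⟨rfl, rfl⟩ | ⟨rfl, rfl⟩ | ⟨rfl, rfl⟩)
    · exact isFacet_steady (by norm_num) (by linarith) (by linarith) (by norm_num) (by linarith)
        z1 l1 l2
    · exact isFacet_steady (by linarith) (by linarith) (by linarith) (by linarith) (by linarith)
        z2 l2 l3
    · exact isFacet_steady (by linarith) (by linarith) (by linarith) (by linarith) (by norm_num)
        z3 l3 l4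

end breaking

/-! ### Weak solutions and their integrated form -/

lemma restrict_cylinder (T : ℝ) : (volume : Measure (ℝ × ℝ)).restrict (cylinder T) =
    (volume.restrict (Ioc (0 : ℝ) 1)).prod (volume.restrict (Ioc 0 T)) := by
  rw [cylinder, Measure.volume_eq_prod, ← Measure.prod_restrict,
    Measure.restrict_congr_set Ioo_ae_eq_Ioc, Measure.restrict_congr_set Ioo_ae_eq_Ioc]

lemma isTest_slice {T : ℝ} {φ : ℝ × ℝ → ℝ} (h1 : ContDiff ℝ ∞ φ) (h2 : HasCompactSupport φ)
    (h3 : tsupport φ ⊆ Ioo 0 1 ×ˢ Iio T) (t : ℝ) : IsTest 0 1 fun x => φ (x, t) := by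
  have hK : IsCompact (Prod.fst '' tsupport φ) := IsCompact.image h2 continuous_fst
  have hsub : tsupport (fun x => φ (x, t)) ⊆ Prod.fst '' tsupport φ := by
    refine closure_minimal (fun x hx => ?_) hK.isClosed
    exact ⟨(x, t), subset_tsupport φ hx, rfl⟩
  refine ⟨h1.comp (contDiff_id.prodMk contDiff_const), hK.of_isClosed_subset
    (isClosed_tsupport _) hsub, hsub.trans ?_⟩
  rintro _ ⟨p, hp, rfl⟩
  exact (h3 hp).1

lemma hasDerivAt_fst {φ : ℝ × ℝ → ℝ} (h : ContDiff ℝ ∞ φ) (x t : ℝ) :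
    HasDerivAt (fun y => φ (y, t)) (fderiv ℝ φ (x, t) (1, 0)) x :=
  ((h.differentiable (by simp)) (x, t)).hasFDerivAt.comp_hasDerivAt x
    ((hasDerivAt_id x).prodMk (hasDerivAt_const x t))

lemma hasDerivAt_snd {φ : ℝ × ℝ → ℝ} (h : ContDiff ℝ ∞ φ) (x t : ℝ) :
    HasDerivAt (fun s => φ (x, s)) (fderiv ℝ φ (x, t) (0, 1)) t :=
  ((h.differentiable (by simp)) (x, t)).hasFDerivAt.comp_hasDerivAt t
    ((hasDerivAt_const t x).prodMk (hasDerivAt_id t))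

lemma measurable_steadyForce₂ : Measurable fun z : ℝ × ℝ => steadyForce z.1 z.2 :=
  measurable_const.add (measurable_fst.mul (measurable_bump.comp measurable_snd))

lemma integrable_cylinder_of_continuous {T : ℝ} {f : ℝ × ℝ → ℝ} (hf : Continuous f) :
    IntegrableOn f (cylinder T) :=
  (hf.continuousOn.integrableOn_compact (isCompact_Icc.prod isCompact_Icc)).mono_set
    (prod_mono Ioo_subset_Icc_self Ioo_subset_Icc_self)

/-- Below the threshold, the time-dependent flux `4 x - 2 + t bumpPrim x` keeps the slope of the
initial state. -/
theorem isWeakSolution_steady_zero {α : ℝ} (hα : 12 < α) :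
    IsWeakSolution 12 (fun x t => -breakingForce α x t) (steady 0) (fun x _ => steady 0 x) := by
  have hu : Continuous fun p : ℝ × ℝ => steady 0 p.1 := (continuous_steady 0).comp continuous_fst
  have hs : Continuous fun p : ℝ × ℝ => steadyFlux p.2 p.1 :=
    continuous_steadyFlux₂.comp (continuous_snd.prodMk continuous_fst)
  refine ⟨hu.aestronglyMeasurable, ?_, Eventually.of_forall fun _ => zeroDirichlet_steady 0,
    fun p => steadyFlux p.2 p.1, integrable_cylinder_of_continuous hs, ?_, ?_⟩
  · obtain ⟨K, hK⟩ := isCompact_Icc.exists_bound_of_continuousOn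
      (continuous_steady 0).continuousOn (s := Icc (0 : ℝ) 1)
    have hm : MemLp (fun x => steady 0 x) 2 (volume.restrict (Ioo (0 : ℝ) 1)) :=
      MemLp.of_bound (continuous_steady 0).aestronglyMeasurable K
        ((ae_restrict_mem measurableSet_Ioo).mono fun x hx => hK x (Ioo_subset_Icc_self hx))
    exact ⟨_, Eventually.of_forall fun _ => (ENNReal.coe_toNNReal hm.2.ne).ge⟩
  · filter_upwards [ae_restrict_mem (measurableSet_Ioo.prod measurableSet_Ioo)] with p hp
    rw [(hasDerivAt_steady 0 p.1).deriv, ← steadySlope_eq_of_le hp.2.1.le hp.2.2.le]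
    exact mem_soft _
  · intro φ h1 h2 h3
    have hcd : Continuous (fderiv ℝ φ) := h1.continuous_fderiv (by simp)
    have hφ : Continuous φ := h1.continuous
    simp only [fun p : ℝ × ℝ => (hasDerivAt_fst h1 p.1 p.2).deriv,
      fun p : ℝ × ℝ => (hasDerivAt_snd h1 p.1 p.2).deriv]
    have c1 : Continuous fun p : ℝ × ℝ => steady 0 p.1 * fderiv ℝ φ (p.1, p.2) (0, 1) :=
      hu.mul (hcd.clm_apply continuous_const)
    have c2 : Continuous fun p : ℝ × ℝ => steadyFlux p.2 p.1 * fderiv ℝ φ (p.1, p.2) (1, 0) :=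
      hs.mul (hcd.clm_apply continuous_const)
    have i1 := integrable_cylinder_of_continuous (T := 12) c1
    have i1' : IntegrableOn (fun p : ℝ × ℝ => -(steady 0 p.1 * fderiv ℝ φ (p.1, p.2) (0, 1)))
      (cylinder 12) := i1.neg
    have i2 := integrable_cylinder_of_continuous (T := 12) c2
    have i3 : IntegrableOn (fun p : ℝ × ℝ => -(steadyForce p.2 p.1 * φ (p.1, p.2)))
        (cylinder 12) := by
      have c3 : Continuous fun p : ℝ × ℝ => (4 + |p.2|) * ‖φ p‖ :=
        (continuous_const.add continuous_snd.abs).mul hφ.norm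
      refine (integrable_cylinder_of_continuous (T := 12) c3).mono'
        (((measurable_steadyForce₂.comp measurable_swap).mul hφ.measurable).neg).aestronglyMeasurable
        (Eventually.of_forall fun p => ?_)
      rw [norm_neg, norm_mul]
      refine mul_le_mul_of_nonneg_right ?_ (norm_nonneg _)
      rw [steadyForce_eq]
      refine (norm_add_le _ _).trans ?_
      rw [norm_mul, Real.norm_eq_abs, Real.norm_eq_abs, Real.norm_eq_abs]
      have := mul_le_mul_of_nonneg_left (abs_bump_le p.1) (abs_nonneg p.2)
      norm_num
      linarith
    rw [integral_add i1' i2, integral_neg]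
    have e1 : ∫ p in cylinder 12, steady 0 p.1 * fderiv ℝ φ (p.1, p.2) (0, 1) =
        -∫ x in Ioo (0 : ℝ) 1, steady 0 x * φ (x, 0) := by
      rw [IntegrableOn, restrict_cylinder] at i1
      rw [restrict_cylinder, integral_prod _ i1, integral_Ioo_zero_one,
        intervalIntegral.integral_of_le zero_le_one, ← integral_neg]
      congr 1
      ext x
      have h12 : φ (x, 12) = 0 := image_eq_zero_of_notMem_tsupport fun h =>
        lt_irrefl _ (mem_Iio.1 (h3 h).2)
      dsimp only
      rw [integral_const_mul, ← mul_neg, ← intervalIntegral.integral_of_le (by norm_num),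
        intervalIntegral.integral_eq_sub_of_hasDerivAt (f := fun t => φ (x, t))
          (fun t _ => hasDerivAt_snd h1 x t)
          (((hcd.clm_apply continuous_const).comp
            (continuous_const.prodMk continuous_id)).intervalIntegrable _ _)]
      rw [h12, zero_sub]
    have e2 : ∫ p in cylinder 12, steadyFlux p.2 p.1 * fderiv ℝ φ (p.1, p.2) (1, 0) =
        ∫ p in cylinder 12, -(steadyForce p.2 p.1 * φ (p.1, p.2)) := by
      rw [IntegrableOn, restrict_cylinder] at i2 i3
      rw [restrict_cylinder, integral_prod_symm _ i2, integral_prod_symm _ i3]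
      congr 1
      ext t
      have := integral_steadyFlux_mul_deriv t (isTest_slice h1 h2 h3 t)
      simp only [(hasDerivAt_fst h1 _ t).deriv] at this
      rw [← intervalIntegral.integral_of_le zero_le_one, this,
        ← intervalIntegral.integral_of_le zero_le_one, intervalIntegral.integral_neg]
    have e3 : ∫ p in cylinder 12, -breakingForce α p.1 p.2 * φ p =
        ∫ p in cylinder 12, -(steadyForce p.2 p.1 * φ (p.1, p.2)) := by
      refine setIntegral_congr_fun (measurableSet_Ioo.prod measurableSet_Ioo) fun p hp => ?_
      have : min p.2 α = p.2 := min_eq_left (hp.2.2.le.trans hα.le)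
      simp only [breakingForce, this, neg_mul]
    rw [e1, e2, e3, neg_neg, add_comm]

/-- The source term of the evolution, frozen at its initial value for negative times. -/
noncomputable def source (α x t : ℝ) : ℝ := -steadyForce (min (max t 0) α) x

/-- Extension of a function of space and time by `f₀` to nonpositive times. With the initial state
for `f₀`, the extended solution needs no initial condition. -/
noncomputable def extend (f₀ : ℝ → ℝ) (f : ℝ → ℝ → ℝ) (x t : ℝ) : ℝ := if t ≤ 0 then f₀ x else f x t

lemma extend_of_le {f₀ : ℝ → ℝ} {f : ℝ → ℝ → ℝ} {x t : ℝ} (h : t ≤ 0) : extend f₀ f x t = f₀ x :=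
  if_pos h

lemma extend_of_lt {f₀ : ℝ → ℝ} {f : ℝ → ℝ → ℝ} {x t : ℝ} (h : 0 < t) :
    extend f₀ f x t = f x t := if_neg h.not_ge

lemma measurable_source (α : ℝ) : Measurable (Function.uncurry (source α)) :=
  (measurable_steadyForce₂.comp
    (((measurable_snd.max measurable_const).min measurable_const).prodMk measurable_fst)).neg

lemma abs_source_le {α : ℝ} (hα : 0 ≤ α) (x t : ℝ) : |source α x t| ≤ 4 + α := by
  rw [source, abs_neg, steadyForce_eq]
  refine (abs_add_le _ _).trans ?_
  rw [abs_mul]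
  have h1 : |min (max t 0) α| ≤ α := by
    rw [abs_of_nonneg (le_min (le_max_right _ _) hα)]; exact min_le_right _ _
  have h2 := mul_le_mul h1 (abs_bump_le x) (abs_nonneg _) hα
  norm_num
  linarith

lemma source_sub_le (α x s t : ℝ) : |source α x s - source α x t| ≤ |s - t| := by
  have h : source α x s - source α x t = (min (max t 0) α - min (max s 0) α) * bump x := by
    rw [source, source, steadyForce_eq, steadyForce_eq]; ring
  have h1 : |min (max t 0) α - min (max s 0) α| ≤ |s - t| := by
    refine (abs_min_sub_min_le_max _ _ _ _).trans ?_
    rw [sub_self, abs_zero, max_eq_left (abs_nonneg _), abs_sub_comm s t]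
    refine (abs_max_sub_max_le_max _ _ _ _).trans ?_
    rw [sub_self, abs_zero, max_eq_left (abs_nonneg _)]
  rw [h, abs_mul]
  have := mul_le_mul h1 (abs_bump_le x) (abs_nonneg _) (abs_nonneg _)
  linarith

/-- The flux of a steady state balances the force. -/
lemma flux_steady {F σ : ℝ → ℝ → ℝ} {ψ : ℝ → ℝ} {β t : ℝ} (hψ : IsTest 0 1 ψ)
    (hσ : ∀ x, σ x t = steadyFlux β x) (hF : ∀ x, F x t = -steadyForce β x) :
    flux F σ ψ t = 0 := by
  have h1 : IntervalIntegrable (fun x => steadyFlux β x * deriv ψ x) volume 0 1 :=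
    ((continuous_steadyFlux β).mul hψ.continuous_deriv).intervalIntegrable _ _
  have h2 := intervalIntegrable_mul_test (intervalIntegrable_steadyForce β 0 1) hψ
  have h3 := integral_steadyFlux_mul_deriv β hψ
  have e : ∀ x, -σ x t * deriv ψ x + F x t * ψ x =
      -(steadyFlux β x * deriv ψ x + steadyForce β x * ψ x) := fun x => by
    rw [hσ, hF]; ring
  simp only [flux, e]
  rw [intervalIntegral.integral_neg, intervalIntegral.integral_add h1 h2, h3]
  ring

lemma integral_sq_le_of_eLpNorm_le {f : ℝ → ℝ} {M : ℝ≥0} (hf : ContinuousOn f (Icc 0 1))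
    (h : eLpNorm f 2 (volume.restrict (Ioo 0 1)) ≤ M) : ∫ x in (0 : ℝ)..1, f x ^ 2 ≤ M ^ 2 := by
  rw [← integral_Ioo_zero_one, integral_eq_lintegral_of_nonneg_ae
    (Eventually.of_forall fun x => sq_nonneg (f x))
    (((hf.mono Ioo_subset_Icc_self).aestronglyMeasurable measurableSet_Ioo).pow 2)]
  refine ENNReal.toReal_le_of_le_ofReal (sq_nonneg _) ?_
  have h1 := eLpNorm_nnreal_pow_eq_lintegral (f := f) (p := 2)
    (μ := volume.restrict (Ioo (0 : ℝ) 1)) two_ne_zero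
  have h2 : ∀ x, ENNReal.ofReal (f x ^ 2) = ‖f x‖ₑ ^ ((2 : ℝ≥0) : ℝ) := fun x => by
    rw [← ofReal_norm, Real.norm_eq_abs, ← sq_abs, NNReal.coe_ofNat, ENNReal.rpow_ofNat,
      ENNReal.ofReal_pow (abs_nonneg _)]
  simp only [h2]
  rw [← h1, ENNReal.ofReal_pow M.coe_nonneg, ENNReal.ofReal_coe_nnreal, NNReal.coe_ofNat,
    ENNReal.rpow_ofNat]
  gcongr
  exact h

lemma integrable_of_eLpNorm_le {T : ℝ} {u : ℝ → ℝ → ℝ}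
    (hm : AEStronglyMeasurable (fun p : ℝ × ℝ => u p.1 p.2) (volume.restrict (cylinder T)))
    (h : ∃ M : ℝ≥0, ∀ᵐ t ∂(volume.restrict (Ioo 0 T)),
      eLpNorm (fun x => u x t) 2 (volume.restrict (Ioo 0 1)) ≤ M) :
    Integrable (fun p : ℝ × ℝ => u p.1 p.2)
      ((volume.restrict (Ioc (0 : ℝ) 1)).prod (volume.restrict (Ioc 0 T))) := by
  obtain ⟨M, hM⟩ := h
  rw [restrict_cylinder] at hm
  simp only [Measure.restrict_congr_set Ioo_ae_eq_Ioc] at hM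
  refine ⟨hm, ?_⟩
  have hms : ∀ᵐ t ∂(volume.restrict (Ioc 0 T)), AEStronglyMeasurable (fun x => u x t)
      (volume.restrict (Ioc (0 : ℝ) 1)) := hm.prod_swap.prodMk_left
  rw [hasFiniteIntegral_iff_enorm, lintegral_prod_symm _ hm.enorm]
  have hle : ∀ᵐ t ∂(volume.restrict (Ioc 0 T)),
      ∫⁻ x in Ioc (0 : ℝ) 1, ‖u x t‖ₑ ≤ M := by
    filter_upwards [hM, hms] with t ht hmt
    let : IsProbabilityMeasure (volume.restrict (Ioc (0 : ℝ) 1)) := ⟨by simp⟩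
    have h12 := eLpNorm_le_eLpNorm_of_exponent_le (p := 1) (q := 2) (by norm_num) hmt
    rw [eLpNorm_one_eq_lintegral_enorm] at h12
    exact h12.trans ht
  refine (lintegral_mono_ae hle).trans_lt ?_
  rw [lintegral_const]
  exact ENNReal.mul_lt_top ENNReal.coe_lt_top (by simp)

lemma isTest_mul {T : ℝ} {ψ η : ℝ → ℝ} (hψ : IsTest 0 1 ψ) (hη : IsTest (-1) T η) :
    ContDiff ℝ ∞ (fun p : ℝ × ℝ => ψ p.1 * η p.2) ∧
      HasCompactSupport (fun p : ℝ × ℝ => ψ p.1 * η p.2) ∧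
      tsupport (fun p : ℝ × ℝ => ψ p.1 * η p.2) ⊆ Ioo 0 1 ×ˢ Iio T := by
  have hsub : tsupport (fun p : ℝ × ℝ => ψ p.1 * η p.2) ⊆ tsupport ψ ×ˢ tsupport η := by
    refine closure_minimal (fun p hp => ?_) ((isClosed_tsupport _).prod (isClosed_tsupport _))
    have := mul_ne_zero_iff.1 hp
    exact ⟨subset_tsupport _ this.1, subset_tsupport _ this.2⟩
  refine ⟨(hψ.1.comp contDiff_fst).mul (hη.1.comp contDiff_snd),
    (IsCompact.prod hψ.2 hη.2).of_isClosed_subset (isClosed_tsupport _) hsub, hsub.trans ?_⟩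
  exact prod_mono hψ.3 fun t ht => (hη.3 ht).2

section sol

variable {α T : ℝ} {u : ℝ → ℝ → ℝ} {σ : ℝ × ℝ → ℝ}

/-- The weak formulation tested with a product of a function of space and a function of time. -/
lemma integral_mul_deriv_of_weak (hα : 0 ≤ α) (hT : 0 < T)
    (hu : Integrable (fun p : ℝ × ℝ => u p.1 p.2)
      ((volume.restrict (Ioc (0 : ℝ) 1)).prod (volume.restrict (Ioc 0 T))))
    (hσ : Integrable σ ((volume.restrict (Ioc (0 : ℝ) 1)).prod (volume.restrict (Ioc 0 T))))
    (h : ∀ φ : ℝ × ℝ → ℝ, ContDiff ℝ ∞ φ → HasCompactSupport φ → tsupport φ ⊆ Ioo 0 1 ×ˢ Iio T →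
      ∫ p in cylinder T, (-(u p.1 p.2 * deriv (fun s => φ (p.1, s)) p.2)
          + σ p * deriv (fun y => φ (y, p.2)) p.1)
        = (∫ p in cylinder T, -breakingForce α p.1 p.2 * φ p) +
          ∫ x in Ioo (0 : ℝ) 1, steady 0 x * φ (x, 0))
    {ψ η : ℝ → ℝ} (hψ : IsTest 0 1 ψ) (hη : IsTest (-1) T η) :
    ∫ t in (0 : ℝ)..T, (∫ x in (0 : ℝ)..1, u x t * ψ x) * deriv η t =
      -(∫ t in (0 : ℝ)..T, flux (source α) (fun x t => σ (x, t)) ψ t * η t) -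
        (∫ x in (0 : ℝ)..1, steady 0 x * ψ x) * η 0 := by
  obtain ⟨h1, h2, h3⟩ := isTest_mul hψ hη
  have key := h _ h1 h2 h3
  obtain ⟨C, -, hC⟩ := hψ.exists_bound
  obtain ⟨C', -, hC'⟩ := hψ.deriv.exists_bound
  obtain ⟨D, -, hD⟩ := hη.exists_bound
  obtain ⟨D', -, hD'⟩ := hη.deriv.exists_bound
  have mψ := (hψ.continuous.comp continuous_fst : Continuous fun p : ℝ × ℝ => ψ p.1)
  have mψ' := (hψ.continuous_deriv.comp continuous_fst : Continuous fun p : ℝ × ℝ => deriv ψ p.1)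
  have mη := (hη.continuous.comp continuous_snd : Continuous fun p : ℝ × ℝ => η p.2)
  have mη' := (hη.continuous_deriv.comp continuous_snd : Continuous fun p : ℝ × ℝ => deriv η p.2)
  have e1 : ∀ p : ℝ × ℝ, deriv (fun s => ψ p.1 * η s) p.2 = ψ p.1 * deriv η p.2 := fun p =>
    deriv_const_mul_field _
  have e2 : ∀ p : ℝ × ℝ, deriv (fun y => ψ y * η p.2) p.1 = deriv ψ p.1 * η p.2 := fun p =>
    deriv_mul_const_field _
  have e3 : ∫ p in cylinder T, -breakingForce α p.1 p.2 * (ψ p.1 * η p.2) =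
      ∫ p in cylinder T, source α p.1 p.2 * ψ p.1 * η p.2 := by
    refine setIntegral_congr_fun (measurableSet_Ioo.prod measurableSet_Ioo) fun p hp => ?_
    have : max p.2 0 = p.2 := max_eq_left hp.2.1.le
    simp only [breakingForce, source, this, mul_assoc]
  have i1 : Integrable (fun p : ℝ × ℝ => u p.1 p.2 * ψ p.1 * deriv η p.2)
      ((volume.restrict (Ioc (0 : ℝ) 1)).prod (volume.restrict (Ioc 0 T))) :=
    (hu.mul_bdd (c := C) mψ.aestronglyMeasurable (Eventually.of_forall fun p => hC p.1)).mul_bdd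
      (c := D') mη'.aestronglyMeasurable (Eventually.of_forall fun p => hD' p.2)
  have i2 : Integrable (fun p : ℝ × ℝ => σ p * deriv ψ p.1 * η p.2)
      ((volume.restrict (Ioc (0 : ℝ) 1)).prod (volume.restrict (Ioc 0 T))) :=
    (hσ.mul_bdd (c := C') mψ'.aestronglyMeasurable
      (Eventually.of_forall fun p => hC' p.1)).mul_bdd
      (c := D) mη.aestronglyMeasurable (Eventually.of_forall fun p => hD p.2)
  have hs : Integrable (fun p : ℝ × ℝ => source α p.1 p.2)
      ((volume.restrict (Ioc (0 : ℝ) 1)).prod (volume.restrict (Ioc 0 T))) :=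
    (integrable_const (4 + α)).mono' (measurable_source α).aestronglyMeasurable
      (Eventually.of_forall fun p => abs_source_le hα p.1 p.2)
  have i3 : Integrable (fun p : ℝ × ℝ => source α p.1 p.2 * ψ p.1 * η p.2)
      ((volume.restrict (Ioc (0 : ℝ) 1)).prod (volume.restrict (Ioc 0 T))) :=
    (hs.mul_bdd (c := C) mψ.aestronglyMeasurable (Eventually.of_forall fun p => hC p.1)).mul_bdd
      (c := D) mη.aestronglyMeasurable (Eventually.of_forall fun p => hD p.2)
  have i1' : Integrable (fun p : ℝ × ℝ => -(u p.1 p.2 * ψ p.1 * deriv η p.2))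
      ((volume.restrict (Ioc (0 : ℝ) 1)).prod (volume.restrict (Ioc 0 T))) := i1.neg
  have i4 : Integrable (fun p : ℝ × ℝ => -σ p * deriv ψ p.1 * η p.2 +
      source α p.1 p.2 * ψ p.1 * η p.2)
      ((volume.restrict (Ioc (0 : ℝ) 1)).prod (volume.restrict (Ioc 0 T))) := by
    have i2' : Integrable (fun p : ℝ × ℝ => -σ p * deriv ψ p.1 * η p.2)
        ((volume.restrict (Ioc (0 : ℝ) 1)).prod (volume.restrict (Ioc 0 T))) := by
      refine i2.neg.congr (Eventually.of_forall fun p => ?_)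
      simp only [Pi.neg_apply]
      ring
    exact i2'.add i3
  have k1 : ∫ p in cylinder T, u p.1 p.2 * ψ p.1 * deriv η p.2 =
      ∫ t in (0 : ℝ)..T, (∫ x in (0 : ℝ)..1, u x t * ψ x) * deriv η t := by
    rw [restrict_cylinder, integral_prod_symm _ i1, intervalIntegral.integral_of_le hT.le]
    simp only [integral_mul_const, intervalIntegral.integral_of_le zero_le_one]
  have k2 : ∫ p in cylinder T, (-σ p * deriv ψ p.1 * η p.2 + source α p.1 p.2 * ψ p.1 * η p.2) =
      ∫ t in (0 : ℝ)..T, flux (source α) (fun x t => σ (x, t)) ψ t * η t := by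
    rw [restrict_cylinder, integral_prod_symm _ i4, intervalIntegral.integral_of_le hT.le]
    simp only [← add_mul, integral_mul_const, flux, intervalIntegral.integral_of_le zero_le_one]
  have k3 : ∫ p in cylinder T, (-σ p * deriv ψ p.1 * η p.2 + source α p.1 p.2 * ψ p.1 * η p.2) =
      -(∫ p in cylinder T, σ p * deriv ψ p.1 * η p.2) +
        ∫ p in cylinder T, source α p.1 p.2 * ψ p.1 * η p.2 := by
    have i2' : Integrable (fun p : ℝ × ℝ => -(σ p * deriv ψ p.1 * η p.2))
        ((volume.restrict (Ioc (0 : ℝ) 1)).prod (volume.restrict (Ioc 0 T))) := i2.neg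
    rw [restrict_cylinder, ← integral_neg, ← integral_add i2' i3]
    congr 1
    ext p
    ring
  simp only [e1, e2, e3] at key
  simp only [← mul_assoc] at key
  rw [integral_Ioo_zero_one, intervalIntegral.integral_mul_const] at key
  have k4 : ∫ p in cylinder T, (-(u p.1 p.2 * ψ p.1 * deriv η p.2) + σ p * deriv ψ p.1 * η p.2) =
      -(∫ p in cylinder T, u p.1 p.2 * ψ p.1 * deriv η p.2) +
        ∫ p in cylinder T, σ p * deriv ψ p.1 * η p.2 := by
    rw [restrict_cylinder, ← integral_neg, ← integral_add i1' i2]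
  rw [k4, k1] at key
  rw [← k2, k3]
  linarith

/-- A weak solution, extended by the initial state to negative times, is a solution in integrated
form. -/
theorem IsWeakSolution.exists_sol (hα : 0 ≤ α) (hT : 0 < T)
    (H : IsWeakSolution T (fun x t => -breakingForce α x t) (steady 0) u) :
    ∃ σ, Sol (-1) T (source α) (extend (steady 0) u) σ := by
  obtain ⟨hum, hbd, hzd, σ₀, hσi, hσL, hw⟩ := H
  have hu := integrable_of_eLpNorm_le hum hbd
  have hσ₀ := hσi
  rw [IntegrableOn, restrict_cylinder] at hσ₀
  rw [restrict_cylinder] at hσL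
  obtain ⟨σ, hσm, hσe⟩ := hσ₀.aestronglyMeasurable.aemeasurable
  have hσ : Integrable σ ((volume.restrict (Ioc (0 : ℝ) 1)).prod (volume.restrict (Ioc 0 T))) :=
    hσ₀.congr hσe
  have hw' : ∀ φ : ℝ × ℝ → ℝ, ContDiff ℝ ∞ φ → HasCompactSupport φ →
      tsupport φ ⊆ Ioo 0 1 ×ˢ Iio T →
      ∫ p in cylinder T, (-(u p.1 p.2 * deriv (fun s => φ (p.1, s)) p.2)
          + σ p * deriv (fun y => φ (y, p.2)) p.1)
        = (∫ p in cylinder T, -breakingForce α p.1 p.2 * φ p) +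
          ∫ x in Ioo (0 : ℝ) 1, steady 0 x * φ (x, 0) := fun φ h1 h2 h3 => by
    rw [← hw φ h1 h2 h3]
    refine integral_congr_ae ?_
    rw [restrict_cylinder]
    filter_upwards [hσe] with p hp
    rw [hp]
  -- at almost every time, `u` is the primitive of `soft σ`
  have hprim : ∀ᵐ t, t ∈ Ioo 0 T → ContinuousOn (fun x => u x t) (Icc 0 1) ∧ u 1 t = 0 ∧
      ∀ x ∈ Icc (0 : ℝ) 1, u x t = ∫ y in (0 : ℝ)..x, soft (σ (y, t)) := by
    have h1 : ∀ᵐ p ∂((volume.restrict (Ioc (0 : ℝ) 1)).prod (volume.restrict (Ioc 0 T))),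
        deriv (fun y => u y p.2) p.1 = soft (σ p) := by
      filter_upwards [hσL, hσe] with p hp hp'
      rw [← hp']
      exact eq_soft_of_mem hp
    have h2 := Measure.ae_ae_of_ae_prod
      (Measure.measurePreserving_swap.quasiMeasurePreserving.ae h1)
    rw [ae_restrict_iff' measurableSet_Ioc] at h2
    rw [ae_restrict_iff' measurableSet_Ioo] at hzd
    filter_upwards [h2, hzd] with t ht hz ht'
    obtain ⟨hac, h0, h1'⟩ := hz ht'
    have ht2 := ht (Ioo_subset_Ioc_self ht')
    rw [ae_restrict_iff' measurableSet_Ioc] at ht2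
    refine ⟨?_, h1', fun x hx => ?_⟩
    · have := hac.continuousOn
      rwa [uIcc_of_le zero_le_one] at this
    have hsub : uIcc (0 : ℝ) x ⊆ uIcc 0 1 := by
      rw [uIcc_of_le hx.1, uIcc_of_le zero_le_one]; exact Icc_subset_Icc_right hx.2
    have h3 := (hac.mono hsub).integral_deriv_eq_sub
    simp only [h0, sub_zero] at h3
    rw [← h3]
    refine intervalIntegral.integral_congr_ae ?_
    filter_upwards [ht2] with y hy hy'
    rw [uIoc_of_le hx.1] at hy'
    exact hy ⟨hy'.1, hy'.2.trans hx.2⟩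
  have hne : ∀ᵐ t : ℝ, t ≠ 0 := by simp [ae_iff, measure_singleton]
  have hm : Measurable (Function.uncurry (extend (steadyFlux 0) fun x t => σ (x, t))) :=
    Measurable.ite (measurableSet_le measurable_snd measurable_const)
      ((continuous_steadyFlux 0).measurable.comp measurable_fst) hσm
  have hfl : ∀ ψ, ∀ t, 0 < t → flux (source α) (extend (steadyFlux 0) fun x t => σ (x, t)) ψ t =
      flux (source α) (fun x t => σ (x, t)) ψ t := fun ψ t ht => by
    simp only [flux, extend_of_lt ht]
  have hfl0 : ∀ ψ, IsTest 0 1 ψ → ∀ t, t ≤ 0 →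
      flux (source α) (extend (steadyFlux 0) fun x t => σ (x, t)) ψ t = 0 := fun ψ hψ t ht =>
    flux_steady hψ (fun x => extend_of_le ht) fun x => by
      rw [source, max_eq_right ht, min_eq_left hα]
  have hint : Integrable (Function.uncurry (extend (steadyFlux 0) fun x t => σ (x, t)))
      ((volume.restrict (Ioc (0 : ℝ) 1)).prod (volume.restrict (Ioc (-1) T))) := by
    have hU : Ioc (0 : ℝ) 1 ×ˢ Ioc (-1) T =
        Ioc (0 : ℝ) 1 ×ˢ Ioc (-1) 0 ∪ Ioc (0 : ℝ) 1 ×ˢ Ioc 0 T := by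
      rw [← prod_union, Ioc_union_Ioc_eq_Ioc (by norm_num) hT.le]
    rw [Measure.prod_restrict, hU, ← IntegrableOn]
    refine IntegrableOn.union ?_ ?_
    · have hc : Continuous fun p : ℝ × ℝ => steadyFlux 0 p.1 :=
        (continuous_steadyFlux 0).comp continuous_fst
      refine IntegrableOn.congr_fun (f := fun p : ℝ × ℝ => steadyFlux 0 p.1)
        ((hc.continuousOn.integrableOn_compact (isCompact_Icc.prod isCompact_Icc)).mono_set
          (prod_mono Ioc_subset_Icc_self Ioc_subset_Icc_self))
        (fun p hp => (extend_of_le hp.2.2).symm) (measurableSet_Ioc.prod measurableSet_Ioc)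
    · rw [Measure.prod_restrict] at hσ
      exact IntegrableOn.congr_fun (f := σ) hσ
        (fun p hp => (extend_of_lt (f := fun x t => σ (x, t)) hp.2.1).symm)
        (measurableSet_Ioc.prod measurableSet_Ioc)
  refine ⟨extend (steadyFlux 0) fun x t => σ (x, t), hm, hint, ?_, ?_, ?_, ?_, measurable_source α,
    4 + α, abs_source_le hα⟩
  · filter_upwards [hprim, hne] with t h hne ht x hx
    rcases lt_or_gt_of_ne hne with h0 | h0
    · simp only [extend_of_le h0.le]; rfl
    · simp only [extend_of_lt h0]
      exact (h ⟨h0, ht.2⟩).2.2 x hx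
  · filter_upwards [hprim, hne] with t h hne ht
    rcases lt_or_gt_of_ne hne with h0 | h0
    · rw [extend_of_le h0.le, steady_one]
    · rw [extend_of_lt h0, (h ⟨h0, ht.2⟩).2.1]
  · obtain ⟨M, hM⟩ := hbd
    rw [ae_restrict_iff' measurableSet_Ioo] at hM
    refine ⟨max (M ^ 2) (∫ x in (0 : ℝ)..1, steady 0 x ^ 2), ?_⟩
    filter_upwards [hM, hprim, hne] with t h h' hne ht
    rcases lt_or_gt_of_ne hne with h0 | h0
    · simp only [extend_of_le h0.le]; exact le_max_right _ _
    · simp only [extend_of_lt h0]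
      exact (integral_sq_le_of_eLpNorm_le (h' ⟨h0, ht.2⟩).1 (h ⟨h0, ht.2⟩)).trans (le_max_left _ _)
  · have key : ∀ ψ, ∃ k, IsTest 0 1 ψ → ∀ᵐ t, t ∈ Ioo (-1) T →
        ∫ x in (0 : ℝ)..1, extend (steady 0) u x t * ψ x = k + ∫ τ in (-1)..t,
          flux (source α) (extend (steadyFlux 0) fun x t => σ (x, t)) ψ τ := by
      intro ψ
      by_cases hψ : IsTest 0 1 ψ
      swap
      · exact ⟨0, fun h => absurd h hψ⟩
      have hflint : IntervalIntegrable
          (flux (source α) (extend (steadyFlux 0) fun x t => σ (x, t)) ψ) volume (-1) T :=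
        (intervalIntegrable_iff_integrableOn_Ioc_of_le (by linarith)).2
          (integrableOn_flux_of_integrable hint (measurable_source α) ⟨_, abs_source_le hα⟩ hψ)
      have hU0e : ∀ t ≤ 0, ∫ x in (0 : ℝ)..1, extend (steady 0) u x t * ψ x =
          ∫ x in (0 : ℝ)..1, steady 0 x * ψ x := fun t ht => by simp only [extend_of_le ht]
      have hUTe : ∀ t > 0, ∫ x in (0 : ℝ)..1, extend (steady 0) u x t * ψ x =
          ∫ x in (0 : ℝ)..1, u x t * ψ x := fun t ht => by simp only [extend_of_lt ht]
      have hU0 : IntervalIntegrable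
          (fun t => ∫ x in (0 : ℝ)..1, extend (steady 0) u x t * ψ x) volume (-1) 0 := by
        refine IntervalIntegrable.congr (f := fun _ => ∫ x in (0 : ℝ)..1, steady 0 x * ψ x) ?_
          intervalIntegrable_const
        intro t ht
        rw [uIoc_of_le (by norm_num)] at ht
        exact (hU0e t ht.2).symm
      have hUT : IntervalIntegrable
          (fun t => ∫ x in (0 : ℝ)..1, extend (steady 0) u x t * ψ x) volume 0 T := by
        refine IntervalIntegrable.congr (f := fun t => ∫ x in (0 : ℝ)..1, u x t * ψ x) ?_ ?_
        · intro t ht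
          rw [uIoc_of_le hT.le] at ht
          exact (hUTe t ht.1).symm
        · rw [intervalIntegrable_iff_integrableOn_Ioc_of_le hT.le]
          obtain ⟨C, -, hC⟩ := hψ.exists_bound
          have := (hu.mul_bdd (c := C)
            (hψ.continuous.comp continuous_fst).aestronglyMeasurable
            (Eventually.of_forall fun p => hC p.1)).integral_prod_right
          simp only [intervalIntegral.integral_of_le zero_le_one]
          exact this
      suffices hweak : ∀ η, IsTest (-1) T η →
          ∫ t in (-1)..T, (∫ x in (0 : ℝ)..1, extend (steady 0) u x t * ψ x) * deriv η t =
          -∫ t in (-1)..T,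
            flux (source α) (extend (steadyFlux 0) fun x t => σ (x, t)) ψ t * η t by
        obtain ⟨k, hk⟩ := ae_eq_primitive_of_weak_deriv (by linarith : (-1 : ℝ) < T)
          (hU0.trans hUT) hflint hweak
        exact ⟨k, fun _ => hk⟩
      intro η hη
      have hfl1 := hflint.mono_set (c := -1) (d := 0) (by
        rw [uIcc_of_le (by norm_num), uIcc_of_le (by linarith)]; exact Icc_subset_Icc_right hT.le)
      have hfl2 := hflint.mono_set (c := 0) (d := T) (by
        rw [uIcc_of_le hT.le, uIcc_of_le (by linarith)]; exact Icc_subset_Icc_left (by norm_num))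
      rw [← intervalIntegral.integral_add_adjacent_intervals
          (intervalIntegrable_mul_test hU0 hη.deriv) (intervalIntegrable_mul_test hUT hη.deriv),
        ← intervalIntegral.integral_add_adjacent_intervals
          (intervalIntegrable_mul_test hfl1 hη) (intervalIntegrable_mul_test hfl2 hη)]
      have k1 : ∫ t in (-1 : ℝ)..0, (∫ x in (0 : ℝ)..1, extend (steady 0) u x t * ψ x) * deriv η t =
          (∫ x in (0 : ℝ)..1, steady 0 x * ψ x) * η 0 := by
        have h1 : ∫ t in (-1 : ℝ)..0, deriv η t = η 0 - η (-1) :=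
          intervalIntegral.integral_deriv_eq_sub (fun t _ => hη.differentiable t)
            (hη.continuous_deriv.intervalIntegrable _ _)
        rw [hη.eq_zero (x := -1) (by simp), sub_zero] at h1
        rw [← h1, ← intervalIntegral.integral_const_mul]
        refine intervalIntegral.integral_congr fun t ht => ?_
        rw [uIcc_of_le (by norm_num)] at ht
        simp only [hU0e t ht.2]
      have k2 : ∫ t in (0 : ℝ)..T, (∫ x in (0 : ℝ)..1, extend (steady 0) u x t * ψ x) * deriv η t =
          ∫ t in (0 : ℝ)..T, (∫ x in (0 : ℝ)..1, u x t * ψ x) * deriv η t := by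
        refine intervalIntegral.integral_congr_ae (Eventually.of_forall fun t ht => ?_)
        rw [uIoc_of_le hT.le] at ht
        simp only [hUTe t ht.1]
      have k3 : ∫ t in (-1 : ℝ)..0,
          flux (source α) (extend (steadyFlux 0) fun x t => σ (x, t)) ψ t * η t = 0 := by
        refine intervalIntegral.integral_zero_ae (Eventually.of_forall fun t ht => ?_)
        rw [uIoc_of_le (by norm_num)] at ht
        rw [hfl0 ψ hψ t ht.2, zero_mul]
      have k4 : ∫ t in (0 : ℝ)..T,
          flux (source α) (extend (steadyFlux 0) fun x t => σ (x, t)) ψ t * η t =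
          ∫ t in (0 : ℝ)..T, flux (source α) (fun x t => σ (x, t)) ψ t * η t := by
        refine intervalIntegral.integral_congr_ae (Eventually.of_forall fun t ht => ?_)
        rw [uIoc_of_le hT.le] at ht
        simp only [hfl ψ t ht.1]
      rw [k1, k2, k3, k4, integral_mul_deriv_of_weak hα hT hu hσ hw' hψ hη]
      ring
    choose k hk using key
    exact ⟨k, hk⟩

end sol

/-! ### Functions with a square integrable derivative -/

lemma exists_mem_Ioo_of_ae {A : Set ℝ} (hA : ∀ᵐ t, t ∈ A) {a b : ℝ} (h : a < b) :
    ∃ s ∈ A, s ∈ Ioo a b :=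
  (Measure.dense_of_ae hA).exists_between h

/-- Hölder continuity of exponent `1 / 2` of a primitive, in squared form. -/
lemma sq_integral_le {q : ℝ → ℝ} (hq : IntervalIntegrable q volume 0 1)
    (hq2 : IntervalIntegrable (fun x => q x ^ 2) volume 0 1) {x y : ℝ} (hx : 0 ≤ x) (hxy : x ≤ y)
    (hy : y ≤ 1) : (∫ z in x..y, q z) ^ 2 ≤ (y - x) * ∫ z in (0 : ℝ)..1, q z ^ 2 := by
  rcases hxy.eq_or_lt with rfl | hlt
  · simp
  have hsub : uIcc x y ⊆ uIcc 0 1 := by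
    rw [uIcc_of_le hxy, uIcc_of_le zero_le_one]; exact Icc_subset_Icc hx hy
  have hh : 0 < y - x := by linarith
  have h1 := stek_sq_le (z := q) (s := x) hh
    (by rw [add_sub_cancel]; exact hq.mono_set hsub)
    (by rw [add_sub_cancel]; exact hq2.mono_set hsub)
  simp only [stek, add_sub_cancel, mul_pow] at h1
  have h2 : ∫ z in x..y, q z ^ 2 ≤ ∫ z in (0 : ℝ)..1, q z ^ 2 :=
    intervalIntegral.integral_mono_interval hx hxy hy
      (Eventually.of_forall fun z => sq_nonneg (q z)) hq2
  have h3 := mul_le_mul_of_nonneg_left h1 (sq_nonneg (y - x))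
  have e1 : (y - x) ^ 2 * ((y - x)⁻¹ ^ 2 * (∫ z in x..y, q z) ^ 2) = (∫ z in x..y, q z) ^ 2 := by
    field_simp
  have e2 : (y - x) ^ 2 * ((y - x)⁻¹ * ∫ z in x..y, q z ^ 2) =
      (y - x) * ∫ z in x..y, q z ^ 2 := by
    field_simp
  rw [e1, e2] at h3
  exact h3.trans (mul_le_mul_of_nonneg_left h2 hh.le)

/-- Interpolation of the supremum norm of a primitive between the `L²` norms of the primitive and
of its derivative. -/
lemma sq_primitive_le {q v : ℝ → ℝ} (hq : IntervalIntegrable q volume 0 1)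
    (hq2 : IntervalIntegrable (fun x => q x ^ 2) volume 0 1)
    (hv : ∀ x ∈ Icc (0 : ℝ) 1, v x = ∫ y in (0 : ℝ)..x, q y) {l : ℝ} (hl : 0 < l) {x : ℝ}
    (hx : x ∈ Icc (0 : ℝ) 1) :
    v x ^ 2 ≤ l * (∫ y in (0 : ℝ)..1, v y ^ 2) + l⁻¹ * ∫ y in (0 : ℝ)..1, q y ^ 2 := by
  have hsub : uIcc 0 x ⊆ uIcc (0 : ℝ) 1 := by
    rw [uIcc_of_le hx.1, uIcc_of_le zero_le_one]; exact Icc_subset_Icc_right hx.2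
  have hvc : ContinuousOn v (uIcc 0 1) := by
    have := intervalIntegral.continuousOn_primitive_interval' hq (a := 0) (by simp)
    rw [uIcc_of_le zero_le_one] at this ⊢
    exact this.congr hv
  have h1 := integral_primitive_mul_self (hq.mono_set hsub) 0
  simp only [zero_add, ← hv x hx] at h1
  have iv2 : IntervalIntegrable (fun y => v y ^ 2) volume 0 1 := (hvc.pow 2).intervalIntegrable
  have h2 : ∫ y in (0 : ℝ)..x, (∫ z in (0 : ℝ)..y, q z) * q y = ∫ y in (0 : ℝ)..x, v y * q y := by
    refine intervalIntegral.integral_congr fun y hy => ?_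
    have hy' := hsub hy
    rw [uIcc_of_le zero_le_one] at hy'
    simp only [hv y hy']
  have ivq : IntervalIntegrable (fun y => v y * q y) volume 0 1 := hq.continuousOn_mul hvc
  have h3 : ∫ y in (0 : ℝ)..x, 2 * (v y * q y) ≤
      ∫ y in (0 : ℝ)..x, (l * v y ^ 2 + l⁻¹ * q y ^ 2) := by
    refine intervalIntegral.integral_mono_on hx.1 ((ivq.mono_set hsub).const_mul 2)
      (((iv2.const_mul l).add (hq2.const_mul l⁻¹)).mono_set hsub) fun y _ => ?_
    have : 0 ≤ l⁻¹ * (l * v y - q y) ^ 2 := by positivity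
    have e : l⁻¹ * (l * v y - q y) ^ 2 = l * v y ^ 2 - 2 * (v y * q y) + l⁻¹ * q y ^ 2 := by
      field_simp
      ring
    linarith
  have h4 : ∫ y in (0 : ℝ)..x, (l * v y ^ 2 + l⁻¹ * q y ^ 2) ≤
      ∫ y in (0 : ℝ)..1, (l * v y ^ 2 + l⁻¹ * q y ^ 2) :=
    intervalIntegral.integral_mono_interval le_rfl hx.1 hx.2
      (Eventually.of_forall fun z => by simp only [Pi.zero_apply]; positivity)
      ((iv2.const_mul l).add (hq2.const_mul l⁻¹))
  rw [intervalIntegral.integral_add (iv2.const_mul l) (hq2.const_mul l⁻¹),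
    intervalIntegral.integral_const_mul, intervalIntegral.integral_const_mul] at h4
  rw [intervalIntegral.integral_const_mul] at h3
  rw [h2] at h1
  linarith

/-! ### Estimates for solutions -/

lemma integral_sq_nonneg (f : ℝ → ℝ) : 0 ≤ ∫ x in (0 : ℝ)..1, f x ^ 2 :=
  intervalIntegral.integral_nonneg zero_le_one fun _ _ => sq_nonneg _

namespace Sol

variable {a b T B E c e : ℝ} {F F₁ F₂ u u₁ u₂ σ σ₁ σ₂ : ℝ → ℝ → ℝ}

/-- Two solutions that agree up to `E` initially and whose sources differ by at most `B`, and only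
before the time `c`, remain close for ever. -/
lemma sub_sq_le (H₁ : Sol (-1) T F₁ u₁ σ₁) (H₂ : Sol (-1) T F₂ u₂ σ₂) (hB : 0 ≤ B) (hc : 0 ≤ c)
    (hF : ∀ x ∈ Ioc (0 : ℝ) 1, ∀ t ∈ Ioo (-1) T, |F₁ x t - F₂ x t| ≤ B)
    (hF' : ∀ x ∈ Ioc (0 : ℝ) 1, ∀ t, c < t → F₁ x t = F₂ x t) (he : -1 < e)
    (hE : ∀ t < e, ∫ x in (0 : ℝ)..1, (u₁ x t - u₂ x t) ^ 2 ≤ E) :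
    ∀ᵐ t, t ∈ Ioo (-1) T →
      ∫ x in (0 : ℝ)..1, (u₁ x t - u₂ x t) ^ 2 ≤ E + B ^ 2 * (c + 2) := by
  obtain ⟨A, hA, hle⟩ := H₁.energy_sub_le H₂ hB hF
  -- the first comparison is used slightly beyond `c`, to provide a starting time for the second
  have early : ∀ t ∈ A, t ∈ Ioo (-1) T → t ≤ c + 1 →
      ∫ x in (0 : ℝ)..1, (u₁ x t - u₂ x t) ^ 2 ≤ E + B ^ 2 * (c + 2) := by
    intro t ht htT htc
    obtain ⟨s, hs, hs'⟩ := exists_mem_Ioo_of_ae hA (lt_min htT.1 he)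
    have hs2 := lt_min_iff.1 hs'.2
    have h1 := (hle s hs t ht hs'.1 hs2.1 htT.2).2
    have h2 : 0 ≤ ∫ τ in s..t, ∫ x in (0 : ℝ)..1, (soft (σ₁ x τ) - soft (σ₂ x τ)) ^ 2 :=
      intervalIntegral.integral_nonneg hs2.1.le fun τ _ => integral_sq_nonneg _
    have h3 : B ^ 2 * (t - s) ≤ B ^ 2 * (c + 2) :=
      mul_le_mul_of_nonneg_left (by linarith [hs'.1]) (sq_nonneg B)
    linarith [hE s hs2.2]
  rcases le_or_gt T c with hTc | hTc
  · filter_upwards [hA] with t ht htT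
    exact early t ht htT (by linarith [htT.2])
  obtain ⟨A', hA', hle'⟩ := (H₁.restrict (a' := c) (by linarith) hTc.le le_rfl).energy_sub_le
    (H₂.restrict (by linarith) hTc.le le_rfl) (B := 0) le_rfl
    (fun x hx t ht => by rw [hF' x hx t ht.1, sub_self, abs_zero])
  filter_upwards [hA, hA'] with t ht ht' htT
  rcases le_or_gt t (c + 1) with h | h
  · exact early t ht htT h
  obtain ⟨s, hs, hs'⟩ := exists_mem_Ioo_of_ae (hA.and hA') (show c < c + 1 by linarith)
  have h1 := (hle' s hs.2 t ht' hs'.1 (hs'.2.trans h) htT.2).2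
  have h2 : 0 ≤ ∫ τ in s..t, ∫ x in (0 : ℝ)..1, (soft (σ₁ x τ) - soft (σ₂ x τ)) ^ 2 :=
    intervalIntegral.integral_nonneg (hs'.2.trans h).le fun τ _ => integral_sq_nonneg _
  have h3 := early s hs.1 ⟨by linarith [hs'.1], by linarith [hs'.2, htT.2]⟩ hs'.2.le
  have h4 : (0 : ℝ) ^ 2 * (t - s) = 0 := by ring
  linarith

/-- Exponential decay of the difference of two solutions with the same source: it decreases by a
factor of two in each unit of time, by the Poincaré inequality. -/
lemma sub_sq_decay (H₁ : Sol a b F u₁ σ₁) (H₂ : Sol a b F u₂ σ₂)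
    (hE : ∀ᵐ t, t ∈ Ioo a b → ∫ x in (0 : ℝ)..1, (u₁ x t - u₂ x t) ^ 2 ≤ E) (n : ℕ) :
    ∀ᵐ t, t ∈ Ioo (a + n) b → ∫ x in (0 : ℝ)..1, (u₁ x t - u₂ x t) ^ 2 ≤ E * (1 / 2) ^ n := by
  obtain ⟨A, hA, hle⟩ := H₁.energy_sub_le H₂ (B := 0) le_rfl
    (fun x hx t ht => by rw [sub_self, abs_zero])
  have hpoin : ∀ s ∈ A, ∀ t ∈ A, a < s → s < t → t < b → ∀ᵐ τ, τ ∈ Ioc s t →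
      ∫ x in (0 : ℝ)..1, (u₁ x τ - u₂ x τ) ^ 2 ≤
        ∫ x in (0 : ℝ)..1, (soft (σ₁ x τ) - soft (σ₂ x τ)) ^ 2 := by
    intro s hs t ht has hst htb
    have h1 := (hle s hs t ht has hst htb).1.prod_left_ae
    rw [ae_restrict_iff' measurableSet_Ioc] at h1
    filter_upwards [h1, H₁.ae_integrable_soft, H₂.ae_integrable_soft, H₁.eq_prim, H₂.eq_prim]
      with τ h2 i1 i2 p1 p2 hτ
    have hτ' : τ ∈ Ioo a b := ⟨has.trans hτ.1, hτ.2.trans_lt htb⟩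
    have i3 : IntervalIntegrable (fun x => (soft (σ₁ x τ) - soft (σ₂ x τ)) ^ 2) volume 0 1 :=
      (intervalIntegrable_iff_integrableOn_Ioc_of_le zero_le_one).2 (h2 hτ)
    have i4 : IntervalIntegrable (fun x => soft (σ₁ x τ) - soft (σ₂ x τ)) volume 0 1 :=
      (i1 hτ').sub (i2 hτ')
    have hnn := integral_sq_nonneg fun x => soft (σ₁ x τ) - soft (σ₂ x τ)
    have h3 : ∀ x ∈ Icc (0 : ℝ) 1, (u₁ x τ - u₂ x τ) ^ 2 ≤
        ∫ x in (0 : ℝ)..1, (soft (σ₁ x τ) - soft (σ₂ x τ)) ^ 2 := fun x hx => by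
      have hsub : uIcc 0 x ⊆ uIcc (0 : ℝ) 1 := by
        rw [uIcc_of_le hx.1, uIcc_of_le zero_le_one]; exact Icc_subset_Icc_right hx.2
      rw [p1 hτ' x hx, p2 hτ' x hx, ← intervalIntegral.integral_sub ((i1 hτ').mono_set hsub)
        ((i2 hτ').mono_set hsub)]
      refine (sq_integral_le i4 i3 le_rfl hx.1 hx.2).trans ?_
      have := mul_le_mul_of_nonneg_right hx.2 hnn
      linarith
    have h4 := intervalIntegral.norm_integral_le_of_norm_le_const (a := 0) (b := 1)
      (f := fun x => (u₁ x τ - u₂ x τ) ^ 2)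
      (C := ∫ x in (0 : ℝ)..1, (soft (σ₁ x τ) - soft (σ₂ x τ)) ^ 2) fun x hx => by
        rw [uIoc_of_le zero_le_one] at hx
        rw [Real.norm_eq_abs, abs_of_nonneg (sq_nonneg _)]
        exact h3 x (Ioc_subset_Icc_self hx)
    rw [sub_zero, abs_one, mul_one] at h4
    exact (le_abs_self _).trans h4
  have hmono : ∀ s ∈ A, ∀ t ∈ A, a < s → s < t → t < b →
      ∫ x in (0 : ℝ)..1, (u₁ x t - u₂ x t) ^ 2 ≤ ∫ x in (0 : ℝ)..1, (u₁ x s - u₂ x s) ^ 2 := by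
    intro s hs t ht has hst htb
    have h1 := (hle s hs t ht has hst htb).2
    have h2 : 0 ≤ ∫ τ in s..t, ∫ x in (0 : ℝ)..1, (soft (σ₁ x τ) - soft (σ₂ x τ)) ^ 2 :=
      intervalIntegral.integral_nonneg hst.le fun τ _ => integral_sq_nonneg _
    linarith
  have hdecay : ∀ s ∈ A, ∀ t ∈ A, a < s → s < t → t < b →
      (1 + (t - s)) * ∫ x in (0 : ℝ)..1, (u₁ x t - u₂ x t) ^ 2 ≤
        ∫ x in (0 : ℝ)..1, (u₁ x s - u₂ x s) ^ 2 := by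
    intro s hs t ht has hst htb
    obtain ⟨h0, h1⟩ := hle s hs t ht has hst htb
    have hi : IntervalIntegrable (fun τ => ∫ x in (0 : ℝ)..1,
        (soft (σ₁ x τ) - soft (σ₂ x τ)) ^ 2) volume s t := by
      rw [intervalIntegrable_iff_integrableOn_Ioc_of_le hst.le]
      simp only [intervalIntegral.integral_of_le zero_le_one]
      exact h0.integral_prod_right
    have h2 : ∫ τ in s..t, (∫ x in (0 : ℝ)..1, (u₁ x t - u₂ x t) ^ 2) ≤
        ∫ τ in s..t, ∫ x in (0 : ℝ)..1, (soft (σ₁ x τ) - soft (σ₂ x τ)) ^ 2 := by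
      refine intervalIntegral.integral_mono_ae_restrict hst.le intervalIntegrable_const hi ?_
      rw [← restrict_Ioo_eq_restrict_Icc, EventuallyLE, ae_restrict_iff' measurableSet_Ioo]
      filter_upwards [hA, hpoin s hs t ht has hst htb] with τ hτ hp hτ'
      exact (hmono τ hτ t ht (has.trans hτ'.1) hτ'.2 htb).trans (hp (Ioo_subset_Ioc_self hτ'))
    rw [intervalIntegral.integral_const, smul_eq_mul] at h2
    linarith
  have hA2 : ∀ᵐ t, t ∈ A ∧ (t ∈ Ioo a b → ∫ x in (0 : ℝ)..1, (u₁ x t - u₂ x t) ^ 2 ≤ E) :=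
    hA.and hE
  filter_upwards [hA2] with t ht
  induction n generalizing t with
  | zero =>
    intro htT
    simpa using ht.2 (by simpa using htT)
  | succ n ih =>
    intro htT
    push_cast at htT
    obtain ⟨s, hs, hs'⟩ := exists_mem_Ioo_of_ae hA2 (show a + n < t - 1 by linarith [htT.1])
    have hn : (0 : ℝ) ≤ n := n.cast_nonneg
    have h1 := ih s hs ⟨hs'.1, by linarith [hs'.2, htT.2]⟩
    have h2 := hdecay s hs.1 t ht.1 (by linarith [hs'.1]) (by linarith [hs'.2]) htT.2
    have h3 := integral_sq_nonneg fun x => u₁ x t - u₂ x t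
    have h4 : 2 * ∫ x in (0 : ℝ)..1, (u₁ x t - u₂ x t) ^ 2 ≤
        (1 + (t - s)) * ∫ x in (0 : ℝ)..1, (u₁ x t - u₂ x t) ^ 2 :=
      mul_le_mul_of_nonneg_right (by linarith [hs'.2]) h3
    rw [pow_succ]
    linarith

end Sol

/-! ### Regularity in time and bound of the gradient -/

lemma integral_sq_sub_le {f g h : ℝ → ℝ} (hf : ContinuousOn f (Icc 0 1))
    (hg : ContinuousOn g (Icc 0 1)) (hh : ContinuousOn h (Icc 0 1)) :
    ∫ x in (0 : ℝ)..1, (f x - h x) ^ 2 ≤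
      2 * (∫ x in (0 : ℝ)..1, (f x - g x) ^ 2) + 2 * ∫ x in (0 : ℝ)..1, (g x - h x) ^ 2 := by
  rw [← uIcc_of_le zero_le_one] at hf hg hh
  have i1 : IntervalIntegrable (fun x => (f x - g x) ^ 2) volume 0 1 :=
    ((hf.sub hg).pow 2).intervalIntegrable
  have i2 : IntervalIntegrable (fun x => (g x - h x) ^ 2) volume 0 1 :=
    ((hg.sub hh).pow 2).intervalIntegrable
  rw [← intervalIntegral.integral_const_mul, ← intervalIntegral.integral_const_mul,
    ← intervalIntegral.integral_add (i1.const_mul 2) (i2.const_mul 2)]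
  refine intervalIntegral.integral_mono_on zero_le_one
    ((hf.sub hh).pow 2).intervalIntegrable ((i1.const_mul 2).add (i2.const_mul 2)) fun x _ => ?_
  nlinarith [sq_nonneg (f x - g x - (g x - h x))]

/-- The difference of the squared norms of two functions at distance `O(h)` is `O(h)`. -/
lemma integral_sq_sub_integral_sq_le {f g : ℝ → ℝ} {h L M : ℝ} (hh : 0 < h)
    (hf : ContinuousOn f (Icc 0 1)) (hg : ContinuousOn g (Icc 0 1))
    (hL : ∫ x in (0 : ℝ)..1, (f x - g x) ^ 2 ≤ L * h ^ 2) (hfM : ∫ x in (0 : ℝ)..1, f x ^ 2 ≤ M)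
    (hgM : ∫ x in (0 : ℝ)..1, g x ^ 2 ≤ M) :
    (∫ x in (0 : ℝ)..1, f x ^ 2) - ∫ x in (0 : ℝ)..1, g x ^ 2 ≤ (L + 2 * M) * h := by
  rw [← uIcc_of_le zero_le_one] at hf hg
  have i0 : IntervalIntegrable (fun x => (f x - g x) ^ 2) volume 0 1 :=
    ((hf.sub hg).pow 2).intervalIntegrable
  have i1 : IntervalIntegrable (fun x => f x ^ 2) volume 0 1 := (hf.pow 2).intervalIntegrable
  have i2 : IntervalIntegrable (fun x => g x ^ 2) volume 0 1 := (hg.pow 2).intervalIntegrable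
  have h1 : ∫ x in (0 : ℝ)..1, (f x ^ 2 - g x ^ 2) ≤
      ∫ x in (0 : ℝ)..1, (h⁻¹ * (f x - g x) ^ 2 + (h * f x ^ 2 + h * g x ^ 2)) := by
    refine intervalIntegral.integral_mono_on zero_le_one (i1.sub i2)
      ((i0.const_mul h⁻¹).add ((i1.const_mul h).add (i2.const_mul h))) fun x _ => ?_
    have e : h⁻¹ * (f x - g x) ^ 2 + (h * f x ^ 2 + h * g x ^ 2) - (f x ^ 2 - g x ^ 2) =
        h⁻¹ * ((f x - g x) - h * (f x + g x) / 2) ^ 2 +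
          h * ((3 / 4) * (f x ^ 2 + g x ^ 2) - f x * g x / 2) := by
      field_simp
      ring
    have h2 : 0 ≤ h⁻¹ * ((f x - g x) - h * (f x + g x) / 2) ^ 2 := by positivity
    have h3 : 0 ≤ h * ((3 / 4) * (f x ^ 2 + g x ^ 2) - f x * g x / 2) :=
      mul_nonneg hh.le (by nlinarith [sq_nonneg (f x - g x), sq_nonneg (f x), sq_nonneg (g x)])
    linarith
  rw [intervalIntegral.integral_sub i1 i2, intervalIntegral.integral_add (i0.const_mul h⁻¹)
    ((i1.const_mul h).add (i2.const_mul h)), intervalIntegral.integral_add (i1.const_mul h)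
    (i2.const_mul h), intervalIntegral.integral_const_mul, intervalIntegral.integral_const_mul,
    intervalIntegral.integral_const_mul] at h1
  have h2 := mul_le_mul_of_nonneg_left hL (inv_pos.2 hh).le
  have e : h⁻¹ * (L * h ^ 2) = L * h := by field_simp
  have h3 := mul_le_mul_of_nonneg_left hfM hh.le
  have h4 := mul_le_mul_of_nonneg_left hgM hh.le
  linarith

/-- A bound for the increments of every fixed length at almost every time holds for almost all
pairs of times. -/
lemma ae_ae_le_of_ae_shift {G : ℝ → ℝ → ℝ} (hG : Measurable (Function.uncurry G)) {a b K : ℝ}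
    (h : ∀ δ ∈ Ioo (0 : ℝ) 1, ∀ᵐ t, t ∈ Ioo a (b - δ) → G (t + δ) t ≤ K * δ ^ 2) :
    (∀ᵐ s, ∀ᵐ t, a < s → s < t → t < s + 1 → t < b → G t s ≤ K * (t - s) ^ 2) ∧
      ∀ᵐ t, ∀ᵐ s, a < s → s < t → t < s + 1 → t < b → G t s ≤ K * (t - s) ^ 2 := by
  let S : Set (ℝ × ℝ) := {z | z.1 ∈ Ioo (0 : ℝ) 1 ∧ a < z.2 ∧ z.2 + z.1 < b}
  have hSm : MeasurableSet S :=
    (measurable_fst measurableSet_Ioo).inter ((measurableSet_lt measurable_const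
      measurable_snd).inter (measurableSet_lt (measurable_snd.add measurable_fst)
      measurable_const))
  have hRm : MeasurableSet {z : ℝ × ℝ | G (z.2 + z.1) z.2 ≤ K * z.1 ^ 2} :=
    measurableSet_le (hG.comp ((measurable_snd.add measurable_fst).prodMk measurable_snd))
      ((measurable_fst.pow_const 2).const_mul _)
  have hm : MeasurableSet {z : ℝ × ℝ | z ∈ S → G (z.2 + z.1) z.2 ≤ K * z.1 ^ 2} := by
    convert! hSm.compl.union hRm using 1
    ext z
    exact imp_iff_not_or
  have h1 : ∀ᵐ δ : ℝ, ∀ᵐ t : ℝ, (δ, t) ∈ S → G (t + δ) t ≤ K * δ ^ 2 := by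
    refine Eventually.of_forall fun δ => ?_
    by_cases hδ : δ ∈ Ioo (0 : ℝ) 1
    · filter_upwards [h δ hδ] with t ht hS
      exact ht ⟨hS.2.1, by linarith [hS.2.2]⟩
    · exact Eventually.of_forall fun t h => absurd h.1 hδ
  have h2 := (Measure.ae_prod_iff_ae_ae (μ := volume) (ν := volume) hm).2 h1
  have hmap := (Measure.measurePreserving_swap (μ := (volume : Measure ℝ))
    (ν := (volume : Measure ℝ))).comp (measurePreserving_prod_neg_add volume volume)
  have h3 : ∀ᵐ z : ℝ × ℝ ∂(volume.prod volume), a < z.1 → z.1 < z.2 → z.2 < z.1 + 1 → z.2 < b →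
      G z.2 z.1 ≤ K * (z.2 - z.1) ^ 2 := by
    filter_upwards [hmap.quasiMeasurePreserving.ae h2] with z hz k1 k2 k3 k4
    have := hz ⟨⟨by simp; linarith, by simp; linarith⟩, by simpa using k1, by simpa using k4⟩
    simpa [neg_add_eq_sub] using this
  exact ⟨Measure.ae_ae_of_ae_prod h3,
    Measure.ae_ae_of_ae_prod (Measure.measurePreserving_swap.quasiMeasurePreserving.ae h3)⟩

namespace Sol

variable {α T : ℝ} {u σ : ℝ → ℝ → ℝ} {v : ℝ → ℝ}

/-- Comparison of a solution with its translate in time: the sources differ by at most `δ`, and only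
until the time `α`, and both functions equal the initial state at times before `-δ`. -/
lemma shift_sub_sq_le (hα : 0 ≤ α) (hT : 0 < T) (H : Sol (-1) T (source α) u σ)
    (h0 : ∀ t ≤ 0, ∀ x, u x t = v x) {δ : ℝ} (hδ : δ ∈ Ioo (0 : ℝ) 1) :
    ∀ᵐ t, t ∈ Ioo (-1) (T - δ) →
      ∫ x in (0 : ℝ)..1, (u x (t + δ) - u x t) ^ 2 ≤ (α + 2) * δ ^ 2 := by
  have h := sub_sq_le (T := T - δ) (c := α) (B := δ) (E := 0) (e := -δ)
    ((H.shift δ).restrict (a' := -1) (b' := T - δ) (by linarith [hδ.1]) (by linarith [hδ.2]) le_rfl)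
    (H.restrict le_rfl (by linarith [hδ.2]) (by linarith [hδ.1])) hδ.1.le hα
    (fun x _ t _ => (source_sub_le α x (t + δ) t).trans (by
      rw [add_sub_cancel_left, abs_of_pos hδ.1]))
    (fun x _ t ht => by
      have h1 : min (max (t + δ) 0) α = α :=
        min_eq_right ((by linarith [hδ.1] : α ≤ t + δ).trans (le_max_left _ _))
      have h2 : min (max t 0) α = α := min_eq_right (ht.le.trans (le_max_left _ _))
      rw [source, source, h1, h2])
    (by linarith [hδ.2]) (fun t ht => by
      have e : ∀ x, u x (t + δ) - u x t = 0 := fun x => by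
        rw [h0 _ (by linarith), h0 _ (by linarith [hδ.1]), sub_self]
      simp [e])
  filter_upwards [h] with t ht ht'
  have := ht ht'
  linarith

/-- Solutions are Lipschitz continuous in time with values in `L²`, off a null set of times. The
good times are those for which the estimate holds with almost every other time; two good times are
compared through a third one between them. -/
lemma exists_lipschitz (hα : 0 ≤ α) (hT : 0 < T) (H : Sol (-1) T (source α) u σ)
    (h0 : ∀ t ≤ 0, ∀ x, u x t = v x) :
    ∃ A : Set ℝ, (∀ᵐ t, t ∈ A) ∧ ∀ s ∈ A, ∀ t ∈ A, -1 < s → s < t → t < s + 1 → t < T →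
      ∫ x in (0 : ℝ)..1, (u x s - u x t) ^ 2 ≤ 2 * (α + 2) * (t - s) ^ 2 := by
  -- a jointly measurable version of the solution
  set w : ℝ → ℝ → ℝ := fun x t => ∫ y in (0 : ℝ)..x, soft (σ y t) with hw
  have hwm : Measurable (Function.uncurry w) :=
    measurable_primitive (continuous_soft.measurable.comp H.meas)
  set G : ℝ → ℝ → ℝ := fun s t => ∫ x in (0 : ℝ)..1, (w x s - w x t) ^ 2 with hG
  have hGm : Measurable (Function.uncurry G) := by
    refine measurable_parametric_intervalIntegral (α := ℝ × ℝ)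
      (f := fun z x => (w x z.1 - w x z.2) ^ 2) ?_ measurable_const measurable_const
    exact ((hwm.comp (measurable_snd.prodMk (measurable_fst.comp measurable_fst))).sub
      (hwm.comp (measurable_snd.prodMk (measurable_snd.comp measurable_fst)))).pow_const 2
  have hGe : ∀ s t, (∀ x ∈ Icc (0 : ℝ) 1, u x s = w x s) → (∀ x ∈ Icc (0 : ℝ) 1, u x t = w x t) →
      G s t = ∫ x in (0 : ℝ)..1, (u x s - u x t) ^ 2 := fun s t hs ht => by
    refine intervalIntegral.integral_congr fun x hx => ?_
    rw [uIcc_of_le zero_le_one] at hx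
    simp only [hs x hx, ht x hx]
  obtain ⟨h4, h5⟩ := ae_ae_le_of_ae_shift hGm (a := -1) (b := T) (K := α + 2) fun δ hδ => by
    filter_upwards [H.shift_sub_sq_le hα hT h0 hδ, H.eq_prim, EnergyData.ae_shift δ H.eq_prim]
      with t ht e1 e2 htT
    rw [hGe _ _ (e2 ⟨by linarith [htT.1, hδ.1], by linarith [htT.2]⟩)
      (e1 ⟨htT.1, by linarith [htT.2, hδ.1]⟩)]
    exact ht htT
  have hgood : ∀ᵐ t, t ∈ Ioo (-1) T → (∀ x ∈ Icc (0 : ℝ) 1, u x t = w x t) ∧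
      ContinuousOn (fun x => u x t) (Icc 0 1) := by
    filter_upwards [H.eq_prim, H.ae_continuousOn] with t e c ht
    exact ⟨e ht, c ht⟩
  refine ⟨{t | _}, (h4.and h5).and hgood, fun s hs t ht h1s hst hst1 htT => ?_⟩
  obtain ⟨m, ⟨⟨hm1, hm2⟩, em⟩, hm⟩ := exists_mem_Ioo_of_ae (A := {m | _})
    ((hs.1.1.and ht.1.2).and hgood) hst
  obtain ⟨es, cs⟩ := hs.2 ⟨h1s, hst.trans htT⟩
  obtain ⟨et, ct⟩ := ht.2 ⟨h1s.trans hst, htT⟩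
  obtain ⟨em, cm⟩ := em ⟨h1s.trans hm.1, hm.2.trans htT⟩
  have k1 := hm1 h1s hm.1 (hm.2.trans hst1) (hm.2.trans htT)
  have k2 := hm2 (h1s.trans hm.1) hm.2 (by linarith [hm.1]) htT
  rw [hGe _ _ em es] at k1
  rw [hGe _ _ et em] at k2
  have k3 := integral_sq_sub_le ct cm cs
  have e : ∫ x in (0 : ℝ)..1, (u x s - u x t) ^ 2 = ∫ x in (0 : ℝ)..1, (u x t - u x s) ^ 2 := by
    congr 1; ext x; ring
  rw [e]
  have k4 : (α + 2) * ((m - s) ^ 2 + (t - m) ^ 2) ≤ (α + 2) * (t - s) ^ 2 :=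
    mul_le_mul_of_nonneg_left (by nlinarith [hm.1, hm.2]) (by linarith)
  linarith

/-- The zero solution; comparison with it bounds the dissipation. -/
lemma zero (a b : ℝ) : Sol a b (fun _ _ => 0) (fun _ _ => 0) fun _ _ => 0 := by
  have hs : soft 0 = 0 := soft_of_abs_le (by norm_num) (by norm_num)
  refine stationary (v := fun _ => 0) (K := 0) measurable_const (fun _ _ _ => by simp)
    (fun t _ x _ => by simp [hs]) rfl measurable_const ⟨0, fun _ _ => by simp⟩
    (fun t _ ψ _ => by simp [flux])

/-- Bound of the gradient in `L²`, uniform in time: the dissipation over a short time interval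
is controlled by the Lipschitz continuity in time. -/
lemma ae_integral_sq_soft_le (hα : 0 ≤ α) (hT : 1 < T) (H : Sol (-1) T (source α) u σ) {A : Set ℝ}
    {L M : ℝ} (hA : ∀ᵐ t, t ∈ A)
    (hL : ∀ s ∈ A, ∀ t ∈ A, -1 < s → s < t → t < s + 1 → t < T →
      ∫ x in (0 : ℝ)..1, (u x s - u x t) ^ 2 ≤ L * (t - s) ^ 2)
    (hM : ∀ᵐ t, t ∈ Ioo (-1) T → ∫ x in (0 : ℝ)..1, u x t ^ 2 ≤ M) :
    ∀ᵐ t, t ∈ Ioo 0 (T - 1) → IntervalIntegrable (fun x => soft (σ x t) ^ 2) volume 0 1 ∧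
      ∫ x in (0 : ℝ)..1, soft (σ x t) ^ 2 ≤ (4 + α) ^ 2 + L + 2 * M := by
  have hs0 : soft 0 = 0 := soft_of_abs_le (by norm_num) (by norm_num)
  obtain ⟨A', hA', hle⟩ := H.energy_sub_le (zero (-1) T) (B := 4 + α) (by linarith)
    (fun x _ t _ => by rw [sub_zero]; exact abs_source_le hα x t)
  simp only [hs0, sub_zero] at hle
  -- the dissipation is integrable on `(s₀, t₀)`, and its averages over `(t, t + h)` are bounded
  obtain ⟨s₀, hs₀, hs₀'⟩ := exists_mem_Ioo_of_ae hA' (show (-1 : ℝ) < 0 by norm_num)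
  obtain ⟨t₀, ht₀, ht₀'⟩ := exists_mem_Ioo_of_ae hA' (show T - 1 < T by linarith)
  have hi := (hle s₀ hs₀ t₀ ht₀ hs₀'.1 (by linarith [hs₀'.2, ht₀'.1]) ht₀'.2).1
  set D : ℝ → ℝ := fun τ => ∫ x in (0 : ℝ)..1, soft (σ x τ) ^ 2 with hD
  have hDnn : ∀ τ, 0 ≤ D τ := fun τ => integral_sq_nonneg fun x => soft (σ x τ)
  have hDi : ∀ {s t : ℝ}, s < t → Integrable (Function.uncurry fun x τ => soft (σ x τ) ^ 2)
      ((volume.restrict (Ioc 0 1)).prod (volume.restrict (Ioc s t))) → IntegrableOn D (Ioc s t) :=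
    fun _ h => by
      simp only [hD, intervalIntegral.integral_of_le zero_le_one]
      exact h.integral_prod_right
  have hz : LocallyIntegrable ((Ioc s₀ t₀).indicator D) volume :=
    ((integrable_indicator_iff measurableSet_Ioc).2
      (hDi (by linarith [hs₀'.2, ht₀'.1]) hi)).locallyIntegrable
  have hx := hi.prod_left_ae
  rw [ae_restrict_iff' measurableSet_Ioc] at hx
  have hgood := ((hA.and hA').and hM).and H.ae_continuousOn
  have hall : ∀ᵐ t, ∀ n : ℕ, _ := ae_all_iff.2 fun n : ℕ =>
    EnergyData.ae_shift (1 / ((n : ℝ) + 1)) hgood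
  filter_upwards [ae_tendsto_stek hz, hx, hgood, hall] with t htend hxt ht hn htT
  have htm : t ∈ Ioc s₀ t₀ := ⟨hs₀'.2.trans htT.1, (htT.2.trans ht₀'.1).le⟩
  refine ⟨(intervalIntegrable_iff_integrableOn_Ioc_of_le zero_le_one).2 (hxt htm), ?_⟩
  rw [indicator_of_mem htm] at htend
  refine le_of_tendsto htend ((eventually_ge_atTop 1).mono fun n h1n => ?_)
  have hn1 : (1 : ℝ) ≤ n := by exact_mod_cast h1n
  have hpos : (0 : ℝ) < 1 / ((n : ℝ) + 1) := by positivity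
  have hlt : 1 / ((n : ℝ) + 1) < 1 := by
    rw [div_lt_one (by linarith)]; linarith
  have hnn := hn n
  generalize 1 / ((n : ℝ) + 1) = h at *
  have htT' : t ∈ Ioo (-1) T := ⟨by linarith [htT.1], by linarith [htT.2]⟩
  have hthT : t + h ∈ Ioo (-1) T := ⟨by linarith [htT.1], by linarith [htT.2]⟩
  obtain ⟨⟨⟨hA1, hA1'⟩, hM1⟩, hc1⟩ := ht
  obtain ⟨⟨⟨hA2, hA2'⟩, hM2⟩, hc2⟩ := hnn
  obtain ⟨hi', hen⟩ := hle t hA1' (t + h) hA2' htT'.1 (by linarith) hthT.2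
  have hlip := hL t hA1 (t + h) hA2 htT'.1 (by linarith) (by linarith) hthT.2
  rw [add_sub_cancel_left] at hlip hen
  have hdiff := integral_sq_sub_integral_sq_le hpos (hc1 htT') (hc2 hthT) hlip (hM1 htT') (hM2 hthT)
  have hDI : IntervalIntegrable D volume t (t + h) :=
    (intervalIntegrable_iff_integrableOn_Ioc_of_le (by linarith)).2 (hDi (by linarith) hi')
  have hzD : ∫ r in t..t + h, (Ioc s₀ t₀).indicator D r ≤ ∫ r in t..t + h, D r :=
    intervalIntegral.integral_mono_on (by linarith)
      (intervalIntegrable_of_locallyIntegrable hz _ _) hDI fun r _ =>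
        indicator_le_self' (fun x _ => hDnn x) r
  rw [stek, inv_mul_le_iff₀ hpos]
  linarith

end Sol

/-! ### Comparison with the steady states -/

lemma abs_steadyFlux_le {β x : ℝ} (hx : x ∈ Icc (0 : ℝ) 1) : |steadyFlux β x| ≤ 2 + |β| := by
  have h1 : |4 * x - 2| ≤ 2 := abs_le.2 ⟨by linarith [hx.1], by linarith [hx.2]⟩
  have h2 := mul_le_mul_of_nonneg_left (abs_bumpPrim_le hx) (abs_nonneg β)
  rw [steadyFlux]
  refine (abs_add_le _ _).trans ?_
  rw [abs_mul]
  linarith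

/-- A bound for the squared distance to the final state. -/
noncomputable def gapBound (α : ℝ) : ℝ :=
  (∫ x in (0 : ℝ)..1, (steady 0 x - steady α x) ^ 2) + α ^ 2 * (α + 2)

/-- A bound for the squared `L²` norm of a solution. -/
noncomputable def normBound (α : ℝ) : ℝ :=
  2 * gapBound α + 2 * ∫ x in (0 : ℝ)..1, steady α x ^ 2

/-- A bound for the squared `L²` norms of the space and time derivatives of a solution. -/
noncomputable def derivBound (α : ℝ) : ℝ := (4 + α) ^ 2 + 2 * (α + 2) + 2 * normBound α

lemma gapBound_nonneg {α : ℝ} (hα : 0 ≤ α) : 0 ≤ gapBound α :=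
  add_nonneg (integral_sq_nonneg _) (by positivity)

lemma normBound_nonneg {α : ℝ} (hα : 0 ≤ α) : 0 ≤ normBound α :=
  add_nonneg (mul_nonneg zero_le_two (gapBound_nonneg hα))
    (mul_nonneg zero_le_two (integral_sq_nonneg _))

lemma le_derivBound {α : ℝ} (hα : 0 ≤ α) : 2 * (α + 2) ≤ derivBound α := by
  have := normBound_nonneg hα
  rw [derivBound]
  nlinarith [sq_nonneg (4 + α)]

/-- The factor `1 / 2` per unit of time after the time `α`, in exponential form. -/
lemma exists_nat_half_pow_le {α t : ℝ} (h : α < t) :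
    ∃ n : ℕ, α + n < t ∧ (1 / 2 : ℝ) ^ n ≤ Real.exp (Real.log 2 * (α + 1 - t)) := by
  obtain ⟨n, hn⟩ : ∃ n : ℕ, α + n < t ∧ t ≤ α + n + 1 := by
    have h1 := Nat.ceil_lt_add_one (sub_pos.2 h).le
    have h2 := Nat.le_ceil (t - α)
    have h3 : 0 < ⌈t - α⌉₊ := Nat.ceil_pos.2 (sub_pos.2 h)
    refine ⟨⌈t - α⌉₊ - 1, ?_⟩
    rw [Nat.cast_sub h3, Nat.cast_one]
    exact ⟨by linarith, by linarith⟩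
  refine ⟨n, hn.1, ?_⟩
  have hlog := Real.log_pos one_lt_two
  have e : (1 / 2 : ℝ) ^ n = Real.exp (Real.log 2 * (-n)) := by
    rw [Real.exp_mul, Real.exp_log two_pos, Real.rpow_neg two_pos.le, Real.rpow_natCast,
      one_div, inv_pow]
  rw [e]
  exact Real.exp_le_exp.2 (mul_le_mul_of_nonneg_left (by linarith [hn.2]) hlog.le)

namespace Sol

variable {α T : ℝ} {u σ : ℝ → ℝ → ℝ}

/-- The steady state for the final force. -/
lemma steady_final (α a b : ℝ) :
    Sol a b (fun x _ => -steadyForce α x) (fun x _ => steady α x) fun x _ => steadyFlux α x := by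
  refine stationary (K := 2 + |α|) ((continuous_steadyFlux α).measurable.comp measurable_fst)
    (fun x hx _ => abs_steadyFlux_le hx) (fun _ _ _ _ => rfl) (steady_one α)
    ((measurable_const.add (measurable_const.mul (measurable_bump.comp measurable_fst))).neg)
    ⟨4 + |α|, fun x _ => ?_⟩ fun _ _ ψ hψ => flux_steady hψ (fun _ => rfl) fun _ => rfl
  rw [abs_neg, steadyForce_eq]
  refine (abs_add_le _ _).trans ?_
  rw [abs_mul]
  have := mul_le_mul_of_nonneg_left (abs_bump_le x) (abs_nonneg α)
  norm_num
  linarith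

/-- The initial state solves the evolution problem up to the time `12`. The flux is truncated in
time only to be bounded. -/
lemma steady_initial (hα : 12 ≤ α) (a : ℝ) {b : ℝ} (hb : b ≤ 12) :
    Sol a b (source α) (fun x _ => steady 0 x)
      fun x t => steadyFlux (min (max t 0) α) x := by
  have hα0 : 0 ≤ α := by linarith
  refine stationary (K := 2 + α) ?_ (fun x hx t => ?_) (fun t ht x _ => ?_) (steady_one 0)
    (measurable_source α) ⟨4 + α, abs_source_le hα0⟩
    fun t _ ψ hψ => flux_steady (β := min (max t 0) α) hψ (fun _ => rfl) fun _ => rfl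
  · exact continuous_steadyFlux₂.measurable.comp
      (((measurable_snd.max measurable_const).min measurable_const).prodMk measurable_fst)
  · refine (abs_steadyFlux_le hx).trans ?_
    rw [abs_of_nonneg (le_min (le_max_right _ _) hα0)]
    linarith [min_le_right (max t 0) α]
  · refine intervalIntegral.integral_congr fun y _ => ?_
    refine (steadySlope_eq_of_le (le_min (le_max_right _ _) hα0) ?_).symm
    exact (min_le_left _ _).trans (max_le (ht.2.le.trans hb) (by norm_num))

/-- The solution does not move before the time `12`. -/
lemma ae_eq_steady_zero (hα : 12 ≤ α) (hT : 0 < T) (H : Sol (-1) T (source α) u σ)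
    (h0 : ∀ t ≤ 0, ∀ x, u x t = steady 0 x) :
    ∀ᵐ t, t ∈ Ioo (-1) T → t < 12 → ∀ x ∈ Icc (0 : ℝ) 1, u x t = steady 0 x := by
  have hT' : 0 < min T 12 := lt_min hT (by norm_num)
  have H' := H.restrict le_rfl (by linarith : -1 ≤ min T 12) (min_le_left _ _)
  have h := sub_sq_le (E := 0) (B := 0) (c := 0) (e := 0) H'
    (steady_initial hα (-1) (min_le_right T 12)) le_rfl le_rfl
    (fun x _ t _ => by rw [sub_self, abs_zero]) (fun _ _ _ _ => rfl) (by norm_num)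
    (fun t ht => by simp [h0 t ht.le])
  filter_upwards [h, H.ae_continuousOn] with t h1 hc ht ht12 x hx
  have h2 := h1 ⟨ht.1, lt_min ht.2 ht12⟩
  have hcd : ContinuousOn (fun x => (u x t - steady 0 x) ^ 2) (Icc 0 1) :=
    ((hc ht).sub (continuous_steady 0).continuousOn).pow 2
  by_contra hne
  have hpos : 0 < ∫ x in (0 : ℝ)..1, (u x t - steady 0 x) ^ 2 :=
    intervalIntegral.integral_pos zero_lt_one hcd (fun _ _ => sq_nonneg _)
      ⟨x, hx, by have := sub_ne_zero.2 hne; positivity⟩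
  linarith

lemma ae_sub_steady_le (hα : 0 ≤ α) (H : Sol (-1) T (source α) u σ)
    (h0 : ∀ t ≤ 0, ∀ x, u x t = steady 0 x) :
    ∀ᵐ t, t ∈ Ioo (-1) T → ∫ x in (0 : ℝ)..1, (u x t - steady α x) ^ 2 ≤ gapBound α := by
  refine sub_sq_le (e := 0) H (steady_final α (-1) T) hα hα (fun x _ t _ => ?_)
    (fun x _ t ht => ?_) (by norm_num) (fun t ht => by simp only [h0 t ht.le, le_refl])
  · have e : source α x t - -steadyForce α x = (α - min (max t 0) α) * bump x := by
      rw [source, steadyForce_eq, steadyForce_eq]; ring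
    have h1 : 0 ≤ min (max t 0) α := le_min (le_max_right _ _) hα
    have h2 : min (max t 0) α ≤ α := min_le_right _ _
    rw [e, abs_mul]
    have h3 : |α - min (max t 0) α| ≤ α := abs_le.2 ⟨by linarith, by linarith⟩
    have := mul_le_mul h3 (abs_bump_le x) (abs_nonneg _) hα
    linarith
  · rw [source, min_eq_right (ht.le.trans (le_max_left _ _))]

lemma ae_sub_steady_decay (hα : 0 ≤ α) (H : Sol (-1) T (source α) u σ)
    (h0 : ∀ t ≤ 0, ∀ x, u x t = steady 0 x) :
    ∀ᵐ t, t ∈ Ioo (-1) T → ∫ x in (0 : ℝ)..1, (u x t - steady α x) ^ 2 ≤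
      gapBound α * Real.exp (Real.log 2 * (α + 1 - t)) := by
  have hlog := Real.log_pos one_lt_two
  have early : ∀ t ≤ α, gapBound α ≤ gapBound α * Real.exp (Real.log 2 * (α + 1 - t)) :=
    fun t ht => le_mul_of_one_le_right (gapBound_nonneg hα)
      (Real.one_le_exp (mul_nonneg hlog.le (by linarith)))
  have h1 := H.ae_sub_steady_le hα h0
  rcases le_or_gt T α with hT | hT
  · filter_upwards [h1] with t h ht
    exact (h ht).trans (early t (by linarith [ht.2]))
  have hsrc : ∀ x, ∀ t, α < t → source α x t = -steadyForce α x := fun x t ht => by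
    rw [source, min_eq_right (ht.le.trans (le_max_left _ _))]
  have H' : Sol α T (fun x _ => -steadyForce α x) u σ := by
    have H'' := H.restrict (by linarith : -1 ≤ α) hT.le le_rfl
    refine ⟨H''.meas, H''.int, H''.eq_prim, H''.right, H''.bound, ?_,
      (steady_final α 0 1).measF, (steady_final α 0 1).boundF⟩
    obtain ⟨k, hk⟩ := H''.weak
    refine ⟨k, fun ψ hψ => ?_⟩
    filter_upwards [hk ψ hψ] with t h ht
    rw [h ht]
    congr 1
    refine intervalIntegral.integral_congr_ae (Eventually.of_forall fun τ hτ => ?_)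
    rw [uIoc_of_le ht.1.le] at hτ
    simp only [flux, hsrc _ τ hτ.1]
  have h2 := ae_all_iff.2 fun n : ℕ => H'.sub_sq_decay (steady_final α α T)
    (h1.mono fun t h ht => h ⟨by linarith [ht.1], ht.2⟩) n
  filter_upwards [h1, h2] with t h1 h2 ht
  rcases le_or_gt t α with h | h
  · exact (h1 ht).trans (early t h)
  · obtain ⟨n, hn, hn'⟩ := exists_nat_half_pow_le h
    exact (h2 n ⟨hn, ht.2⟩).trans (mul_le_mul_of_nonneg_left hn' (gapBound_nonneg hα))

lemma ae_sq_le_normBound (hα : 0 ≤ α) (H : Sol (-1) T (source α) u σ)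
    (h0 : ∀ t ≤ 0, ∀ x, u x t = steady 0 x) :
    ∀ᵐ t, t ∈ Ioo (-1) T → ∫ x in (0 : ℝ)..1, u x t ^ 2 ≤ normBound α := by
  filter_upwards [H.ae_sub_steady_le hα h0, H.ae_continuousOn] with t h hc ht
  have := integral_sq_sub_le (hc ht) (continuous_steady α).continuousOn
    (continuousOn_const (c := (0 : ℝ)))
  simp only [sub_zero] at this
  rw [normBound]
  linarith [h ht]

end Sol

/-- The estimates on which the long time behaviour of a global weak solution rests: off a null set
of times it is bounded in `W^{1,2}`, Lipschitz continuous with values in `L²`, equal to the initial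
state before the time `12`, and exponentially close to the final state. -/
theorem IsGlobalWeakSolution.exists_estimates {α : ℝ} (hα : 12 ≤ α) {u : ℝ → ℝ → ℝ}
    (hu : IsGlobalWeakSolution (fun x t => -breakingForce α x t) (steady 0) u) :
    ∃ A : Set ℝ, (∀ᵐ t, t ∈ A) ∧
      (∀ t ∈ A, 0 < t → ∃ q : ℝ → ℝ, IntervalIntegrable q volume 0 1 ∧
        IntervalIntegrable (fun x => q x ^ 2) volume 0 1 ∧
        (∀ x ∈ Icc (0 : ℝ) 1, u x t = ∫ y in (0 : ℝ)..x, q y) ∧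
        ∫ x in (0 : ℝ)..1, q x ^ 2 ≤ derivBound α) ∧
      (∀ s ∈ A, ∀ t ∈ A, 0 < s → s < t → t < s + 1 →
        ∫ x in (0 : ℝ)..1, (u x s - u x t) ^ 2 ≤ derivBound α * (t - s) ^ 2) ∧
      (∀ t ∈ A, 0 < t → t < 12 → ∀ x ∈ Icc (0 : ℝ) 1, u x t = steady 0 x) ∧
      ∀ t ∈ A, 0 < t → ∫ x in (0 : ℝ)..1, (u x t - steady α x) ^ 2 ≤
        gapBound α * Real.exp (Real.log 2 * (α + 1 - t)) := by
  have hα0 : 0 ≤ α := by linarith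
  have key : ∀ n : ℕ, ∃ A : Set ℝ, (∀ᵐ t, t ∈ A) ∧
      (∀ t ∈ A, 0 < t → t < n → ∃ q : ℝ → ℝ, IntervalIntegrable q volume 0 1 ∧
        IntervalIntegrable (fun x => q x ^ 2) volume 0 1 ∧
        (∀ x ∈ Icc (0 : ℝ) 1, u x t = ∫ y in (0 : ℝ)..x, q y) ∧
        ∫ x in (0 : ℝ)..1, q x ^ 2 ≤ derivBound α) ∧
      (∀ s ∈ A, ∀ t ∈ A, 0 < s → s < t → t < s + 1 → t < n →
        ∫ x in (0 : ℝ)..1, (u x s - u x t) ^ 2 ≤ derivBound α * (t - s) ^ 2) ∧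
      (∀ t ∈ A, 0 < t → t < n → t < 12 → ∀ x ∈ Icc (0 : ℝ) 1, u x t = steady 0 x) ∧
      ∀ t ∈ A, 0 < t → t < n → ∫ x in (0 : ℝ)..1, (u x t - steady α x) ^ 2 ≤
        gapBound α * Real.exp (Real.log 2 * (α + 1 - t)) := by
    intro n
    have hn : (0 : ℝ) ≤ n := n.cast_nonneg
    have hT : (0 : ℝ) < n + 2 := by linarith
    obtain ⟨σ, H⟩ := (hu (n + 2) hT).exists_sol hα0 hT
    have h0 : ∀ t ≤ 0, ∀ x, extend (steady 0) u x t = steady 0 x := fun t ht x =>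
      extend_of_le ht
    obtain ⟨A, hA, hL⟩ := H.exists_lipschitz hα0 hT h0
    have hgrad := H.ae_integral_sq_soft_le hα0 (by linarith) hA hL (H.ae_sq_le_normBound hα0 h0)
    refine ⟨_, (((hA.and hgrad).and (H.ae_integrable_soft.and H.eq_prim)).and
      (H.ae_eq_steady_zero hα hT h0)).and (H.ae_sub_steady_decay hα0 h0), ?_, ?_, ?_, ?_⟩
    · rintro t ⟨⟨⟨⟨-, hg⟩, hi, hp⟩, -⟩, -⟩ ht htn
      have htT : t ∈ Ioo (-1) ((n : ℝ) + 2) := ⟨by linarith, by linarith⟩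
      refine ⟨fun x => soft (σ x t), hi htT, (hg ⟨ht, by linarith⟩).1, fun x hx => ?_,
        (hg ⟨ht, by linarith⟩).2⟩
      rw [← hp htT x hx, extend_of_lt ht]
    · rintro s ⟨⟨⟨⟨hs, -⟩, -⟩, -⟩, -⟩ t ⟨⟨⟨⟨ht, -⟩, -⟩, -⟩, -⟩ h0s hst hst1 htn
      have h1 := hL s hs t ht (by linarith) hst hst1 (by linarith)
      simp only [extend_of_lt h0s, extend_of_lt (h0s.trans hst)] at h1
      exact h1.trans (mul_le_mul_of_nonneg_right (le_derivBound hα0) (sq_nonneg _))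
    · rintro t ⟨⟨-, h⟩, -⟩ ht htn ht12 x hx
      have := h ⟨by linarith, by linarith⟩ ht12 x hx
      rwa [extend_of_lt ht] at this
    · rintro t ⟨-, h⟩ ht htn
      have := h ⟨by linarith, by linarith⟩
      simpa only [extend_of_lt ht] using this
  choose A hA h1 h2 h3 h4 using key
  refine ⟨{t | ∀ n, t ∈ A n}, ae_all_iff.2 hA, fun t ht h0 => ?_, fun s hs t ht h0 hst hst1 => ?_,
    fun t ht h0 => ?_, fun t ht h0 => ?_⟩
  all_goals obtain ⟨n, hn⟩ := exists_nat_gt t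
  · exact h1 n t (ht n) h0 hn
  · exact h2 n s (hs n) t (ht n) h0 hst hst1 hn
  · exact h3 n t (ht n) h0 hn
  · exact h4 n t (ht n) h0 hn

/-! ### The continuous representative -/

lemma sq_sub_primitive_le {q₁ q₂ v₁ v₂ : ℝ → ℝ} (h₁ : IntervalIntegrable q₁ volume 0 1)
    (h₁' : IntervalIntegrable (fun x => q₁ x ^ 2) volume 0 1)
    (h₂ : IntervalIntegrable q₂ volume 0 1)
    (h₂' : IntervalIntegrable (fun x => q₂ x ^ 2) volume 0 1)
    (hv₁ : ∀ x ∈ Icc (0 : ℝ) 1, v₁ x = ∫ y in (0 : ℝ)..x, q₁ y)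
    (hv₂ : ∀ x ∈ Icc (0 : ℝ) 1, v₂ x = ∫ y in (0 : ℝ)..x, q₂ y) {l : ℝ} (hl : 0 < l) {x : ℝ}
    (hx : x ∈ Icc (0 : ℝ) 1) :
    (v₁ x - v₂ x) ^ 2 ≤ l * (∫ y in (0 : ℝ)..1, (v₁ y - v₂ y) ^ 2) +
      l⁻¹ * (2 * (∫ y in (0 : ℝ)..1, q₁ y ^ 2) + 2 * ∫ y in (0 : ℝ)..1, q₂ y ^ 2) := by
  have i2 : IntervalIntegrable (fun y => 2 * q₁ y ^ 2 + 2 * q₂ y ^ 2) volume 0 1 :=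
    (h₁'.const_mul 2).add (h₂'.const_mul 2)
  have hle : ∀ y, (q₁ y - q₂ y) ^ 2 ≤ 2 * q₁ y ^ 2 + 2 * q₂ y ^ 2 := fun y => by
    nlinarith [sq_nonneg (q₁ y + q₂ y)]
  have i1 : IntervalIntegrable (fun y => (q₁ y - q₂ y) ^ 2) volume 0 1 := by
    rw [intervalIntegrable_iff_integrableOn_Ioc_of_le zero_le_one] at i2 h₁ h₂ ⊢
    refine i2.mono' ((h₁.1.sub h₂.1).pow 2) (Eventually.of_forall fun y => ?_)
    rw [Real.norm_eq_abs, abs_of_nonneg (sq_nonneg _)]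
    exact hle y
  have hv : ∀ y ∈ Icc (0 : ℝ) 1, v₁ y - v₂ y = ∫ z in (0 : ℝ)..y, (q₁ z - q₂ z) := fun y hy => by
    have hsub : uIcc 0 y ⊆ uIcc (0 : ℝ) 1 := by
      rw [uIcc_of_le hy.1, uIcc_of_le zero_le_one]; exact Icc_subset_Icc_right hy.2
    rw [hv₁ y hy, hv₂ y hy, intervalIntegral.integral_sub (h₁.mono_set hsub) (h₂.mono_set hsub)]
  refine (sq_primitive_le (v := fun y => v₁ y - v₂ y) (h₁.sub h₂) i1 hv hl hx).trans ?_
  have h3 := intervalIntegral.integral_mono_on zero_le_one i1 i2 fun y _ => hle y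
  rw [intervalIntegral.integral_add (h₁'.const_mul 2) (h₂'.const_mul 2),
    intervalIntegral.integral_const_mul, intervalIntegral.integral_const_mul] at h3
  have h4 := mul_le_mul_of_nonneg_left h3 (inv_pos.2 hl).le
  linarith

/-- A function that is Hölder continuous of exponent `1 / 2` on a set at small distances extends
continuously to the closure of the set. -/
lemma exists_continuousOn_closure {X : Type*} [PseudoMetricSpace X] {f : X → ℝ} {S : Set X} {N : ℝ}
    (hN : 0 ≤ N) (h : ∀ p ∈ S, ∀ q ∈ S, dist p q < 1 → (f p - f q) ^ 2 ≤ N * dist p q) :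
    ∃ g : X → ℝ, ContinuousOn g (closure S) ∧ ∀ p ∈ S, g p = f p := by
  have hmod : ∀ ε > 0, ∃ δ > 0, ∀ p ∈ S, ∀ q ∈ S, dist p q < δ → dist (f p) (f q) < ε := by
    intro ε hε
    refine ⟨min 1 (ε ^ 2 / (N + 1)), lt_min one_pos (by positivity), fun p hp q hq hpq => ?_⟩
    have h1 := h p hp q hq (hpq.trans_le (min_le_left _ _))
    have h2 := hpq.trans_le (min_le_right _ _)
    rw [lt_div_iff₀ (by linarith)] at h2
    rw [Real.dist_eq]
    refine abs_lt_of_sq_lt_sq (h1.trans_lt ?_) hε.le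
    nlinarith [dist_nonneg (x := p) (y := q)]
  have hcont : ContinuousOn f S := fun p hp => by
    refine Metric.continuousWithinAt_iff.2 fun ε hε => ?_
    obtain ⟨δ, hδ, hd⟩ := hmod ε hε
    exact ⟨δ, hδ, fun q hq hqp => hd q hq p hp hqp⟩
  refine ⟨extendFrom S f, continuousOn_extendFrom le_rfl fun p hp => ?_,
    extendFrom_extends hcont⟩
  have : (𝓝[S] p).NeBot := mem_closure_iff_nhdsWithin_neBot.1 hp
  refine cauchy_map_iff_exists_tendsto.1 (Metric.cauchy_iff.2 ⟨inferInstance, fun ε hε => ?_⟩)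
  obtain ⟨δ, hδ, hd⟩ := hmod ε hε
  refine ⟨f '' (S ∩ Metric.ball p (δ / 2)), image_mem_map (inter_mem self_mem_nhdsWithin
    (mem_nhdsWithin_of_mem_nhds (Metric.ball_mem_nhds p (half_pos hδ)))), ?_⟩
  rintro _ ⟨x, ⟨hxS, hx⟩, rfl⟩ _ ⟨y, ⟨hyS, hy⟩, rfl⟩
  refine hd x hxS y hyS ?_
  have := dist_triangle_right x y p
  rw [Metric.mem_ball] at hx hy
  linarith

/-- A function with the space and time regularity of a solution agrees, off a null set of times,
with a continuous function. -/
lemma exists_continuous_eq {u : ℝ → ℝ → ℝ} {A : Set ℝ} {K : ℝ} (hA : ∀ᵐ t, t ∈ A) (hK : 0 ≤ K)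
    (hx : ∀ t ∈ A, 0 < t → ∃ q : ℝ → ℝ, IntervalIntegrable q volume 0 1 ∧
        IntervalIntegrable (fun x => q x ^ 2) volume 0 1 ∧
        (∀ x ∈ Icc (0 : ℝ) 1, u x t = ∫ y in (0 : ℝ)..x, q y) ∧
        ∫ x in (0 : ℝ)..1, q x ^ 2 ≤ K)
    (ht : ∀ s ∈ A, ∀ t ∈ A, 0 < s → s < t → t < s + 1 →
        ∫ x in (0 : ℝ)..1, (u x s - u x t) ^ 2 ≤ K * (t - s) ^ 2) :
    ∃ w : ℝ → ℝ → ℝ, Continuous (Function.uncurry w) ∧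
      ∀ t ∈ A, 0 < t → ∀ x ∈ Icc (0 : ℝ) 1, w x t = u x t := by
  have htime : ∀ s ∈ A, ∀ t ∈ A, 0 < s → s < t → t < s + 1 → ∀ x ∈ Icc (0 : ℝ) 1,
      (u x s - u x t) ^ 2 ≤ 5 * K * (t - s) := by
    intro s hs t htA h0 hst hst1 x hx'
    obtain ⟨q₁, a1, a2, a3, a4⟩ := hx s hs h0
    obtain ⟨q₂, b1, b2, b3, b4⟩ := hx t htA (h0.trans hst)
    have hpos : 0 < t - s := sub_pos.2 hst
    have h1 := sq_sub_primitive_le (v₁ := fun x => u x s) (v₂ := fun x => u x t) a1 a2 b1 b2 a3 b3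
      (inv_pos.2 hpos) hx'
    rw [inv_inv] at h1
    have h2 := mul_le_mul_of_nonneg_left (ht s hs t htA h0 hst hst1) (inv_pos.2 hpos).le
    have e : (t - s)⁻¹ * (K * (t - s) ^ 2) = K * (t - s) := by field_simp
    have h3 := mul_le_mul_of_nonneg_left a4 hpos.le
    have h4 := mul_le_mul_of_nonneg_left b4 hpos.le
    linarith
  have htime' : ∀ s ∈ A, ∀ t ∈ A, 0 < s → 0 < t → dist s t < 1 → ∀ x ∈ Icc (0 : ℝ) 1,
      (u x s - u x t) ^ 2 ≤ 5 * K * dist s t := by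
    intro s hs t htA h0s h0t hd x hx'
    rcases lt_trichotomy s t with h | h | h
    · rw [dist_comm, Real.dist_eq, abs_of_pos (sub_pos.2 h)] at hd ⊢
      exact htime s hs t htA h0s h (by linarith) x hx'
    · simp [h]
    · rw [Real.dist_eq, abs_of_pos (sub_pos.2 h)] at hd ⊢
      have := htime t htA s hs h0t h (by linarith) x hx'
      linarith [show (u x s - u x t) ^ 2 = (u x t - u x s) ^ 2 by ring]
  have hspace : ∀ t ∈ A, 0 < t → ∀ x ∈ Icc (0 : ℝ) 1, ∀ y ∈ Icc (0 : ℝ) 1,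
      (u x t - u y t) ^ 2 ≤ K * dist x y := by
    intro t htA h0 x hx' y hy'
    obtain ⟨q, a1, a2, a3, a4⟩ := hx t htA h0
    wlog hxy : y ≤ x generalizing x y
    · have := this y hy' x hx' (le_of_not_ge hxy)
      rw [dist_comm]
      linarith [show (u x t - u y t) ^ 2 = (u y t - u x t) ^ 2 by ring]
    have hsub : ∀ z ∈ Icc (0 : ℝ) 1, uIcc 0 z ⊆ uIcc (0 : ℝ) 1 := fun z hz => by
      rw [uIcc_of_le hz.1, uIcc_of_le zero_le_one]; exact Icc_subset_Icc_right hz.2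
    rw [a3 x hx', a3 y hy', intervalIntegral.integral_interval_sub_left
      (a1.mono_set (hsub x hx')) (a1.mono_set (hsub y hy')), Real.dist_eq,
      abs_of_nonneg (sub_nonneg.2 hxy)]
    refine (sq_integral_le a1 a2 hy'.1 hxy hx'.2).trans ?_
    have := mul_le_mul_of_nonneg_left a4 (sub_nonneg.2 hxy)
    linarith
  obtain ⟨g, hg, hgu⟩ := exists_continuousOn_closure (f := Function.uncurry u)
    (S := Icc (0 : ℝ) 1 ×ˢ (Ioi 0 ∩ A)) (N := 12 * K) (by linarith) (by
      rintro ⟨x, s⟩ ⟨hx', h0s, hs⟩ ⟨y, t⟩ ⟨hy', h0t, htA⟩ hd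
      simp only [Function.uncurry]
      have hd1 : dist x y ≤ dist (x, s) (y, t) := le_max_left _ _
      have hd2 : dist s t ≤ dist (x, s) (y, t) := le_max_right _ _
      have h1 := htime' s hs t htA h0s h0t (hd2.trans_lt hd) x hx'
      have h2 := hspace t htA h0t x hx' y hy'
      have h3 := mul_le_mul_of_nonneg_left hd1 hK
      have h4 := mul_le_mul_of_nonneg_left hd2 hK
      nlinarith [sq_nonneg ((u x s - u x t) - (u x t - u y t))])
  have hsub : Icc (0 : ℝ) 1 ×ˢ Ici (0 : ℝ) ⊆ closure (Icc (0 : ℝ) 1 ×ˢ (Ioi 0 ∩ A)) := by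
    rw [closure_prod_eq]
    refine prod_mono subset_closure ?_
    rw [← closure_Ioi]
    exact closure_minimal ((Measure.dense_of_ae hA).open_subset_closure_inter isOpen_Ioi)
      isClosed_closure
  refine ⟨fun x t => g (max 0 (min x 1), max t 0), ?_, fun t htA h0 x hx' => ?_⟩
  · refine hg.comp_continuous (f := fun p : ℝ × ℝ => (max 0 (min p.1 1), max p.2 0))
      (by fun_prop) fun p => hsub ⟨⟨le_max_left _ _, ?_⟩, mem_Ici.2 (le_max_right _ _)⟩
    exact max_le zero_le_one (min_le_right _ _)
  · have e1 : max 0 (min x 1) = x := by rw [min_eq_left hx'.2, max_eq_right hx'.1]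
    have e2 : max t 0 = t := max_eq_left h0.le
    simp only [e1, e2]
    exact hgu (x, t) ⟨hx', h0, htA⟩

/-- Convergence to the final state, with constants that depend on `α` only. -/
theorem exists_convergence {α : ℝ} (hα : 12 ≤ α) :
    ∃ C r : ℝ, 0 < r ∧ ∀ u : ℝ → ℝ → ℝ,
      IsGlobalWeakSolution (fun x t => -breakingForce α x t) (steady 0) u →
      ∃ w : ℝ → ℝ → ℝ, ContinuousOn (fun p : ℝ × ℝ => w p.1 p.2) (Icc 0 1 ×ˢ Ici 0) ∧
        (∀ᵐ t ∂(volume.restrict (Ioi (0 : ℝ))), ∀ x ∈ Icc (0 : ℝ) 1, u x t = w x t) ∧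
        (∀ t ∈ Icc (0 : ℝ) 12, ∀ x ∈ Icc (0 : ℝ) 1, w x t = steady 0 x) ∧
        (∀ t : ℝ, 0 ≤ t → Real.sqrt (∫ x in Icc (0 : ℝ) 1, (w x t - steady α x) ^ 2) ≤
          C * Real.exp (-r * t)) ∧
        TendstoUniformlyOn (fun t x => w x t) (steady α) atTop (Icc 0 1) := by
  have hα0 : 0 ≤ α := by linarith
  have hlog := Real.log_pos one_lt_two
  set Y : ℝ := gapBound α * Real.exp (Real.log 2 * (α + 1)) with hY
  have hY0 : 0 ≤ Y := mul_nonneg (gapBound_nonneg hα0) (Real.exp_pos _).le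
  refine ⟨Real.sqrt Y, Real.log 2 / 2, half_pos hlog, fun u hu => ?_⟩
  have hYexp : ∀ t, gapBound α * Real.exp (Real.log 2 * (α + 1 - t)) =
      Y * Real.exp (-(Real.log 2 / 2) * t) ^ 2 := fun t => by
    rw [hY, mul_assoc, ← Real.exp_nat_mul, ← Real.exp_add]
    congr 2
    push_cast
    ring
  obtain ⟨A, hA, hx, ht, hinit, hdec⟩ := hu.exists_estimates hα
  simp only [hYexp] at hdec
  have hK : 0 ≤ derivBound α := by linarith [le_derivBound hα0]
  obtain ⟨w, hw, hwu⟩ := exists_continuous_eq hA hK hx ht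
  have hdense : ∀ {U : Set ℝ}, IsOpen U → U ⊆ closure (U ∩ A) := fun hU =>
    (Measure.dense_of_ae hA).open_subset_closure_inter hU
  have hwt : ∀ x, Continuous fun t => w x t := fun x =>
    hw.comp (continuous_const.prodMk continuous_id)
  have hexp : Continuous fun t : ℝ => Real.exp (-(Real.log 2 / 2) * t) := by fun_prop
  -- closed conditions on the time pass from the good times to all times
  have hclosed : ∀ {P : ℝ → Prop}, IsClosed {t | P t} → (∀ t ∈ A, 0 < t → P t) →
      ∀ t, 0 ≤ t → P t := by
    intro P hP h t h0
    have h1 : Ioi (0 : ℝ) ∩ A ⊆ {t | P t} := fun s hs => h s hs.2 hs.1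
    have h2 : Ici (0 : ℝ) ⊆ {t | P t} := by
      rw [← closure_Ioi]
      exact closure_minimal ((hdense isOpen_Ioi).trans (closure_minimal h1 hP)) hP
    exact h2 h0
  have hw12 : ∀ t ∈ Icc (0 : ℝ) 12, ∀ x ∈ Icc (0 : ℝ) 1, w x t = steady 0 x := by
    intro t ht x hx'
    have hcl : IsClosed {t | w x t = steady 0 x} := isClosed_eq (hwt x) continuous_const
    have h1 : Ioo (0 : ℝ) 12 ∩ A ⊆ {t | w x t = steady 0 x} := fun s hs => by
      exact (hwu s hs.2 hs.1.1 x hx').trans (hinit s hs.2 hs.1.1 hs.1.2 x hx')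
    have h2 : Icc (0 : ℝ) 12 ⊆ {t | w x t = steady 0 x} := by
      rw [← closure_Ioo (by norm_num)]
      exact closure_minimal ((hdense isOpen_Ioo).trans (closure_minimal h1 hcl)) hcl
    exact h2 ht
  have hwL2 : ∀ t, 0 ≤ t → ∫ x in (0 : ℝ)..1, (w x t - steady α x) ^ 2 ≤
      Y * Real.exp (-(Real.log 2 / 2) * t) ^ 2 := by
    refine hclosed (isClosed_le ?_ (continuous_const.mul (hexp.pow 2))) fun t htA h0 => ?_
    · refine intervalIntegral.continuous_parametric_intervalIntegral_of_continuous' ?_ 0 1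
      exact ((hw.comp continuous_swap).sub ((continuous_steady α).comp continuous_snd)).pow 2
    · refine le_of_eq_of_le ?_ (hdec t htA h0)
      refine intervalIntegral.integral_congr fun x hx' => ?_
      rw [uIcc_of_le zero_le_one] at hx'
      simp only [hwu t htA h0 x hx']
  set Z : ℝ := Y + (2 * derivBound α + 2 * ∫ x in (0 : ℝ)..1, steadySlope α x ^ 2) with hZ
  have hwsup : ∀ x ∈ Icc (0 : ℝ) 1, ∀ t, 0 ≤ t →
      (w x t - steady α x) ^ 2 ≤ Z * Real.exp (-(Real.log 2 / 2) * t) := by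
    intro x hx'
    refine hclosed (isClosed_le (((hwt x).sub continuous_const).pow 2)
      (continuous_const.mul hexp)) fun t htA h0 => ?_
    rw [hwu t htA h0 x hx']
    obtain ⟨q, a1, a2, a3, a4⟩ := hx t htA h0
    have hE := Real.exp_pos (-(Real.log 2 / 2) * t)
    -- the weight in the interpolation balances the decay of the `L²` norm
    have h1 := sq_sub_primitive_le (v₁ := fun x => u x t) (v₂ := steady α) a1 a2
      ((continuous_steadySlope α).intervalIntegrable _ _)
      (((continuous_steadySlope α).pow 2).intervalIntegrable _ _) a3 (fun _ _ => rfl)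
      (inv_pos.2 hE) hx'
    rw [inv_inv] at h1
    have h2 := mul_le_mul_of_nonneg_left (hdec t htA h0) (inv_pos.2 hE).le
    have h3 := mul_le_mul_of_nonneg_left a4 hE.le
    have e : (Real.exp (-(Real.log 2 / 2) * t))⁻¹ * (Y * Real.exp (-(Real.log 2 / 2) * t) ^ 2) =
        Y * Real.exp (-(Real.log 2 / 2) * t) := by field_simp
    rw [hZ]
    linarith
  refine ⟨w, hw.continuousOn, ?_, hw12, fun t h0 => ?_, ?_⟩
  · rw [ae_restrict_iff' measurableSet_Ioi]
    filter_upwards [hA] with t htA h0 x hx'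
    exact (hwu t htA h0 x hx').symm
  · rw [integral_Icc_eq_integral_Ioc, ← intervalIntegral.integral_of_le zero_le_one]
    refine (Real.sqrt_le_sqrt (hwL2 t h0)).trans ?_
    rw [Real.sqrt_mul hY0, Real.sqrt_sq (Real.exp_pos _).le]
  · rw [Metric.tendstoUniformlyOn_iff]
    intro ε hε
    have hlim : Tendsto (fun t : ℝ => Z * Real.exp (-(Real.log 2 / 2) * t)) atTop (𝓝 0) := by
      rw [← mul_zero Z]
      refine (Real.tendsto_exp_atBot.comp ?_).const_mul Z
      exact tendsto_id.const_mul_atTop_of_neg (by linarith)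
    filter_upwards [hlim.eventually (gt_mem_nhds (pow_pos hε 2)), eventually_ge_atTop 0]
      with t h1 h0 x hx'
    rw [dist_comm, Real.dist_eq]
    exact abs_lt_of_sq_lt_sq ((hwsup x hx' t h0).trans_lt h1) hε.le

end FacetBreaking

theorem lemmal (α : ℝ) (hα : 12 < α) :
    ∃ u₀ uα : ℝ → ℝ,
      -- the initial state: the steady solution for the force `4`, with a single facet
      FacetBreaking.IsSteadySolution (fun _ => 4) u₀ ∧
      (∀ v, FacetBreaking.IsSteadySolution (fun _ => 4) v → EqOn v u₀ (Icc 0 1)) ∧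
      (∀ a b, FacetBreaking.IsFacet u₀ a b ↔ (a = 1 / 4 ∧ b = 3 / 4)) ∧
      -- the final state: the steady solution for the force `f_α`, with exactly three facets
      FacetBreaking.IsSteadySolution (FacetBreaking.steadyForce α) uα ∧
      (∀ v, FacetBreaking.IsSteadySolution (FacetBreaking.steadyForce α) v →
        EqOn v uα (Icc 0 1)) ∧
      (∃ c e f d : ℝ, 1 / 4 < c ∧ c < 3 / 8 ∧ 3 / 8 < e ∧ e < 1 / 2 ∧ 1 / 2 < f ∧ f < 5 / 8 ∧
        5 / 8 < d ∧ d < 3 / 4 ∧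
        (∀ a b, FacetBreaking.IsFacet uα a b ↔
          (a = 1 / 4 ∧ b = c) ∨ (a = e ∧ b = f) ∨ (a = d ∧ b = 3 / 4)) ∧
        StrictAntiOn uα (Icc 0 (1 / 4)) ∧ StrictMonoOn uα (Icc c e) ∧
        StrictAntiOn uα (Icc f d) ∧ StrictMonoOn uα (Icc (3 / 4) 1)) ∧
      (∀ x ∈ Icc (0 : ℝ) 1, uα (1 - x) = uα x) ∧
      -- the evolution: the constant-in-time state `u₀` is a weak solution up to time `12`
      FacetBreaking.IsWeakSolution 12 (fun x t => -FacetBreaking.breakingForce α x t) u₀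
        (fun x _ => u₀ x) ∧
      -- every global weak solution, after modification on a null set of times, is continuous,
      -- equals `u₀` for `t ≤ 12` and converges to `uα`
      ∃ C r : ℝ, 0 < r ∧ ∀ u : ℝ → ℝ → ℝ,
        FacetBreaking.IsGlobalWeakSolution (fun x t => -FacetBreaking.breakingForce α x t) u₀ u →
        ∃ w : ℝ → ℝ → ℝ,
          ContinuousOn (fun p : ℝ × ℝ => w p.1 p.2) (Icc 0 1 ×ˢ Ici 0) ∧
          (∀ᵐ t ∂(volume.restrict (Ioi (0 : ℝ))), ∀ x ∈ Icc (0 : ℝ) 1, u x t = w x t) ∧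
          (∀ t ∈ Icc (0 : ℝ) 12, ∀ x ∈ Icc (0 : ℝ) 1, w x t = u₀ x) ∧
          (∀ t : ℝ, 0 ≤ t →
            Real.sqrt (∫ x in Icc (0 : ℝ) 1, (w x t - uα x) ^ 2) ≤ C * Real.exp (-r * t)) ∧
          TendstoUniformlyOn (fun t x => w x t) uα atTop (Icc 0 1) := by
  have hzero : FacetBreaking.steadyForce 0 = fun _ => 4 := by
    ext x
    rw [FacetBreaking.steadyForce_eq, zero_mul, add_zero]
  refine ⟨FacetBreaking.steady 0, FacetBreaking.steady α, ?_, fun v hv => ?_,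
    FacetBreaking.isFacet_steady_zero_iff, FacetBreaking.isSteadySolution_steady α,
    fun v hv => FacetBreaking.eqOn_steady hv, FacetBreaking.exists_facets_steady hα,
    fun x _ => FacetBreaking.steady_symm α x, FacetBreaking.isWeakSolution_steady_zero hα,
    FacetBreaking.exists_convergence hα.le⟩
  · rw [← hzero]
    exact FacetBreaking.isSteadySolution_steady 0
  · rw [← hzero] at hv
    exact FacetBreaking.eqOn_steady hv
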